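/- **Setting.** Let $\mathbb F$ be a field, $G$ a finite group with unit $1$, $G_*$ the set of its conjugacy classes, and $m>0$. For a set $M$ let $\Gamma(n,M)$ be the set of $n\times n$ matrices with entries in $M\cup\{0\}$ having at most one nonzero entry in each row and each column. $\overline G_n=\Gamma(n,G)$ is a semigroup under matrix multiplication (with $x+0=0+x=x$, $x0=0x=0$). It contains the wreath product $G_n=G\wr S_n$, where $(g,\sigma)\in G^n\rtimes S_n$ is the matrix with entries $g_{\sigma(j)}$ in position $(\sigma(j),j)$. Let $\varepsilon_i\in\overline G_n$ be the diagonal matrix with $(i,i)$ entry $0$ and other diagonal entries $1$, and $\overline\varepsilon_T=\prod_{i\in T}(1-\varepsilon_i)\in\mathbb F\overline G_n$. For $n\ge m$ let $\overline{\mathcal Z}_{m,n}$ be the centralizer in $\mathbb F\overline G_n$ of the set of $\gamma\in\overline G_n$ whose first $m$ diagonal entries are $1$. Let $\theta_n:\mathbb F\overline G_n\to\mathbb F\overline G_{n-1}$ be the linear map taking each matrix to its upper left corner of order $n-1$. For $\gamma\in\overline G_n$ put $\deg\gamma=|\{k:\gamma_{kk}\ne1\}|$ and $\deg_m\gamma=|\{k>m:\gamma_{kk}\neq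 1\}|$; the degree ($m$-degree) of an element of $\mathbb F\overline G_n$ is the maximum over the matrices occurring in it. $\overline{\mathcal Z}_m$ is the algebra of sequences $\alpha=(\alpha_n)_{n\ge m}$ with $\alpha_n\in\overline{\mathcal Z}_{m,n}$, $\theta_n(\alpha_n)=\alpha_{n-1}$ for $n>m$, and $\sup_n\deg\alpha_n<\infty$, under componentwise operations. For $k\ge 0$, $\Gamma^k_m(\overline{\mathcal Z}_m)$ is the subspace of those $\alpha$ with $\deg_m\alpha_n\le k$ for all $n$. **The elements.** For $\Omega\in\Gamma(m,G\times\mathbb Z_+)$ let $\mathrm{ord}(\Omega)$ be the sum of the $\mathbb Z_+$-components of its nonzero entries. Let $\mathcal P(G_*)$ be the set of families $\rho=(\rho(C))_{C\in G_*}$ of partitions, and $\|\rho\|=\sum_C|\rho(C)|$. For $T\subseteq\{1,\dots,n\}$ with $|T|=\|\rho\|$, let $C^\rho_{n,T}\in\mathbb FG_n$ be the following sum. It runs over all ways of filling, with the elements of $T$, each used exactly once, sequences $(k^C_{s,1},\dots,k^C_{s,\mu_s})$, one for each $C\in G_*$ and each part $\mu_s$ of $\rho(C)$; and over all $g\in G^n$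 with $g_j=1$ for $j\notin T$ and $g_{k^C_{s,\mu_s}}\cdots g_{k^C_{s,1}}\in C$ for all $C,s$. The summand is $(g,\sigma)$, where $\sigma$ is the product of the cycles $(k^C_{s,1}\,\cdots\,k^C_{s,\mu_s})$. Let $c^\rho_{n,T}$ be the sum of the distinct elements of $G_n$ occurring in $C^\rho_{n,T}$, each taken once. For $P\subseteq\{m+1,\dots,n\}$ let $\Gamma(\Omega,P)$ be the set of $\gamma\in\overline G_n$ satisfying the following conditions. * The $i$th row and the $i$th column of $\gamma$ are nonzero for all $i>m$. * For $1\le i,j\le m$: $\Omega_{ij}=(\gamma_{ip_r}\gamma_{p_rp_{r-1}}\cdots\gamma_{p_1j},\,r)$ if there are $r\ge0$ and $p_1,\dots,p_r>m$ making this product nonzero (for $r=0$ the product is $\gamma_{ij}$), and $\Omega_{ij}=0$ otherwise. * $P$ is the set of all indices $p_1,\dots,p_r$ that occur in this way. * $\gamma_{pp}=1$ for all $p>m$ with $p\notin P$. Put $$\Delta_n^{\Omega,\rho}=\sum_{P,T}\ \sum_{\gamma\in\Gamma(\Omega,P)}\overline\varepsilon_P\,\gamma\, C^\rho_{n,T}\,\overline\varepsilon_T\,\overline\varepsilon_P,$$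 where $P,T$ run over the disjoint subsets of $\{m+1,\dots,n\}$ with $|P|=\mathrm{ord}(\Omega)$, $|T|=\|\rho\|$ (so that $\Delta_n^{\Omega,\rho}=0$ if $\mathrm{ord}(\Omega)+\|\rho\|>n-m$), and $\Delta^{\Omega,\rho}=(\Delta^{\Omega,\rho}_n)_{n\ge m}$. Let $\widetilde\Delta^{\Omega,\rho}$ be defined in the same way with $c^\rho_{n,T}$ in place of $C^\rho_{n,T}$. **Theorem.** 1. If $\mathbb F$ has characteristic $0$, then the $\Delta^{\Omega,\rho}$, with $\Omega\in\Gamma(m,G\times\mathbb Z_+)$ and $\rho\in\mathcal P(G_*)$, lie in $\overline{\mathcal Z}_m$ and form a basis of it. For every $k\ge0$, those with $\mathrm{ord}(\Omega)+\|\rho\|\le k$ form a basis of $\Gamma_m^k(\overline{\mathcal Z}_m)$. 2. For an arbitrary field $\mathbb F$, the same two assertions hold with $\widetilde\Delta^{\Omega,\rho}$ in place of $\Delta^{\Omega,\rho}$. -/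

import Mathlib

namespace WreathCentralizer

/-- An `n × n` matrix with entries in `M ∪ {0}` such that every row and every column has at most
one nonzero entry. With `M = G` this is the semigroup `Ḡ_n`; with `M = G × ℤ₊` and `n = m` this is
the set `Γ(m, G × ℤ₊)`. -/
@[ext]
structure PartialMonomial (n : ℕ) (M : Type*) where
  entry : Matrix (Fin n) (Fin n) (WithZero M)
  row_unique : ∀ i j j', entry i j ≠ 0 → entry i j' ≠ 0 → j = j'
  col_unique : ∀ i i' j, entry i j ≠ 0 → entry i' j ≠ 0 → i = i'

namespace PartialMonomial

section Multiplication

variable {n : ℕ} {G : Type*} [Group G]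

open scoped Classical in
/-- The `(i, j)` entry of the matrix product: the sum over `k` of `a i k * b k j`, where
`x + 0 = 0 + x = x`. At most one of the summands is nonzero. -/
noncomputable def mulEntry (a b : PartialMonomial n G) (i j : Fin n) : WithZero G :=
  if h : ∃ k, a.entry i k * b.entry k j ≠ 0 then a.entry i h.choose * b.entry h.choose j else 0

theorem mulEntry_eq (a b : PartialMonomial n G) {i j k : Fin n}
    (h : a.entry i k * b.entry k j ≠ 0) :
    mulEntry a b i j = a.entry i k * b.entry k j := by
  have h' : ∃ k, a.entry i k * b.entry k j ≠ 0 := ⟨k, h⟩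
  have hk : h'.choose = k :=
    a.row_unique i _ _ (left_ne_zero_of_mul h'.choose_spec) (left_ne_zero_of_mul h)
  rw [mulEntry, dif_pos h', hk]

theorem exists_of_mulEntry_ne (a b : PartialMonomial n G) {i j : Fin n}
    (h : mulEntry a b i j ≠ 0) : ∃ k, a.entry i k * b.entry k j ≠ 0 := by
  by_contra h'
  exact h (by rw [mulEntry, dif_neg h'])

noncomputable instance : Mul (PartialMonomial n G) where
  mul a b :=
    { entry := mulEntry a b
      row_unique := by
        intro i j j' h h'
        obtain ⟨k, hk⟩ := exists_of_mulEntry_ne a b h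
        obtain ⟨k', hk'⟩ := exists_of_mulEntry_ne a b h'
        obtain rfl := a.row_unique i k k' (left_ne_zero_of_mul hk) (left_ne_zero_of_mul hk')
        exact b.row_unique k j j' (right_ne_zero_of_mul hk) (right_ne_zero_of_mul hk')
      col_unique := by
        intro i i' j h h'
        obtain ⟨k, hk⟩ := exists_of_mulEntry_ne a b h
        obtain ⟨k', hk'⟩ := exists_of_mulEntry_ne a b h'
        obtain rfl := b.col_unique k k' j (right_ne_zero_of_mul hk) (right_ne_zero_of_mul hk')
        exact a.col_unique i i' k (left_ne_zero_of_mul hk) (left_ne_zero_of_mul hk') }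

instance : One (PartialMonomial n G) where
  one :=
    { entry := fun i j => if i = j then 1 else 0
      row_unique := by
        intro i j j' h h'
        simp only [ne_eq, ite_eq_right_iff, Classical.not_imp] at h h'
        exact h.1.symm.trans h'.1
      col_unique := by
        intro i i' j h h'
        simp only [ne_eq, ite_eq_right_iff, Classical.not_imp] at h h'
        exact h.1.trans h'.1.symm }

theorem one_entry (i j : Fin n) :
    (1 : PartialMonomial n G).entry i j = if i = j then 1 else 0 := rfl

theorem mul_entry_eq (a b : PartialMonomial n G) {i j k : Fin n}
    (h : a.entry i k * b.entry k j ≠ 0) :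
    (a * b).entry i j = a.entry i k * b.entry k j := mulEntry_eq a b h

theorem exists_of_mul_entry_ne (a b : PartialMonomial n G) {i j : Fin n}
    (h : (a * b).entry i j ≠ 0) :
    ∃ k, a.entry i k * b.entry k j ≠ 0 ∧ (a * b).entry i j = a.entry i k * b.entry k j := by
  obtain ⟨k, hk⟩ := exists_of_mulEntry_ne a b h
  exact ⟨k, hk, mulEntry_eq a b hk⟩

/-- Two matrices agree as soon as each nonzero entry of one is an entry of the other. -/
theorem ext_of_ne {n : ℕ} {M : Type*} {a b : PartialMonomial n M}
    (h : ∀ i j, a.entry i j ≠ 0 → b.entry i j = a.entry i j)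
    (h' : ∀ i j, b.entry i j ≠ 0 → a.entry i j = b.entry i j) : a = b := by
  apply PartialMonomial.ext
  funext i j
  by_cases ha : a.entry i j = 0
  · by_cases hb : b.entry i j = 0
    · rw [ha, hb]
    · exact h' i j hb
  · exact (h i j ha).symm

noncomputable instance : Monoid (PartialMonomial n G) where
  one_mul a := by
    apply ext_of_ne
    · intro i j h
      obtain ⟨k, hk, he⟩ := exists_of_mul_entry_ne _ _ h
      have hik : i = k := by
        by_contra hne
        exact hk (by rw [one_entry, if_neg hne, zero_mul])
      subst hik
      rw [he, one_entry, if_pos rfl, one_mul]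
    · intro i j h
      have : (1 : PartialMonomial n G).entry i i * a.entry i j = a.entry i j := by
        rw [one_entry, if_pos rfl, one_mul]
      rw [mul_entry_eq (k := i) _ _ (by rwa [this]), this]
  mul_one a := by
    apply ext_of_ne
    · intro i j h
      obtain ⟨k, hk, he⟩ := exists_of_mul_entry_ne _ _ h
      have hik : k = j := by
        by_contra hne
        exact hk (by rw [one_entry, if_neg hne, mul_zero])
      subst hik
      rw [he, one_entry, if_pos rfl, mul_one]
    · intro i j h
      have : a.entry i j * (1 : PartialMonomial n G).entry j j = a.entry i j := by
        rw [one_entry, if_pos rfl, mul_one]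
      rw [mul_entry_eq (k := j) _ _ (by rwa [this]), this]
  mul_assoc a b c := by
    apply ext_of_ne
    · intro i j h
      obtain ⟨k, hk, he⟩ := exists_of_mul_entry_ne _ _ h
      obtain ⟨l, hl, he'⟩ := exists_of_mul_entry_ne _ _ (left_ne_zero_of_mul hk)
      rw [he'] at hk he
      rw [mul_assoc] at hk he
      have hbc := mul_entry_eq b c (i := l) (j := j) (k := k) (right_ne_zero_of_mul hk)
      rw [← hbc] at hk he
      rw [mul_entry_eq a (b * c) hk, he]
    · intro i j h
      obtain ⟨k, hk, he⟩ := exists_of_mul_entry_ne _ _ h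
      obtain ⟨l, hl, he'⟩ := exists_of_mul_entry_ne _ _ (right_ne_zero_of_mul hk)
      rw [he'] at hk he
      rw [← mul_assoc] at hk he
      have hab := mul_entry_eq a b (i := i) (j := l) (k := k) (left_ne_zero_of_mul hk)
      rw [← hab] at hk he
      rw [mul_entry_eq (a * b) c hk, he]

/-- The diagonal idempotent `ε_i`: its `(i, i)` entry is `0`, its other diagonal entries are `1`. -/
def eps (i : Fin n) : PartialMonomial n G where
  entry a b := if a = b ∧ a ≠ i then 1 else 0
  row_unique := by
    intro a b b' h h'
    simp only [ne_eq, ite_eq_right_iff, Classical.not_imp] at h h'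
    exact h.1.1.symm.trans h'.1.1
  col_unique := by
    intro a a' b h h'
    simp only [ne_eq, ite_eq_right_iff, Classical.not_imp] at h h'
    exact h.1.1.trans h'.1.1.symm

theorem eps_entry (i a b : Fin n) :
    (eps i : PartialMonomial n G).entry a b = if a = b ∧ a ≠ i then 1 else 0 := rfl

/-- Left multiplication by `ε_i` replaces the `i`th row by zero. -/
theorem eps_mul_entry (x : PartialMonomial n G) (i a b : Fin n) :
    (eps i * x).entry a b = if a = i then 0 else x.entry a b := by
  by_cases hab : (eps i * x).entry a b = 0
  · rw [hab]
    split_ifs with ha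
    · rfl
    · by_contra hx
      have : (eps i : PartialMonomial n G).entry a a * x.entry a b = x.entry a b := by
        rw [eps_entry, if_pos ⟨rfl, ha⟩, one_mul]
      have h2 := mul_entry_eq (eps i) x (i := a) (j := b) (k := a)
        (by rw [this]; exact fun h => hx h.symm)
      rw [hab, this] at h2
      exact hx h2
  · obtain ⟨k, hk, he⟩ := exists_of_mul_entry_ne _ _ hab
    rw [eps_entry] at hk he
    split_ifs at hk he with h
    · rw [he, if_neg h.2, h.1, one_mul]
    · simp at hk

/-- Right multiplication by `ε_i` replaces the `i`th column by zero. -/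
theorem mul_eps_entry (x : PartialMonomial n G) (i a b : Fin n) :
    (x * eps i).entry a b = if b = i then 0 else x.entry a b := by
  by_cases hab : (x * eps i).entry a b = 0
  · rw [hab]
    split_ifs with ha
    · rfl
    · by_contra hx
      have : x.entry a b * (eps i : PartialMonomial n G).entry b b = x.entry a b := by
        rw [eps_entry, if_pos ⟨rfl, ha⟩, mul_one]
      have h2 := mul_entry_eq x (eps i) (i := a) (j := b) (k := b)
        (by rw [this]; exact fun h => hx h.symm)
      rw [hab, this] at h2
      exact hx h2
  · obtain ⟨k, hk, he⟩ := exists_of_mul_entry_ne _ _ hab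
    rw [eps_entry] at hk he
    split_ifs at hk he with h
    · rw [he, if_neg (h.1 ▸ h.2), h.1, mul_one]
    · simp at hk

theorem eps_commute (i j : Fin n) :
    Commute (eps i : PartialMonomial n G) (eps j) := by
  apply PartialMonomial.ext
  funext a b
  rw [eps_mul_entry, mul_eps_entry, eps_entry]
  by_cases hab : a = b
  · subst hab
    by_cases h1 : a = i <;> by_cases h2 : a = j <;> simp [h1, h2]
  · simp [hab]

/-- The element `Δ(g) M(σ)` of the wreath product `G_n` attached to `(g, σ)`: its nonzero entries
are `g_{σ(j)}` in position `(σ(j), j)`. -/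
def wreath (g : Fin n → G) (σ : Equiv.Perm (Fin n)) : PartialMonomial n G where
  entry i j := if σ j = i then (g i : WithZero G) else 0
  row_unique := by
    intro i j j' h h'
    simp only [ne_eq, ite_eq_right_iff, Classical.not_imp] at h h'
    exact σ.injective (h.1.trans h'.1.symm)
  col_unique := by
    intro i i' j h h'
    simp only [ne_eq, ite_eq_right_iff, Classical.not_imp] at h h'
    exact h.1.symm.trans h'.1

end Multiplication

/-- The canonical projection `θ_{n+1} : Ḡ_{n+1} → Ḡ_n` onto the upper left corner of order `n`. -/
def trunc {n : ℕ} {M : Type*} (a : PartialMonomial (n + 1) M) : PartialMonomial n M where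
  entry i j := a.entry i.castSucc j.castSucc
  row_unique _ _ _ h h' := Fin.castSucc_injective n (a.row_unique _ _ _ h h')
  col_unique _ _ _ h h' := Fin.castSucc_injective n (a.col_unique _ _ _ h h')

theorem trunc_entry {n : ℕ} {M : Type*} (a : PartialMonomial (n + 1) M) (i j : Fin n) :
    a.trunc.entry i j = a.entry i.castSucc j.castSucc := rfl

section Truncation

variable {n : ℕ} {G : Type*} [Group G]

theorem trunc_one : (1 : PartialMonomial (n + 1) G).trunc = 1 := by
  apply PartialMonomial.ext
  funext i j
  rw [trunc_entry, one_entry, one_entry]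
  simp only [Fin.castSucc_inj]

theorem trunc_mul_eps (a : PartialMonomial (n + 1) G) : (a * eps (Fin.last n)).trunc = a.trunc := by
  apply PartialMonomial.ext
  funext i j
  rw [trunc_entry, trunc_entry, mul_eps_entry, if_neg (Fin.castSucc_ne_last j)]

theorem trunc_mul_eps_mul (a b : PartialMonomial (n + 1) G) :
    (a * eps (Fin.last n) * b).trunc = a.trunc * b.trunc := by
  apply ext_of_ne
  · intro i j h
    rw [trunc_entry] at h
    obtain ⟨k, hk, he⟩ := exists_of_mul_entry_ne _ _ h
    rw [mul_eps_entry] at hk he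
    split_ifs at hk he with hl
    · simp at hk
    · obtain ⟨k', rfl⟩ := Fin.exists_castSucc_eq.2 hl
      exact (mul_entry_eq a.trunc b.trunc (k := k') hk).trans he.symm
  · intro i j h
    obtain ⟨k, hk, he⟩ := exists_of_mul_entry_ne _ _ h
    have : (a * eps (Fin.last n)).entry i.castSucc k.castSucc = a.trunc.entry i k := by
      rw [mul_eps_entry, if_neg (Fin.castSucc_ne_last k), trunc_entry]
    rw [he, trunc_entry, mul_entry_eq (k := k.castSucc), this, ← trunc_entry b]
    rw [this, ← trunc_entry b]
    exact hk

end Truncation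

open scoped Classical in
/-- `deg(γ)`, the number of `k` with `γ_{kk} ≠ 1`. -/
noncomputable def deg {n : ℕ} {G : Type*} [Group G] (γ : PartialMonomial n G) : ℕ :=
  (Finset.univ.filter fun k : Fin n => γ.entry k k ≠ 1).card

open scoped Classical in
/-- The `m`-degree `deg_m(γ)`, the number of `k` among the last `n - m` indices with
`γ_{kk} ≠ 1`. -/
noncomputable def mdeg {n : ℕ} {G : Type*} [Group G] (m : ℕ) (γ : PartialMonomial n G) : ℕ :=
  (Finset.univ.filter fun k : Fin n => m ≤ k.val ∧ γ.entry k k ≠ 1).card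

theorem mul_entry_diag {n : ℕ} {G : Type*} [Group G] {a b : PartialMonomial n G} {k : Fin n}
    (ha : a.entry k k = 1) (hb : b.entry k k = 1) : (a * b).entry k k = 1 := by
  rw [mul_entry_eq (k := k) _ _ (by rw [ha, hb, one_mul]; exact one_ne_zero), ha, hb, one_mul]

theorem deg_mul_le {n : ℕ} {G : Type*} [Group G] (a b : PartialMonomial n G) :
    (a * b).deg ≤ a.deg + b.deg := by
  classical
  unfold deg
  refine le_trans (Finset.card_le_card ?_) (Finset.card_union_le _ _)
  intro k hk
  simp only [Finset.mem_filter, Finset.mem_univ, true_and, Finset.mem_union] at hk ⊢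
  by_contra h
  rw [not_or, not_not, not_not] at h
  exact hk (mul_entry_diag h.1 h.2)

theorem deg_one {n : ℕ} {G : Type*} [Group G] : (1 : PartialMonomial n G).deg = 0 := by
  classical
  simp [deg, one_entry]

instance {n : ℕ} {M : Type*} [Finite M] : Finite (PartialMonomial n M) := by
  have : Finite (WithZero M) := inferInstanceAs (Finite (Option M))
  exact Finite.of_injective (β := Fin n → Fin n → WithZero M) (fun a => a.entry)
    (fun a b h => PartialMonomial.ext h)

noncomputable instance {n : ℕ} {M : Type*} [Finite M] : Fintype (PartialMonomial n M) :=
  Fintype.ofFinite _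

/-- The order of an entry of a matrix over `(G × ℤ₊) ∪ {0}`: `ord(g, z^k) = k`, and zero entries
contribute nothing. -/
def ordEntry {G : Type*} : WithZero (G × Multiplicative ℕ) → ℕ :=
  WithZero.recZeroCoe 0 fun x => x.2.toAdd

/-- `ord(Ω)`, the sum of the orders of the nonzero entries of `Ω ∈ Γ(m, G × ℤ₊)`. -/
def ord {m : ℕ} {G : Type*} (Ω : PartialMonomial m (G × Multiplicative ℕ)) : ℕ :=
  ∑ i, ∑ j, ordEntry (Ω.entry i j)

end PartialMonomial

open PartialMonomial

/-! ### The algebras `F Ḡ_n`, the centralizers and their projective limit -/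

section Algebra

variable (F : Type*) [Field F] (G : Type*) [Group G]

/-- The subsemigroup `Ḡ'_{n-m}` of `Ḡ_n`: the matrices whose first `m` diagonal entries are `1`. -/
def lowerSemigroup (m n : ℕ) : Set (PartialMonomial n G) :=
  {γ | ∀ i : Fin n, i.val < m → γ.entry i i = 1}

/-- The centralizer of `Ḡ'_{n-m}` in the semigroup algebra `F Ḡ_n`. -/
noncomputable def centralizer (m n : ℕ) : Subalgebra F (MonoidAlgebra F (PartialMonomial n G)) :=
  Subalgebra.centralizer F (MonoidAlgebra.of F (PartialMonomial n G) '' lowerSemigroup G m n)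

variable {F G}

/-- The linear extension `θ_{n+1} : F Ḡ_{n+1} → F Ḡ_n` of the canonical projection. -/
noncomputable def theta {n : ℕ} :
    MonoidAlgebra F (PartialMonomial (n + 1) G) →ₗ[F] MonoidAlgebra F (PartialMonomial n G) where
  toFun := MonoidAlgebra.mapDomain trunc
  map_add' := MonoidAlgebra.mapDomain_add _
  map_smul' c x := by
    apply MonoidAlgebra.coeff_injective
    simp

theorem theta_single {n : ℕ} (γ : PartialMonomial (n + 1) G) (r : F) :
    theta (MonoidAlgebra.single γ r) = MonoidAlgebra.single γ.trunc r :=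
  MonoidAlgebra.mapDomain_single

theorem theta_one {n : ℕ} : theta (1 : MonoidAlgebra F (PartialMonomial (n + 1) G)) = 1 := by
  rw [MonoidAlgebra.one_def, theta_single, trunc_one, ← MonoidAlgebra.one_def]

theorem theta_mul_eps {n : ℕ} (x : MonoidAlgebra F (PartialMonomial (n + 1) G)) :
    theta (x * MonoidAlgebra.of F _ (eps (Fin.last n))) = theta x := by
  induction x using MonoidAlgebra.induction_linear with
  | zero => rw [zero_mul]
  | add f g hf hg => rw [add_mul, map_add, map_add, hf, hg]
  | single a b =>
    rw [MonoidAlgebra.of_apply, MonoidAlgebra.single_mul_single, theta_single, theta_single,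
      trunc_mul_eps, mul_one]

theorem theta_mul_eps_mul {n : ℕ} (x y : MonoidAlgebra F (PartialMonomial (n + 1) G)) :
    theta (x * MonoidAlgebra.of F _ (eps (Fin.last n)) * y) = theta x * theta y := by
  induction x using MonoidAlgebra.induction_linear with
  | zero => rw [zero_mul, zero_mul, map_zero, zero_mul]
  | add f g hf hg => rw [add_mul, add_mul, map_add, map_add, hf, hg, add_mul]
  | single a b =>
    induction y using MonoidAlgebra.induction_linear with
    | zero => rw [mul_zero, map_zero, mul_zero]
    | add f g hf hg => rw [mul_add, map_add, map_add, hf, hg, mul_add]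
    | single c d =>
      rw [MonoidAlgebra.of_apply, MonoidAlgebra.single_mul_single,
        MonoidAlgebra.single_mul_single, theta_single, theta_single, theta_single,
        MonoidAlgebra.single_mul_single, trunc_mul_eps_mul, mul_one]

/-- On the centralizers `θ_{n+1}` is multiplicative. -/
theorem theta_mul {m n : ℕ} (hmn : m ≤ n) {x y : MonoidAlgebra F (PartialMonomial (n + 1) G)}
    (hy : y ∈ centralizer F G m (n + 1)) : theta (x * y) = theta x * theta y := by
  have he : (eps (Fin.last n) : PartialMonomial (n + 1) G) ∈ lowerSemigroup G m (n + 1) := by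
    intro i hi
    rw [eps_entry, if_pos]
    refine ⟨rfl, fun h => ?_⟩
    rw [h, Fin.val_last] at hi
    omega
  have hc := (Subalgebra.mem_centralizer_iff F).1 hy _ (Set.mem_image_of_mem _ he)
  rw [← theta_mul_eps_mul, mul_assoc, hc, ← mul_assoc, theta_mul_eps]

variable (F G)

/-- The projective limit `Z̄_m` of the centralizers `Z̄_{m,n}`, `n ≥ m`, in the category of filtered
algebras: sequences `(α_n)_{n ≥ m}`, written with `n = m + l`, with `α_n ∈ Z̄_{m,n}`,
`θ_{n+1}(α_{n+1}) = α_n` and bounded degree, with componentwise operations. -/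
def limitCentralizer (m : ℕ) :
    Subalgebra F (∀ l : ℕ, MonoidAlgebra F (PartialMonomial (m + l) G)) where
  carrier := {α | (∀ l, α l ∈ centralizer F G m (m + l)) ∧
    (∀ l, theta (n := m + l) (α (l + 1)) = α l) ∧
    ∃ d : ℕ, ∀ l, ∀ γ ∈ (α l).coeff.support, γ.deg ≤ d}
  mul_mem' := by
    classical
    rintro α β ⟨hα, hα', d, hd⟩ ⟨hβ, hβ', e, he⟩
    refine ⟨fun l => mul_mem (hα l) (hβ l), fun l => ?_, d + e, fun l γ hγ => ?_⟩
    · rw [Pi.mul_apply, theta_mul (Nat.le_add_right m l) (hβ (l + 1)), hα', hβ', Pi.mul_apply]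
    · obtain ⟨a, ha, b, hb, rfl⟩ := Finset.mem_mul.1 (MonoidAlgebra.support_coeff_mul_subset _ _ hγ)
      exact (deg_mul_le a b).trans (add_le_add (hd l a ha) (he l b hb))
  add_mem' := by
    classical
    rintro α β ⟨hα, hα', d, hd⟩ ⟨hβ, hβ', e, he⟩
    refine ⟨fun l => add_mem (hα l) (hβ l), fun l => ?_, d + e, fun l γ hγ => ?_⟩
    · rw [Pi.add_apply, map_add, hα', hβ', Pi.add_apply]
    · rcases Finset.mem_union.1 (Finsupp.support_add hγ) with h | h
      · exact (hd l γ h).trans (Nat.le_add_right d e)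
      · exact (he l γ h).trans (Nat.le_add_left e d)
  algebraMap_mem' := by
    intro r
    have hr : ∀ l, algebraMap F (∀ l : ℕ, MonoidAlgebra F (PartialMonomial (m + l) G)) r l
        = r • 1 := fun l => Algebra.algebraMap_eq_smul_one r
    refine ⟨fun l => Subalgebra.algebraMap_mem _ r, fun l => ?_, 0, fun l γ hγ => ?_⟩
    · rw [hr, hr, map_smul]
      exact congrArg _ theta_one
    · rw [hr, MonoidAlgebra.coeff_smul] at hγ
      have h1 := Finsupp.support_smul hγ
      rw [MonoidAlgebra.one_def, MonoidAlgebra.coeff_single] at h1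
      have h2 := Finset.mem_singleton.1 (Finsupp.support_single_subset h1)
      rw [h2, deg_one]

/-- The `k`th term of the `m`-degree filtration of `Z̄_m`: the sequences all of whose components
are combinations of matrices of `m`-degree at most `k`. -/
def mdegFiltration (m k : ℕ) : Submodule F (limitCentralizer F G m) where
  carrier := {α | ∀ l, ∀ γ ∈ (α.1 l).coeff.support, γ.mdeg m ≤ k}
  add_mem' := by
    classical
    intro α β hα hβ l γ hγ
    rcases Finset.mem_union.1 (Finsupp.support_add hγ) with h | h
    · exact hα l γ h
    · exact hβ l γ h
  zero_mem' := by
    intro l γ hγ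
    simp at hγ
  smul_mem' := by
    intro c α hα l γ hγ
    exact hα l γ (Finsupp.support_smul hγ)

end Algebra

/-! ### Families of partitions and the elements `C^ρ_{n,T}` -/

section Partitions

variable (G : Type*) [Group G]

/-- `P(G_*)`: the families of partitions, of arbitrary sizes, indexed by the conjugacy classes
of `G`. -/
abbrev PartitionFamily : Type _ := ConjClasses G → Σ k : ℕ, k.Partition

variable {G}

open scoped Classical in
/-- `‖ρ‖`, the sum over the conjugacy classes `C` of the sizes `|ρ(C)|`. -/
noncomputable def PartitionFamily.norm [Fintype G] (ρ : PartitionFamily G) : ℕ :=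
  ∑ C, (ρ C).1

/-- The parts of `ρ(C)` in decreasing order. -/
def PartitionFamily.partList (ρ : PartitionFamily G) (C : ConjClasses G) : List ℕ :=
  (ρ C).2.parts.sort (· ≥ ·)

/-- The positions `(C, s, a)` of the indices `k^C_{s,a}`, where `s` runs over the parts `μ_s` of
`ρ(C)` and `a` over `1, …, μ_s`. -/
abbrev PartitionFamily.Slots (ρ : PartitionFamily G) : Type _ :=
  Σ C : ConjClasses G, Σ s : Fin (ρ.partList C).length, Fin ((ρ.partList C).get s)

/-- The cyclic shift `(C, s, a) ↦ (C, s, a + 1)`. -/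
def PartitionFamily.shift (ρ : PartitionFamily G) : Equiv.Perm ρ.Slots :=
  Equiv.sigmaCongrRight fun C => Equiv.sigmaCongrRight fun s =>
    finRotate ((ρ.partList C).get s)

/-- The product of the disjoint cycles `(k^C_{s,1}, …, k^C_{s,μ_s})` in `S_n`. -/
noncomputable def cyclePerm {n : ℕ} (ρ : PartitionFamily G) (k : ρ.Slots ↪ Fin n) :
    Equiv.Perm (Fin n) :=
  ρ.shift.viaEmbedding k

/-- The data `(k, g)` over which the sum `C^ρ_{n,T}` is taken: the pairwise distinct indices `k`
fill up `T`, the cycle product `g_{k_μ} ⋯ g_{k_1}` of each cycle lies in the conjugacy class to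
which the cycle belongs, and `g_j = 1` for `j ∉ T`. -/
def IsCycleData {n : ℕ} (ρ : PartitionFamily G) (T : Finset (Fin n)) (k : ρ.Slots ↪ Fin n)
    (g : Fin n → G) : Prop :=
  Set.range k = (T : Set (Fin n)) ∧
  (∀ (C : ConjClasses G) (s : Fin (ρ.partList C).length),
    ConjClasses.mk (List.ofFn fun a => g (k ⟨C, s, a⟩)).reverse.prod = C) ∧
  ∀ j, j ∉ T → g j = 1

variable (F : Type*) [Field F] [Fintype G]

open scoped Classical in
/-- `C^ρ_{n,T} = ∑ (g, (k^1_{1,1}, …) ⋯)`, the sum over all data `(k, g)`; an element of `G_n` is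
counted once for each way of writing it. -/
noncomputable def cycleSum {n : ℕ} (ρ : PartitionFamily G) (T : Finset (Fin n)) :
    MonoidAlgebra F (PartialMonomial n G) :=
  ∑ k : ρ.Slots ↪ Fin n, ∑ g ∈ Finset.univ.filter (IsCycleData ρ T k),
    MonoidAlgebra.of F _ (wreath g (cyclePerm ρ k))

open scoped Classical in
/-- The multiplicity-free variant of `C^ρ_{n,T}`: the sum of the distinct elements of `G_n` that
occur in `C^ρ_{n,T}`, each with coefficient one. -/
noncomputable def reducedCycleSum {n : ℕ} (ρ : PartitionFamily G) (T : Finset (Fin n)) :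
    MonoidAlgebra F (PartialMonomial n G) :=
  ∑ γ ∈ Finset.univ.filter (fun γ : PartialMonomial n G =>
      ∃ k g, IsCycleData ρ T k g ∧ γ = wreath g (cyclePerm ρ k)),
    MonoidAlgebra.of F _ γ

end Partitions

/-! ### The elements `Δ^{Ω,ρ}` -/

section Delta

variable {G : Type*} [Group G] {m l : ℕ}

/-- `pathProd γ [p₁, …, p_k] j i = γ_{i p_k} γ_{p_k p_{k-1}} ⋯ γ_{p₁ j}`; it is nonzero exactly if
all the factors are. For the empty list it is `γ_{ij}`. -/
def pathProd {n : ℕ} (γ : PartialMonomial n G) : List (Fin n) → Fin n → Fin n → WithZero G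
  | [], j, i => γ.entry i j
  | p :: ps, j, i => pathProd γ ps p i * γ.entry p j

open scoped Classical in
/-- The matrix `Ω(γ)`: its `(i, j)` entry is `(γ_{i p_k} ⋯ γ_{p₁ j}, z^k)` if there are `k ≥ 0` and
`p₁, …, p_k` among the last `n - m` indices such that this product is nonzero, and `0` otherwise. -/
noncomputable def omega (γ : PartialMonomial (m + l) G) :
    Matrix (Fin m) (Fin m) (WithZero (G × Multiplicative ℕ)) := fun i j =>
  if h : ∃ q : G × List (Fin (m + l)), (∀ p ∈ q.2, m ≤ p.val) ∧
      pathProd γ q.2 (Fin.castAdd l j) (Fin.castAdd l i) = (q.1 : WithZero G) then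
    ((h.choose.1, Multiplicative.ofAdd h.choose.2.length) : G × Multiplicative ℕ)
  else 0

/-- `P(γ)`: the set of all `p` among the last `n - m` indices that occur as one of `p₁, …, p_k`
in the definition of some entry of `Ω(γ)`. -/
def pathSet (γ : PartialMonomial (m + l) G) : Set (Fin (m + l)) :=
  {p | ∃ (i j : Fin m) (ps : List (Fin (m + l))), (∀ q ∈ ps, m ≤ q.val) ∧
    pathProd γ ps (Fin.castAdd l j) (Fin.castAdd l i) ≠ 0 ∧ p ∈ ps}

/-- `Γ(Ω, P)`: the matrices `γ ∈ Ḡ_n` whose `p`th row and column are nonzero for each of the last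
`n - m` indices `p`, with `Ω(γ) = Ω`, `P(γ) = P`, and such that the block of `γ` on the remaining
indices `P*(γ)` has all its cycles of length one with cycle product `1`, that is, is the identity. -/
def gammaSet (Ω : PartialMonomial m (G × Multiplicative ℕ)) (P : Finset (Fin (m + l))) :
    Set (PartialMonomial (m + l) G) :=
  {γ | (∀ p : Fin (m + l), m ≤ p.val → (∃ j, γ.entry p j ≠ 0) ∧ ∃ i, γ.entry i p ≠ 0) ∧
    omega γ = Ω.entry ∧ pathSet γ = (P : Set (Fin (m + l))) ∧
    ∀ p : Fin (m + l), m ≤ p.val → p ∉ P → γ.entry p p = 1}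

variable (F : Type*) [Field F]

/-- `ε̄_T = ∏_{i ∈ T} (1 - ε_i)`. -/
noncomputable def epsBar {n : ℕ} (T : Finset (Fin n)) : MonoidAlgebra F (PartialMonomial n G) :=
  T.noncommProd (fun i => 1 - MonoidAlgebra.of F _ (eps i)) fun i _ j _ _ =>
    ((Commute.one_left _).sub_left
      (((Commute.one_right _).sub_right ((eps_commute i j).map (MonoidAlgebra.of F _)))))

variable [Fintype G]

open scoped Classical in
/-- The sum `∑_{P,T} ∑_{γ ∈ Γ(Ω,P)} ε̄_P γ c_T ε̄_T ε̄_P` over all disjoint subsets `P`, `T` of the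
last `n - m` indices with `|P| = ord(Ω)` and `|T| = r`, where `n = m + l`. It is `0` if
`ord(Ω) + r > n - m`. -/
noncomputable def deltaSum (Ω : PartialMonomial m (G × Multiplicative ℕ)) (r : ℕ)
    (c : Finset (Fin (m + l)) → MonoidAlgebra F (PartialMonomial (m + l) G)) :
    MonoidAlgebra F (PartialMonomial (m + l) G) :=
  ∑ PT ∈ Finset.univ.filter (fun PT : Finset (Fin (m + l)) × Finset (Fin (m + l)) =>
      (∀ p ∈ PT.1 ∪ PT.2, m ≤ p.val) ∧ Disjoint PT.1 PT.2 ∧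
      PT.1.card = Ω.ord ∧ PT.2.card = r),
    ∑ γ ∈ Finset.univ.filter (fun γ => γ ∈ gammaSet Ω PT.1),
      epsBar F PT.1 * MonoidAlgebra.of F _ γ * c PT.2 * epsBar F PT.2 * epsBar F PT.1

/-- The sequence `Δ^{Ω,ρ} = (Δ_n^{Ω,ρ})_{n ≥ m}`, with `n = m + l`. -/
noncomputable def delta (Ω : PartialMonomial m (G × Multiplicative ℕ)) (ρ : PartitionFamily G) :
    ∀ l : ℕ, MonoidAlgebra F (PartialMonomial (m + l) G) :=
  fun _ => deltaSum F Ω ρ.norm (cycleSum F ρ)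

/-- The variant of `Δ^{Ω,ρ}` built from the multiplicity-free sums. -/
noncomputable def reducedDelta (Ω : PartialMonomial m (G × Multiplicative ℕ))
    (ρ : PartitionFamily G) : ∀ l : ℕ, MonoidAlgebra F (PartialMonomial (m + l) G) :=
  fun _ => deltaSum F Ω ρ.norm (reducedCycleSum F ρ)

end Delta

/-- The sequences `D Ω ρ` lie in `Z̄_m` and form a basis of it, and for every `k` those with
`ord(Ω) + ‖ρ‖ ≤ k` lie in the `k`th term of the `m`-degree filtration and form a basis of it. -/
def IsFilteredBasis (F : Type*) [Field F] (G : Type*) [Group G] [Fintype G] (m : ℕ)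
    (D : PartialMonomial m (G × Multiplicative ℕ) → PartitionFamily G →
      ∀ l : ℕ, MonoidAlgebra F (PartialMonomial (m + l) G)) : Prop :=
  (∃ b : Module.Basis (PartialMonomial m (G × Multiplicative ℕ) × PartitionFamily G) F
      (limitCentralizer F G m),
    ∀ i, (b i : ∀ l : ℕ, MonoidAlgebra F (PartialMonomial (m + l) G)) = D i.1 i.2) ∧
  ∀ k : ℕ, ∃ b : Module.Basis
      {i : PartialMonomial m (G × Multiplicative ℕ) × PartitionFamily G //
        i.1.ord + i.2.norm ≤ k} F (mdegFiltration F G m k),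
    ∀ i, ((b i : limitCentralizer F G m) :
      ∀ l : ℕ, MonoidAlgebra F (PartialMonomial (m + l) G)) = D i.1.1 i.1.2

end WreathCentralizer

set_option linter.unusedSectionVars false

/-! Read a matrix `x` as a labelled partial permutation, with an edge from `j` to `i` for every
nonzero entry `(i, j)`. Call an index lower if it is not among the first `m`, and call `x` full
(`IsFull`) if all lower rows and columns are nonzero. In a full matrix, a walk that leaves the first
`m` indices and stays among lower ones must return to the first `m`, by finiteness
(`IsFull.isCoreachable`). Hence a full matrix splits into paths between the first `m` indices,
recorded by `Ω`, and labelled cycles on the other lower indices. Conjugation by wreath elements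
trivial on the first `m` indices moves all labels of a path to its last edge, and leaves only the
conjugacy class of each cycle product. So the pairs `(Ω, ρ)` classify full matrices of all sizes up
to this conjugation (`isRepresenting_pattern`), with `pattern Ω ρ` as normal form.

The multiplicity-free element is the sum of `ε̄_R x ε̄_R` over all copies `(R, x)` of that normal
form, with `x` the identity on lower indices outside `R` (`reducedDelta_eq_copySum`). In this form
membership in the limit is visible. Conjugation permutes the copies. Each lower `ε_p` commutes with
every summand. The map `θ` annihilates the copies with the last index in `R` and matches the others
with the copies one level below. At most `|R|` lower diagonal entries differ from `1`.

For the basis property there is a functional `dual x` for each `x` at level `l`, an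
inclusion-exclusion over the fixed lower indices of `x`. It vanishes on every matrix fixing some
lower index, and it is the coefficient of `x` on elements `α` with `ε_p α ε_p = 0` for all lower
`p`. Therefore these functionals, one per conjugacy class of full matrices, are dual to the copy
sums (`dual_copySum`). They separate the points of the limit (`eq_zero_of_forall_dual_eq_zero`):
once level `l` is zero, `θ` vanishes on level `l + 1`, so all `ε_p α ε_p` vanish there, and `α` is
then a combination of elements `ε̄ y ε̄` with `y` full, whose coefficients are the values `dual y α
= 0`. They also vanish on `m`-degree below `l`, which gives both the finiteness of expansions and
the filtered statement (`exists_basis_of_dual`).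

Finally, `C^ρ` is `c^ρ` times the number of symmetries of the slots of `ρ`, which is invertible in
characteristic zero (`cycleSum_eq_smul`). -/

namespace WreathCentralizer

open PartialMonomial

/-! ### Conjugation by the wreath product and deletion of rows and columns. -/

namespace PartialMonomial

variable {n : ℕ} {G : Type*} [Group G]

theorem wreath_entry (g : Fin n → G) (σ : Equiv.Perm (Fin n)) (i j : Fin n) :
    (wreath g σ).entry i j = if σ j = i then (g i : WithZero G) else 0 := rfl

theorem wreath_mul_entry (g : Fin n → G) (σ : Equiv.Perm (Fin n)) (x : PartialMonomial n G)
    (i j : Fin n) : (wreath g σ * x).entry (σ i) j = g (σ i) * x.entry i j := by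
  by_cases h : x.entry i j = 0
  · rw [h, mul_zero]
    by_contra h'
    obtain ⟨k, hk, -⟩ := exists_of_mul_entry_ne _ _ h'
    rw [wreath_entry] at hk
    split_ifs at hk with hki
    · rw [σ.injective hki, h, mul_zero] at hk
      exact hk rfl
    · exact hk (zero_mul _)
  · have : (wreath g σ).entry (σ i) i = g (σ i) := by rw [wreath_entry, if_pos rfl]
    rw [mul_entry_eq (k := i), this]
    rw [this]
    exact mul_ne_zero WithZero.coe_ne_zero h

theorem mul_wreath_entry (g : Fin n → G) (σ : Equiv.Perm (Fin n)) (x : PartialMonomial n G)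
    (i j : Fin n) : (x * wreath g σ).entry i j = x.entry i (σ j) * g (σ j) := by
  have hw : (wreath g σ).entry (σ j) j = g (σ j) := by rw [wreath_entry, if_pos rfl]
  by_cases h : x.entry i (σ j) = 0
  · rw [h, zero_mul]
    by_contra h'
    obtain ⟨k, hk, -⟩ := exists_of_mul_entry_ne _ _ h'
    rw [wreath_entry] at hk
    split_ifs at hk with hki
    · rw [← hki, h, zero_mul] at hk
      exact hk rfl
    · exact hk (mul_zero _)
  · rw [mul_entry_eq (k := σ j), hw]
    rw [hw]
    exact mul_ne_zero h WithZero.coe_ne_zero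

theorem wreath_mul_wreath_inv (g : Fin n → G) (σ : Equiv.Perm (Fin n)) :
    wreath g σ * wreath (fun j => (g (σ j))⁻¹) σ⁻¹ = 1 := by
  apply PartialMonomial.ext
  funext i j
  obtain ⟨i, rfl⟩ := σ.surjective i
  rw [wreath_mul_entry, wreath_entry, one_entry]
  by_cases h : σ i = j
  · subst h
    simp
  · rw [if_neg h, if_neg, mul_zero]
    rintro rfl
    simp at h

theorem wreath_inv_mul_wreath (g : Fin n → G) (σ : Equiv.Perm (Fin n)) :
    wreath (fun j => (g (σ j))⁻¹) σ⁻¹ * wreath g σ = 1 := by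
  apply PartialMonomial.ext
  funext i j
  rw [mul_wreath_entry, wreath_entry, one_entry]
  by_cases h : i = j
  · subst h
    simp
  · rw [if_neg h, if_neg, zero_mul]
    simpa using fun h' => h h'.symm

/-- The elements of the wreath product are invertible. -/
def wreathUnit (g : Fin n → G) (σ : Equiv.Perm (Fin n)) : (PartialMonomial n G)ˣ where
  val := wreath g σ
  inv := wreath (fun j => (g (σ j))⁻¹) σ⁻¹
  val_inv := wreath_mul_wreath_inv g σ
  inv_val := wreath_inv_mul_wreath g σ

/-- Conjugation by an element of the wreath product. -/
noncomputable def conj (g : Fin n → G) (σ : Equiv.Perm (Fin n)) (x : PartialMonomial n G) :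
    PartialMonomial n G :=
  wreath g σ * x * ↑(wreathUnit g σ)⁻¹

theorem conj_mul_wreath (g : Fin n → G) (σ : Equiv.Perm (Fin n)) (x : PartialMonomial n G) :
    conj g σ x * wreath g σ = wreath g σ * x := by
  exact (wreathUnit g σ).inv_mul_cancel_right _

theorem conj_entry (g : Fin n → G) (σ : Equiv.Perm (Fin n)) (x : PartialMonomial n G)
    (i j : Fin n) :
    (conj g σ x).entry (σ i) (σ j) = g (σ i) * x.entry i j * ((g (σ j))⁻¹ : G) := by
  have h := congrArg (fun y => PartialMonomial.entry y (σ i) j) (conj_mul_wreath g σ x)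
  simp only [mul_wreath_entry, wreath_mul_entry] at h
  rw [← h, mul_assoc, ← WithZero.coe_mul, mul_inv_cancel, WithZero.coe_one, mul_one]

theorem conj_injective (g : Fin n → G) (σ : Equiv.Perm (Fin n)) :
    Function.Injective (conj g σ : PartialMonomial n G → _) := by
  intro x y h
  exact (Units.mul_right_inj (wreathUnit g σ)).1 ((Units.mul_left_inj _).1 h)

theorem conj_surjective (g : Fin n → G) (σ : Equiv.Perm (Fin n)) :
    Function.Surjective (conj g σ : PartialMonomial n G → _) := by
  intro y
  refine ⟨↑(wreathUnit g σ)⁻¹ * y * wreath g σ, ?_⟩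
  rw [conj, mul_assoc (↑(wreathUnit g σ)⁻¹ : PartialMonomial n G)]
  erw [(wreathUnit g σ).mul_inv_cancel_left, (wreathUnit g σ).mul_inv_cancel_right]

theorem conj_eq_of_entry {g : Fin n → G} {σ : Equiv.Perm (Fin n)} {x y : PartialMonomial n G}
    (h : ∀ i j, y.entry (σ i) (σ j) = g (σ i) * x.entry i j * ((g (σ j))⁻¹ : G)) :
    conj g σ x = y := by
  apply PartialMonomial.ext
  funext i j
  obtain ⟨i, rfl⟩ := σ.surjective i
  obtain ⟨j, rfl⟩ := σ.surjective j
  rw [conj_entry, h]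

theorem conj_entry_self (g : Fin n → G) (σ : Equiv.Perm (Fin n)) (x : PartialMonomial n G)
    (i : Fin n) : (conj g σ x).entry (σ i) (σ i) = 1 ↔ x.entry i i = 1 := by
  rw [conj_entry]
  constructor
  · intro h
    have h' := congrArg (fun z => ((g (σ i))⁻¹ : G) * z * (g (σ i) : WithZero G)) h
    simpa [mul_assoc] using h'
  · intro h
    rw [h, mul_one, ← WithZero.coe_mul, mul_inv_cancel, WithZero.coe_one]

theorem conj_eps (g : Fin n → G) (σ : Equiv.Perm (Fin n)) (i : Fin n) :
    conj g σ (eps i) = eps (σ i) := by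
  apply conj_eq_of_entry
  intro a b
  rw [eps_entry, eps_entry]
  by_cases h : a = b ∧ a ≠ i
  · obtain ⟨rfl, h⟩ := h
    rw [if_pos ⟨rfl, fun h' => h (σ.injective h')⟩, if_pos ⟨rfl, h⟩, mul_one, ← WithZero.coe_mul,
      mul_inv_cancel, WithZero.coe_one]
  · rw [if_neg h, if_neg, mul_zero, zero_mul]
    simpa using h

/-- A nonzero diagonal entry is alone in its row and in its column, so deleting the row or the
column removes the same single entry. -/
theorem eps_mul_eq_mul_eps {x : PartialMonomial n G} {i : Fin n} (h : x.entry i i = 1) :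
    eps i * x = x * eps i := by
  have hx : x.entry i i ≠ 0 := by rw [h]; exact one_ne_zero
  apply PartialMonomial.ext
  funext a b
  rw [eps_mul_entry, mul_eps_entry]
  by_cases ha : a = i <;> by_cases hb : b = i
  · simp [ha, hb]
  · rw [if_pos ha, if_neg hb]
    by_contra hne
    subst ha
    exact hb (x.row_unique _ _ _ (fun h' => hne h'.symm) hx)
  · rw [if_neg ha, if_pos hb]
    by_contra hne
    subst hb
    exact ha (x.col_unique _ _ _ hne hx)
  · rw [if_neg ha, if_neg hb]

theorem eps_mul_eps (i : Fin n) : (eps i * eps i : PartialMonomial n G) = eps i := by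
  apply PartialMonomial.ext
  funext a b
  rw [eps_mul_entry, eps_entry]
  by_cases ha : a = i <;> simp [ha]

/-- The rows and columns of `x` with index in `S` are replaced by zero. -/
def kill {M : Type*} [DecidableEq (Fin n)] (S : Finset (Fin n)) (x : PartialMonomial n M) :
    PartialMonomial n M where
  entry i j := if i ∈ S ∨ j ∈ S then 0 else x.entry i j
  row_unique := by
    intro i j j' h h'
    simp only [ne_eq, ite_eq_left_iff, Classical.not_imp] at h h'
    exact x.row_unique _ _ _ h.2 h'.2
  col_unique := by
    intro i i' j h h'
    simp only [ne_eq, ite_eq_left_iff, Classical.not_imp] at h h'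
    exact x.col_unique _ _ _ h.2 h'.2

theorem kill_entry {M : Type*} (S : Finset (Fin n)) (x : PartialMonomial n M)
    (i j : Fin n) : (kill S x).entry i j = if i ∈ S ∨ j ∈ S then 0 else x.entry i j := rfl

theorem kill_empty {M : Type*} (x : PartialMonomial n M) : kill ∅ x = x := by
  apply PartialMonomial.ext
  funext i j
  simp [kill_entry]

theorem kill_singleton (p : Fin n) (x : PartialMonomial n G) : kill {p} x = eps p * x * eps p := by
  apply PartialMonomial.ext
  funext i j
  rw [kill_entry, mul_eps_entry, eps_mul_entry]
  by_cases hi : i = p <;> by_cases hj : j = p <;> simp [hi, hj]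

theorem kill_kill {M : Type*} (S T : Finset (Fin n)) (x : PartialMonomial n M) :
    kill S (kill T x) = kill (S ∪ T) x := by
  apply PartialMonomial.ext
  funext i j
  simp only [kill_entry, Finset.mem_union]
  by_cases h1 : i ∈ S <;> by_cases h2 : j ∈ S <;> simp [h1, h2]

theorem kill_conj (g : Fin n → G) (σ : Equiv.Perm (Fin n)) (S : Finset (Fin n))
    (x : PartialMonomial n G) :
    kill (S.map σ.toEmbedding) (conj g σ x) = conj g σ (kill S x) := by
  symm
  apply conj_eq_of_entry
  intro i j
  rw [kill_entry, kill_entry, conj_entry]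
  simp only [Finset.mem_map_equiv, Equiv.symm_apply_apply]
  split_ifs <;> simp

/-- The elements with a nonzero entry in the rows and columns with index in the last `l`. -/
def IsFull {m l : ℕ} {M : Type*} (x : PartialMonomial (m + l) M) : Prop :=
  ∀ p : Fin (m + l), m ≤ p.val → (∃ j, x.entry p j ≠ 0) ∧ ∃ i, x.entry i p ≠ 0

end PartialMonomial

/-! ### The idempotents `ε̄_R` and the elements `ε̄_R x ε̄_R`. -/

section EpsBar

variable {F : Type*} [Field F] {G : Type*} [Group G] {n : ℕ}

theorem epsBar_empty : epsBar F (∅ : Finset (Fin n)) (G := G) = 1 := by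
  simp [epsBar]

theorem epsBar_insert {p : Fin n} {R : Finset (Fin n)} (hp : p ∉ R) :
    (epsBar F (insert p R) : MonoidAlgebra F (PartialMonomial n G)) =
      (1 - MonoidAlgebra.of F _ (eps p)) * epsBar F R :=
  Finset.noncommProd_insert_of_notMem _ _ _ _ hp

theorem epsBar_insert' {p : Fin n} {R : Finset (Fin n)} (hp : p ∉ R) :
    (epsBar F (insert p R) : MonoidAlgebra F (PartialMonomial n G)) =
      epsBar F R * (1 - MonoidAlgebra.of F _ (eps p)) :=
  Finset.noncommProd_insert_of_notMem' _ _ _ _ hp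

theorem epsBar_union {R S : Finset (Fin n)} (h : Disjoint R S) :
    (epsBar F (R ∪ S) : MonoidAlgebra F (PartialMonomial n G)) = epsBar F R * epsBar F S :=
  Finset.noncommProd_union_of_disjoint h _ _

theorem commute_epsBar {z : MonoidAlgebra F (PartialMonomial n G)} {R : Finset (Fin n)}
    (h : ∀ p ∈ R, Commute z (MonoidAlgebra.of F _ (eps p))) : Commute z (epsBar F R) :=
  Finset.noncommProd_commute _ _ _ _ fun p hp => (Commute.one_right z).sub_right (h p hp)

theorem of_eps_commute_epsBar (p : Fin n) (R : Finset (Fin n)) :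
    Commute (MonoidAlgebra.of F (PartialMonomial n G) (eps p)) (epsBar F R) :=
  commute_epsBar fun q _ => (eps_commute p q).map (MonoidAlgebra.of F (PartialMonomial n G))

/-- The factor `1 - ε_p` can be brought to the front, and `ε_p (1 - ε_p) = 0`. -/
theorem of_eps_mul_epsBar {p : Fin n} {R : Finset (Fin n)} (hp : p ∈ R) :
    MonoidAlgebra.of F (PartialMonomial n G) (eps p) * epsBar F R = 0 := by
  classical
  rw [← Finset.insert_erase hp, epsBar_insert (Finset.notMem_erase p R), ← mul_assoc, mul_sub,
    mul_one, ← map_mul, eps_mul_eps, sub_self, zero_mul]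

theorem epsBar_mul_of_eps {p : Fin n} {R : Finset (Fin n)} (hp : p ∈ R) :
    epsBar F R * MonoidAlgebra.of F (PartialMonomial n G) (eps p) = 0 := by
  rw [← (of_eps_commute_epsBar p R).eq, of_eps_mul_epsBar hp]

theorem epsBar_mul_eq_self {z : MonoidAlgebra F (PartialMonomial n G)} {R : Finset (Fin n)}
    (h : ∀ p ∈ R, MonoidAlgebra.of F _ (eps p) * z = 0) : epsBar F R * z = z := by
  classical
  induction R using Finset.induction_on with
  | empty => rw [epsBar_empty, one_mul]
  | insert p R hp ih =>
    rw [epsBar_insert hp, mul_assoc, ih fun q hq => h q (Finset.mem_insert_of_mem hq), sub_mul,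
      one_mul, h p (Finset.mem_insert_self p R), sub_zero]

theorem mul_epsBar_eq_self {z : MonoidAlgebra F (PartialMonomial n G)} {R : Finset (Fin n)}
    (h : ∀ p ∈ R, z * MonoidAlgebra.of F _ (eps p) = 0) : z * epsBar F R = z := by
  classical
  induction R using Finset.induction_on with
  | empty => rw [epsBar_empty, mul_one]
  | insert p R hp ih =>
    rw [epsBar_insert' hp, ← mul_assoc, ih fun q hq => h q (Finset.mem_insert_of_mem hq), mul_sub,
      mul_one, h p (Finset.mem_insert_self p R), sub_zero]

theorem epsBar_mul_self (R : Finset (Fin n)) :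
    (epsBar F R * epsBar F R : MonoidAlgebra F (PartialMonomial n G)) = epsBar F R :=
  epsBar_mul_eq_self fun _ hp => of_eps_mul_epsBar hp

/-- All matrices occurring in `ε_p z` have zero `p`th row, so `x` is not among them. -/
theorem coeff_of_eps_mul {x : PartialMonomial n G} {p : Fin n} (hx : ∃ j, x.entry p j ≠ 0)
    (z : MonoidAlgebra F (PartialMonomial n G)) :
    (MonoidAlgebra.of F _ (eps p) * z).coeff x = 0 := by
  obtain ⟨j, hj⟩ := hx
  apply MonoidAlgebra.coeff_single_mul_of_forall_mul_ne
  rintro d rfl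
  rw [eps_mul_entry, if_pos rfl] at hj
  exact hj rfl

theorem coeff_mul_of_eps {x : PartialMonomial n G} {p : Fin n} (hx : ∃ i, x.entry i p ≠ 0)
    (z : MonoidAlgebra F (PartialMonomial n G)) :
    (z * MonoidAlgebra.of F _ (eps p)).coeff x = 0 := by
  obtain ⟨j, hj⟩ := hx
  apply MonoidAlgebra.coeff_mul_single_of_forall_mul_ne
  rintro d rfl
  rw [mul_eps_entry, if_pos rfl] at hj
  exact hj rfl

/-- In the expansion of `ε̄_R z` every term other than `z` begins with some `ε_p`, and cannot
contribute to a matrix whose rows in `R` are nonzero. -/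
theorem coeff_epsBar_mul {x : PartialMonomial n G} {R : Finset (Fin n)}
    (hx : ∀ p ∈ R, ∃ j, x.entry p j ≠ 0) (z : MonoidAlgebra F (PartialMonomial n G)) :
    (epsBar F R * z).coeff x = z.coeff x := by
  classical
  induction R using Finset.induction_on with
  | empty => rw [epsBar_empty, one_mul]
  | insert p R hp ih =>
    rw [epsBar_insert hp, mul_assoc, sub_mul, one_mul, MonoidAlgebra.coeff_sub, Finsupp.sub_apply,
      coeff_of_eps_mul (hx p (Finset.mem_insert_self p R)), sub_zero,
      ih fun q hq => hx q (Finset.mem_insert_of_mem hq)]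

theorem coeff_mul_epsBar {x : PartialMonomial n G} {R : Finset (Fin n)}
    (hx : ∀ p ∈ R, ∃ i, x.entry i p ≠ 0) (z : MonoidAlgebra F (PartialMonomial n G)) :
    (z * epsBar F R).coeff x = z.coeff x := by
  classical
  induction R using Finset.induction_on with
  | empty => rw [epsBar_empty, mul_one]
  | insert p R hp ih =>
    rw [epsBar_insert' hp, ← mul_assoc, mul_sub, mul_one, MonoidAlgebra.coeff_sub,
      Finsupp.sub_apply, coeff_mul_of_eps (hx p (Finset.mem_insert_self p R)), sub_zero,
      ih fun q hq => hx q (Finset.mem_insert_of_mem hq)]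

theorem of_wreath_mul_epsBar (g : Fin n → G) (σ : Equiv.Perm (Fin n)) (R : Finset (Fin n)) :
    MonoidAlgebra.of F _ (wreath g σ) * epsBar F R =
      epsBar F (R.map σ.toEmbedding) * MonoidAlgebra.of F _ (wreath g σ) := by
  classical
  induction R using Finset.induction_on with
  | empty => rw [Finset.map_empty, epsBar_empty, mul_one, one_mul]
  | insert p R hp ih =>
    rw [Finset.map_insert, epsBar_insert hp, epsBar_insert (by simpa using hp), mul_assoc, ← ih,
      ← mul_assoc, ← mul_assoc, mul_sub, mul_one, sub_mul 1, one_mul, ← map_mul, ← map_mul,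
      Equiv.coe_toEmbedding, ← conj_eps g σ p, conj_mul_wreath]

/-- The element `ε̄_R x ε̄_R` of the semigroup algebra. -/
noncomputable def sandwich (F : Type*) [Field F] (R : Finset (Fin n)) (x : PartialMonomial n G) :
    MonoidAlgebra F (PartialMonomial n G) :=
  epsBar F R * MonoidAlgebra.of F _ x * epsBar F R

theorem of_wreath_mul_sandwich (g : Fin n → G) (σ : Equiv.Perm (Fin n)) (R : Finset (Fin n))
    (x : PartialMonomial n G) :
    MonoidAlgebra.of F _ (wreath g σ) * sandwich F R x =
      sandwich F (R.map σ.toEmbedding) (conj g σ x) * MonoidAlgebra.of F _ (wreath g σ) := by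
  rw [sandwich, sandwich, mul_assoc _ _ (MonoidAlgebra.of F _ (wreath g σ)),
    ← of_wreath_mul_epsBar, ← mul_assoc, ← mul_assoc, of_wreath_mul_epsBar,
    mul_assoc _ (MonoidAlgebra.of F _ (wreath g σ)), ← map_mul, ← conj_mul_wreath, map_mul]
  simp only [mul_assoc, of_wreath_mul_epsBar]

/-- The correction terms of `ε̄_R y ε̄_R` all have a zero row or column in `R`. This triangularity
is the source of linear independence. -/
theorem coeff_sandwich {x y : PartialMonomial n G} {R : Finset (Fin n)} [Decidable (y = x)]
    (hx : ∀ p ∈ R, (∃ j, x.entry p j ≠ 0) ∧ ∃ i, x.entry i p ≠ 0) :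
    (sandwich F R y).coeff x = if y = x then 1 else 0 := by
  rw [sandwich, coeff_mul_epsBar fun p hp => (hx p hp).2, coeff_epsBar_mul fun p hp => (hx p hp).1,
    MonoidAlgebra.of_apply, MonoidAlgebra.coeff_single, Finsupp.single_apply]

/-- For `p ∈ R` both sides are zero; for `p ∉ R` the index is fixed by `x`, so `ε_p` commutes with
all three factors. -/
theorem of_eps_commute_sandwich {x : PartialMonomial n G} {R : Finset (Fin n)} {p : Fin n}
    (h : p ∉ R → x.entry p p = 1) :
    MonoidAlgebra.of F _ (eps p) * sandwich F R x =
      sandwich F R x * MonoidAlgebra.of F _ (eps p) := by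
  by_cases hp : p ∈ R
  · rw [sandwich, ← mul_assoc, ← mul_assoc, of_eps_mul_epsBar hp, mul_assoc _ (epsBar F R),
      epsBar_mul_of_eps hp, zero_mul, zero_mul, mul_zero]
  · have h1 : Commute (MonoidAlgebra.of F _ (eps p)) (MonoidAlgebra.of F _ x) := by
      rw [Commute, SemiconjBy, ← map_mul, ← map_mul, eps_mul_eq_mul_eps (h hp)]
    exact ((of_eps_commute_epsBar p R).mul_right h1).mul_right (of_eps_commute_epsBar p R)

/-- The elements all of whose matrices have `1` in the `p`th place of the diagonal. -/
def FixesDiag (p : Fin n) (z : MonoidAlgebra F (PartialMonomial n G)) : Prop :=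
  ∀ y ∈ z.coeff.support, y.entry p p = 1

theorem FixesDiag.of {p : Fin n} {x : PartialMonomial n G} (h : x.entry p p = 1) :
    FixesDiag p (MonoidAlgebra.of F _ x) := by
  intro y hy
  rw [MonoidAlgebra.of_apply, MonoidAlgebra.coeff_single] at hy
  rw [Finset.mem_singleton.1 (Finsupp.support_single_subset hy), h]

theorem FixesDiag.mul {p : Fin n} {z w : MonoidAlgebra F (PartialMonomial n G)}
    (hz : FixesDiag p z) (hw : FixesDiag p w) : FixesDiag p (z * w) := by
  classical
  intro y hy
  obtain ⟨a, ha, b, hb, rfl⟩ := Finset.mem_mul.1 (MonoidAlgebra.support_coeff_mul_subset _ _ hy)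
  exact mul_entry_diag (hz a ha) (hw b hb)

theorem FixesDiag.sub {p : Fin n} {z w : MonoidAlgebra F (PartialMonomial n G)}
    (hz : FixesDiag p z) (hw : FixesDiag p w) : FixesDiag p (z - w) := by
  classical
  intro y hy
  rw [MonoidAlgebra.coeff_sub] at hy
  rcases Finset.mem_union.1 (Finsupp.support_sub hy) with h | h
  · exact hz y h
  · exact hw y h

theorem FixesDiag.one (p : Fin n) :
    FixesDiag p (1 : MonoidAlgebra F (PartialMonomial n G)) := by
  rw [← map_one (MonoidAlgebra.of F (PartialMonomial n G))]
  exact FixesDiag.of (by rw [one_entry, if_pos rfl])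

theorem FixesDiag.epsBar {p : Fin n} {R : Finset (Fin n)} (hp : p ∉ R) :
    FixesDiag p (epsBar F R : MonoidAlgebra F (PartialMonomial n G)) := by
  refine Finset.noncommProd_induction _ _ _ (FixesDiag p) (fun _ _ => FixesDiag.mul)
    (FixesDiag.one p) fun q hq => (FixesDiag.one p).sub (FixesDiag.of ?_)
  rw [eps_entry, if_pos]
  exact ⟨rfl, fun h => hp (h ▸ hq)⟩

/-- Used twice: it bounds the `m`-degree of copy sums, and it makes the dual functionals vanish on
copies that do not use every lower index. -/
theorem FixesDiag.sandwich {p : Fin n} {R : Finset (Fin n)} {x : PartialMonomial n G}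
    (hp : p ∉ R) (hx : x.entry p p = 1) : FixesDiag p (sandwich F R x) :=
  ((FixesDiag.epsBar hp).mul (FixesDiag.of hx)).mul (FixesDiag.epsBar hp)

end EpsBar

end WreathCentralizer

namespace WreathCentralizer

open PartialMonomial

/-! ### Generators of the lower semigroup. -/

section Centralizer

variable {F : Type*} [Field F] {G : Type*} [Group G] {m n : ℕ}

/-- The pairs `(g, σ)` in the wreath product acting trivially on the first `m` indices. -/
def IsLower (m : ℕ) (g : Fin n → G) (σ : Equiv.Perm (Fin n)) : Prop :=
  ∀ i : Fin n, i.val < m → σ i = i ∧ g i = 1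

theorem IsLower.wreath_mem {g : Fin n → G} {σ : Equiv.Perm (Fin n)} (h : IsLower m g σ) :
    wreath g σ ∈ lowerSemigroup G m n := by
  intro i hi
  rw [wreath_entry, if_pos (h i hi).1, (h i hi).2, WithZero.coe_one]

theorem IsLower.le_apply {g : Fin n → G} {σ : Equiv.Perm (Fin n)} (h : IsLower m g σ)
    {i : Fin n} : m ≤ (σ i).val ↔ m ≤ i.val := by
  constructor
  · intro hi
    by_contra hlt
    rw [(h i (not_le.1 hlt)).1] at hi
    exact hlt hi
  · intro hi
    by_contra hlt
    have := σ.injective (h _ (not_le.1 hlt)).1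
    rw [this] at hlt
    exact hlt hi

theorem eps_mem_lowerSemigroup {p : Fin n} (hp : m ≤ p.val) :
    (eps p : PartialMonomial n G) ∈ lowerSemigroup G m n := by
  intro i hi
  rw [eps_entry, if_pos]
  refine ⟨rfl, ?_⟩
  rintro rfl
  omega

/-- A partial permutation of a finite set extends to a permutation; `γ` is recovered from the
extension by deleting the columns that were zero. -/
theorem exists_eq_wreath_mul_kill {γ : PartialMonomial n G} (hγ : γ ∈ lowerSemigroup G m n) :
    ∃ (g : Fin n → G) (σ : Equiv.Perm (Fin n)) (S : Finset (Fin n)), IsLower m g σ ∧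
      (∀ p ∈ S, m ≤ p.val) ∧ γ = wreath g σ * kill S 1 := by
  classical
  -- The bijection from nonzero columns to nonzero rows, to be completed by `extendSubtype`.
  let e : {j // ∃ i, γ.entry i j ≠ 0} ≃ {i // ∃ j, γ.entry i j ≠ 0} :=
    { toFun := fun j => ⟨j.2.choose, j, j.2.choose_spec⟩
      invFun := fun i => ⟨i.2.choose, i, i.2.choose_spec⟩
      left_inv := fun j => Subtype.ext <| by
        have h := (⟨j, j.2.choose_spec⟩ : ∃ j', γ.entry j.2.choose j' ≠ 0)
        exact γ.row_unique _ _ _ h.choose_spec j.2.choose_spec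
      right_inv := fun i => Subtype.ext <| by
        have h := (⟨i, i.2.choose_spec⟩ : ∃ i', γ.entry i' i.2.choose ≠ 0)
        exact γ.col_unique _ _ _ h.choose_spec i.2.choose_spec }
  have he : ∀ i j, γ.entry i j ≠ 0 → e.extendSubtype j = i := by
    intro i j h
    rw [e.extendSubtype_apply_of_mem j ⟨i, h⟩]
    have h' : ∃ i, γ.entry i j ≠ 0 := ⟨i, h⟩
    exact γ.col_unique _ _ _ h'.choose_spec h
  have hdiag : ∀ i : Fin n, i.val < m → e.extendSubtype i = i := fun i hi =>
    he i i (by rw [hγ i hi]; exact one_ne_zero)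
  -- The label `1` in the added rows is arbitrary: `kill` removes it again.
  refine ⟨fun i => if h : γ.entry i (e.extendSubtype.symm i) = 0 then 1 else WithZero.unzero h,
    e.extendSubtype, Finset.univ.filter fun j => γ.entry (e.extendSubtype j) j = 0, ?_, ?_, ?_⟩
  · intro i hi
    refine ⟨hdiag i hi, ?_⟩
    have h1 : γ.entry i (e.extendSubtype.symm i) = 1 := by
      rw [e.extendSubtype.symm_apply_eq.2 (hdiag i hi).symm, hγ i hi]
    have h2 : γ.entry i (e.extendSubtype.symm i) ≠ 0 := by rw [h1]; exact one_ne_zero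
    refine (dif_neg h2).trans ?_
    apply WithZero.coe_injective
    rw [WithZero.coe_unzero, h1, WithZero.coe_one]
  · intro p hp
    by_contra hlt
    rw [Finset.mem_filter, hdiag p (not_le.1 hlt), hγ p (not_le.1 hlt)] at hp
    exact one_ne_zero hp.2
  · apply PartialMonomial.ext
    funext i j
    obtain ⟨i, rfl⟩ := e.extendSubtype.surjective i
    rw [wreath_mul_entry, kill_entry, one_entry]
    by_cases hij : i = j
    · subst hij
      by_cases h : γ.entry (e.extendSubtype i) i = 0
      · rw [if_pos (by simp [h]), mul_zero, h]
      · rw [if_neg (by simp [h]), if_pos rfl, mul_one]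
        rw [dif_neg (by rwa [Equiv.symm_apply_apply]), WithZero.coe_unzero,
          Equiv.symm_apply_apply]
    · rw [if_neg hij, ite_self, mul_zero]
      by_contra hne
      exact hij (e.extendSubtype.injective (he _ _ hne).symm)

theorem kill_insert_one {p : Fin n} {S : Finset (Fin n)} :
    kill (insert p S) 1 = (eps p * kill S 1 : PartialMonomial n G) := by
  apply PartialMonomial.ext
  funext i j
  rw [eps_mul_entry, kill_entry, kill_entry, one_entry]
  by_cases hij : i = j
  · subst hij
    by_cases h1 : i = p <;> by_cases h2 : i ∈ S <;> simp [h1, h2]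
  · simp [hij]

/-- By the factorization above, the lower semigroup is generated by its wreath elements and the
lower `ε_p`. -/
theorem mem_centralizer_of_commute {z : MonoidAlgebra F (PartialMonomial n G)}
    (heps : ∀ p : Fin n, m ≤ p.val → Commute (MonoidAlgebra.of F _ (eps p)) z)
    (hwr : ∀ (g : Fin n → G) (σ : Equiv.Perm (Fin n)), IsLower m g σ →
      Commute (MonoidAlgebra.of F _ (wreath g σ)) z) : z ∈ centralizer F G m n := by
  classical
  rw [centralizer, Subalgebra.mem_centralizer_iff]
  rintro _ ⟨γ, hγ, rfl⟩
  obtain ⟨g, σ, S, hg, hS, rfl⟩ := exists_eq_wreath_mul_kill hγ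
  rw [map_mul]
  refine (hwr g σ hg).mul_left ?_
  clear hγ
  induction S using Finset.induction_on with
  | empty =>
    rw [kill_empty, map_one]
    exact Commute.one_left z
  | insert p S hp ih =>
    rw [kill_insert_one, map_mul]
    exact (heps p (hS p (Finset.mem_insert_self p S))).mul_left
      (ih fun q hq => hS q (Finset.mem_insert_of_mem hq))

theorem commute_of_mem_centralizer {z : MonoidAlgebra F (PartialMonomial n G)}
    (hz : z ∈ centralizer F G m n) {γ : PartialMonomial n G} (hγ : γ ∈ lowerSemigroup G m n) :
    Commute (MonoidAlgebra.of F _ γ) z :=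
  (Subalgebra.mem_centralizer_iff F).1 hz _ (Set.mem_image_of_mem _ hγ)

end Centralizer

/-! ### The projection `θ` on sandwiched elements. -/

section Theta

variable {F : Type*} [Field F] {G : Type*} [Group G] {n : ℕ}

theorem theta_of (γ : PartialMonomial (n + 1) G) :
    theta (MonoidAlgebra.of F _ γ) = MonoidAlgebra.of F _ γ.trunc :=
  theta_single γ 1

/-- `θ` ignores a final `ε_last` and is multiplicative across a middle one; commutation moves the
one to the other. -/
theorem theta_mul_of_commute {x y : MonoidAlgebra F (PartialMonomial (n + 1) G)}
    (h : Commute (MonoidAlgebra.of F _ (eps (Fin.last n))) y) :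
    theta (x * y) = theta x * theta y := by
  rw [← theta_mul_eps_mul, mul_assoc, h.eq, ← mul_assoc, theta_mul_eps]

theorem trunc_eps_castSucc (p : Fin n) :
    (eps p.castSucc : PartialMonomial (n + 1) G).trunc = eps p := by
  apply PartialMonomial.ext
  funext i j
  rw [trunc_entry, eps_entry, eps_entry]
  simp [Fin.castSucc_inj]

theorem theta_epsBar (R : Finset (Fin n)) :
    theta (epsBar F (R.map Fin.castSuccEmb) : MonoidAlgebra F (PartialMonomial (n + 1) G)) =
      epsBar F R := by
  classical
  induction R using Finset.induction_on with
  | empty => rw [Finset.map_empty, epsBar_empty, epsBar_empty, theta_one]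
  | insert p R hp ih =>
    rw [Finset.map_insert, epsBar_insert hp, epsBar_insert (by simpa using hp),
      theta_mul_of_commute (of_eps_commute_epsBar _ _), ih, map_sub, theta_one, theta_of,
      Fin.coe_castSuccEmb, trunc_eps_castSucc]

theorem theta_sandwich {R : Finset (Fin n)} {x : PartialMonomial (n + 1) G}
    (hx : x.entry (Fin.last n) (Fin.last n) = 1) :
    theta (sandwich F (R.map Fin.castSuccEmb) x) = sandwich F R x.trunc := by
  have hc : Commute (MonoidAlgebra.of F _ (eps (Fin.last n))) (MonoidAlgebra.of F _ x) := by
    rw [Commute, SemiconjBy, ← map_mul, ← map_mul, eps_mul_eq_mul_eps hx]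
  rw [sandwich, theta_mul_of_commute (of_eps_commute_epsBar _ _), theta_mul_of_commute hc,
    theta_epsBar, theta_of, sandwich]

/-- `θ` is unchanged by right multiplication with `ε_last`, which annihilates `ε̄_R`. -/
theorem theta_sandwich_of_last_mem {R : Finset (Fin (n + 1))} (hR : Fin.last n ∈ R)
    (x : PartialMonomial (n + 1) G) : theta (sandwich F R x) = 0 := by
  rw [← theta_mul_eps, sandwich, mul_assoc, epsBar_mul_of_eps hR, mul_zero, map_zero]

/-- The extension of a matrix by `1` in the new place of the diagonal. -/
def PartialMonomial.extend (x : PartialMonomial n G) : PartialMonomial (n + 1) G where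
  entry i j := Fin.lastCases (motive := fun _ => WithZero G)
    (Fin.lastCases (motive := fun _ => WithZero G) 1 (fun _ => 0) j)
    (fun i' => Fin.lastCases (motive := fun _ => WithZero G) 0 (fun j' => x.entry i' j') j) i
  row_unique := by
    intro i j j'
    induction i using Fin.lastCases <;> induction j using Fin.lastCases <;>
      induction j' using Fin.lastCases <;> simp
    exact x.row_unique _ _ _
  col_unique := by
    intro i i' j
    induction i using Fin.lastCases <;> induction i' using Fin.lastCases <;>
      induction j using Fin.lastCases <;> simp
    exact x.col_unique _ _ _

theorem extend_entry_castSucc (x : PartialMonomial n G) (i j : Fin n) :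
    x.extend.entry i.castSucc j.castSucc = x.entry i j := by
  simp [PartialMonomial.extend]

theorem extend_entry_last (x : PartialMonomial n G) :
    x.extend.entry (Fin.last n) (Fin.last n) = 1 := by
  simp [PartialMonomial.extend]

theorem trunc_extend (x : PartialMonomial n G) : x.extend.trunc = x := by
  apply PartialMonomial.ext
  funext i j
  rw [trunc_entry, extend_entry_castSucc]

/-- The entry `1` in the corner forces the rest of the last row and column to be zero, so only the
truncation is left free. -/
theorem eq_of_trunc_eq {x y : PartialMonomial (n + 1) G} (h : x.trunc = y.trunc)
    (hx : x.entry (Fin.last n) (Fin.last n) = 1) (hy : y.entry (Fin.last n) (Fin.last n) = 1) :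
    x = y := by
  have key : ∀ {x y : PartialMonomial (n + 1) G}, x.trunc = y.trunc →
      x.entry (Fin.last n) (Fin.last n) = 1 → y.entry (Fin.last n) (Fin.last n) = 1 →
      ∀ i j, x.entry i j ≠ 0 → y.entry i j = x.entry i j := by
    intro x y h hx hy i j hij
    have hx0 : x.entry (Fin.last n) (Fin.last n) ≠ 0 := by rw [hx]; exact one_ne_zero
    induction i using Fin.lastCases with
    | last => rw [x.row_unique _ _ _ hij hx0, hx, hy]
    | cast i =>
      induction j using Fin.lastCases with
      | last => exact absurd (x.col_unique _ _ _ hij hx0) (Fin.castSucc_ne_last i)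
      | cast j => rw [← trunc_entry, ← trunc_entry, h]
  exact ext_of_ne (key h hx hy) (key h.symm hy hx)

theorem kill_last_eq {x y : PartialMonomial (n + 1) G} (h : x.trunc = y.trunc) :
    kill {Fin.last n} x = kill {Fin.last n} y := by
  apply PartialMonomial.ext
  funext i j
  rw [kill_entry, kill_entry]
  induction i using Fin.lastCases with
  | last => simp
  | cast i =>
    induction j using Fin.lastCases with
    | last => simp
    | cast j => rw [← trunc_entry, ← trunc_entry, h]

/-- The map `z ↦ ε_last z ε_last` depends only on upper left corners, so it factors through `θ`. -/
theorem eps_mul_mul_eps_of_theta_eq_zero {z : MonoidAlgebra F (PartialMonomial (n + 1) G)}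
    (h : theta z = 0) :
    MonoidAlgebra.of F _ (eps (Fin.last n)) * z * MonoidAlgebra.of F _ (eps (Fin.last n)) = 0 := by
  have key : ∀ z : MonoidAlgebra F (PartialMonomial (n + 1) G),
      MonoidAlgebra.of F _ (eps (Fin.last n)) * z * MonoidAlgebra.of F _ (eps (Fin.last n)) =
        MonoidAlgebra.mapDomain (fun y => kill {Fin.last n} y.extend) (theta z) := by
    intro z
    induction z using MonoidAlgebra.induction_linear with
    | zero => rw [mul_zero, zero_mul, map_zero, MonoidAlgebra.mapDomain_zero]
    | add f g hf hg => rw [mul_add, add_mul, map_add, hf, hg, MonoidAlgebra.mapDomain_add]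
    | single a b =>
      rw [theta_single, MonoidAlgebra.mapDomain_single, kill_last_eq (trunc_extend a.trunc),
        kill_singleton, MonoidAlgebra.of_apply, MonoidAlgebra.single_mul_single,
        MonoidAlgebra.single_mul_single, one_mul, mul_one]
  rw [key, h, MonoidAlgebra.mapDomain_zero]

end Theta

end WreathCentralizer

namespace WreathCentralizer

open PartialMonomial

/-! ### Copies of an abstract pattern inside `Ḡ_n`. -/

section Copies

variable {G : Type*} [Group G] {m l : ℕ} {K : Type*}

/-- `x` is, up to the labels `h`, the pattern `N` transported along the embedding `u`, extended
by the identity. -/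
structure IsCopyVia (N : Fin m ⊕ K → Fin m ⊕ K → WithZero G) (R : Finset (Fin (m + l)))
    (x : PartialMonomial (m + l) G) (u : Fin m ⊕ K → Fin (m + l)) (h : Fin m ⊕ K → G) : Prop where
  inj : Function.Injective u
  top : ∀ i, u (Sum.inl i) = Fin.castAdd l i
  label_top : ∀ i, h (Sum.inl i) = 1
  mem_iff : ∀ p, p ∈ R ↔ ∃ v, u (Sum.inr v) = p
  entry : ∀ v w, x.entry (u v) (u w) = h v * N v w * ((h w)⁻¹ : G)
  diag : ∀ p : Fin (m + l), m ≤ p.val → p ∉ R → x.entry p p = 1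

/-- `x` is conjugate to a copy of the pattern `N` on the index set `R`, extended by the
identity. -/
def IsCopy (N : Fin m ⊕ K → Fin m ⊕ K → WithZero G) (R : Finset (Fin (m + l)))
    (x : PartialMonomial (m + l) G) : Prop :=
  ∃ u h, IsCopyVia N R x u h

/-- A pattern: a partial monomial matrix whose rows and columns outside the first block are
nonzero. -/
structure IsPattern (N : Fin m ⊕ K → Fin m ⊕ K → WithZero G) : Prop where
  row_unique : ∀ i j j', N i j ≠ 0 → N i j' ≠ 0 → j = j'
  col_unique : ∀ i i' j, N i j ≠ 0 → N i' j ≠ 0 → i = i'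
  row_full : ∀ v, ∃ j, N (Sum.inr v) j ≠ 0
  col_full : ∀ v, ∃ i, N i (Sum.inr v) ≠ 0

variable {N : Fin m ⊕ K → Fin m ⊕ K → WithZero G} {R : Finset (Fin (m + l))}
  {x : PartialMonomial (m + l) G}

theorem IsCopyVia.le_of_inr {u : Fin m ⊕ K → Fin (m + l)} {h : Fin m ⊕ K → G}
    (hx : IsCopyVia N R x u h) (v : K) : m ≤ (u (Sum.inr v)).val := by
  by_contra hlt
  have := hx.inj ((hx.top ⟨_, not_le.1 hlt⟩).trans (Fin.ext rfl))
  simp at this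

theorem IsCopyVia.entry_ne_zero_iff {u : Fin m ⊕ K → Fin (m + l)} {h : Fin m ⊕ K → G}
    (hx : IsCopyVia N R x u h) (v w : Fin m ⊕ K) : x.entry (u v) (u w) ≠ 0 ↔ N v w ≠ 0 := by
  rw [hx.entry]
  simp

theorem IsCopyVia.exists_of_lt {u : Fin m ⊕ K → Fin (m + l)} {h : Fin m ⊕ K → G}
    (hx : IsCopyVia N R x u h) {p : Fin (m + l)} (hp : p.val < m) : ∃ i, u (Sum.inl i) = p :=
  ⟨⟨p, hp⟩, (hx.top _).trans (Fin.ext rfl)⟩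

theorem IsCopyVia.surjective {u : Fin m ⊕ K → Fin (m + l)} {h : Fin m ⊕ K → G}
    (hx : IsCopyVia N R x u h) (hR : ∀ p : Fin (m + l), m ≤ p.val → p ∈ R) :
    Function.Surjective u := by
  intro p
  by_cases hp : p.val < m
  · obtain ⟨i, hi⟩ := hx.exists_of_lt hp
    exact ⟨_, hi⟩
  · obtain ⟨v, hv⟩ := (hx.mem_iff p).1 (hR p (not_lt.1 hp))
    exact ⟨_, hv⟩

theorem IsCopy.le_of_mem (hx : IsCopy N R x) {p : Fin (m + l)} (hp : p ∈ R) : m ≤ p.val := by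
  obtain ⟨u, h, hx⟩ := hx
  obtain ⟨v, rfl⟩ := (hx.mem_iff p).1 hp
  exact hx.le_of_inr v

theorem IsCopy.diag (hx : IsCopy N R x) {p : Fin (m + l)} (hp : m ≤ p.val) (hpR : p ∉ R) :
    x.entry p p = 1 := by
  obtain ⟨u, h, hx⟩ := hx
  exact hx.diag p hp hpR

theorem IsCopy.card [Fintype K] (hx : IsCopy N R x) : R.card = Fintype.card K := by
  classical
  obtain ⟨u, h, hx⟩ := hx
  have : R = Finset.univ.map ⟨fun v => u (Sum.inr v), hx.inj.comp Sum.inr_injective⟩ := by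
    ext p
    rw [hx.mem_iff]
    simp
  rw [this, Finset.card_map, Finset.card_univ]

theorem IsCopy.isFull (hN : IsPattern N) (hx : IsCopy N R x) : IsFull x := by
  obtain ⟨u, h, hx⟩ := hx
  intro p hp
  by_cases hpR : p ∈ R
  · obtain ⟨v, rfl⟩ := (hx.mem_iff p).1 hpR
    obtain ⟨j, hj⟩ := hN.row_full v
    obtain ⟨i, hi⟩ := hN.col_full v
    exact ⟨⟨u j, (hx.entry_ne_zero_iff _ _).2 hj⟩, ⟨u i, (hx.entry_ne_zero_iff _ _).2 hi⟩⟩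
  · have : x.entry p p ≠ 0 := by rw [hx.diag p hp hpR]; exact one_ne_zero
    exact ⟨⟨p, this⟩, ⟨p, this⟩⟩

theorem IsCopy.conj {g : Fin (m + l) → G} {σ : Equiv.Perm (Fin (m + l))} (hg : IsLower m g σ)
    (hx : IsCopy N R x) : IsCopy N (R.map σ.toEmbedding) (conj g σ x) := by
  obtain ⟨u, h, hx⟩ := hx
  refine ⟨fun v => σ (u v), fun v => g (σ (u v)) * h v, σ.injective.comp hx.inj, fun i => ?_,
    fun i => ?_, fun p => ?_, fun v w => ?_, fun p hp hpR => ?_⟩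
  · rw [hx.top, (hg _ (Fin.castAdd_lt l i)).1]
  · rw [hx.top, hx.label_top, mul_one, (hg _ (Fin.castAdd_lt l i)).1,
      (hg _ (Fin.castAdd_lt l i)).2]
  · rw [Finset.mem_map_equiv, hx.mem_iff]
    simp only [Equiv.eq_symm_apply]
  · rw [conj_entry, hx.entry]
    simp only [WithZero.coe_mul, mul_inv_rev, mul_assoc]
  · rw [Finset.mem_map_equiv] at hpR
    obtain ⟨p, rfl⟩ := σ.surjective p
    rw [conj_entry_self]
    rw [Equiv.symm_apply_apply] at hpR
    exact hx.diag p (hg.le_apply.1 hp) hpR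

/-- When `R` and `R'` contain all lower indices, the placements `u` and `u'` are bijections onto all
indices. Conjugation by `u' ∘ u⁻¹` with labels `h' h⁻¹` carries one copy to the other, and it is
trivial on the first `m` indices because both placements are fixed there with label `1`. -/
theorem IsCopy.exists_conj {R' : Finset (Fin (m + l))} {x' : PartialMonomial (m + l) G}
    (hx : IsCopy N R x) (hx' : IsCopy N R' x')
    (hR : ∀ p : Fin (m + l), m ≤ p.val → p ∈ R) (hR' : ∀ p : Fin (m + l), m ≤ p.val → p ∈ R') :
    ∃ (g : Fin (m + l) → G) (σ : Equiv.Perm (Fin (m + l))),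
      IsLower m g σ ∧ PartialMonomial.conj g σ x = x' := by
  obtain ⟨u, h, hx⟩ := hx
  obtain ⟨u', h', hx'⟩ := hx'
  let e := Equiv.ofBijective u ⟨hx.inj, hx.surjective hR⟩
  let e' := Equiv.ofBijective u' ⟨hx'.inj, hx'.surjective hR'⟩
  have he : ∀ v, (e.symm.trans e') (u v) = u' v := fun v => by
    rw [Equiv.trans_apply]
    exact congrArg u' (e.symm_apply_apply v)
  have he' : ∀ v, e'.symm (u' v) = v := fun v => e'.symm_apply_apply v
  refine ⟨fun p => h' (e'.symm p) * (h (e'.symm p))⁻¹, e.symm.trans e', fun i hi => ?_, ?_⟩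
  · obtain ⟨i, rfl⟩ := hx.exists_of_lt hi
    have h1 : u (Sum.inl i) = u' (Sum.inl i) := by rw [hx.top, hx'.top]
    refine ⟨by rw [he, h1], ?_⟩
    simp only [h1, he', hx.label_top, hx'.label_top, inv_one, mul_one]
  · apply conj_eq_of_entry
    intro i j
    obtain ⟨i, rfl⟩ := hx.surjective hR i
    obtain ⟨j, rfl⟩ := hx.surjective hR j
    rw [he, he, hx'.entry, hx.entry]
    have hcancel : ∀ (g : G) (z : WithZero G), ((g⁻¹ : G) : WithZero G) * (g * z) = z := by
      intro g z
      rw [← mul_assoc, ← WithZero.coe_mul, inv_mul_cancel, WithZero.coe_one, one_mul]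
    simp only [he', mul_inv_rev, inv_inv, WithZero.coe_mul, mul_assoc, hcancel]

theorem IsPattern.exists_isCopy [Fintype K] (hN : IsPattern N) (hl : Fintype.card K = l) :
    ∃ x : PartialMonomial (m + l) G, IsCopy N (Finset.univ.filter fun p => m ≤ p.val) x := by
  let e : Fin m ⊕ K ≃ Fin (m + l) :=
    (Equiv.sumCongr (Equiv.refl _) (Fintype.equivFinOfCardEq hl)).trans finSumFinEquiv
  refine ⟨⟨fun i j => N (e.symm i) (e.symm j), fun i j j' h h' => e.symm.injective
    (hN.row_unique _ _ _ h h'), fun i i' j h h' => e.symm.injective (hN.col_unique _ _ _ h h')⟩,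
    e, fun _ => 1, e.injective, fun i => ?_, fun i => rfl, fun p => ?_, fun v w => ?_,
    fun p hp hpR => ?_⟩
  · simp [e]
  · rw [Finset.mem_filter]
    constructor
    · rintro ⟨-, hp⟩
      refine ⟨(Fintype.equivFinOfCardEq hl).symm ⟨p.val - m, by omega⟩, ?_⟩
      simp only [e, Equiv.trans_apply, Equiv.sumCongr_apply, Sum.map_inr, Equiv.apply_symm_apply,
        finSumFinEquiv_apply_right]
      apply Fin.ext
      simp only [Fin.val_natAdd]
      omega
    · rintro ⟨v, rfl⟩
      simp [e]
  · simp
  · simp [hp] at hpR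

end Copies

/-! ### Copy sums as elements of the projective limit. -/

section CopySum

variable {F : Type*} [Field F] {G : Type*} [Group G] [Fintype G] {m : ℕ} {K : Type*}

open scoped Classical in
/-- The sum of the elements `ε̄_R x ε̄_R` over all copies `(R, x)` of the pattern `N`. -/
noncomputable def copySum (F : Type*) [Field F] (N : Fin m ⊕ K → Fin m ⊕ K → WithZero G) (l : ℕ) :
    MonoidAlgebra F (PartialMonomial (m + l) G) :=
  ∑ q ∈ Finset.univ.filter (fun q : Finset (Fin (m + l)) × PartialMonomial (m + l) G =>
    IsCopy N q.1 q.2), sandwich F q.1 q.2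

variable (F) (N : Fin m ⊕ K → Fin m ⊕ K → WithZero G)

theorem of_wreath_mul_copySum {l : ℕ} {g : Fin (m + l) → G} {σ : Equiv.Perm (Fin (m + l))}
    (hg : IsLower m g σ) :
    MonoidAlgebra.of F _ (wreath g σ) * copySum F N l =
      copySum F N l * MonoidAlgebra.of F _ (wreath g σ) := by
  classical
  rw [copySum, Finset.mul_sum, Finset.sum_mul]
  have hinj : Set.InjOn (fun q : Finset (Fin (m + l)) × PartialMonomial (m + l) G =>
      (q.1.map σ.toEmbedding, conj g σ q.2))
      (Finset.univ.filter fun q : Finset (Fin (m + l)) × PartialMonomial (m + l) G =>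
        IsCopy N q.1 q.2) := by
    intro q _ q' _ h
    rw [Prod.mk.injEq] at h
    exact Prod.ext (Finset.map_injective _ h.1) (conj_injective g σ h.2)
  have hmaps : Set.MapsTo (fun q : Finset (Fin (m + l)) × PartialMonomial (m + l) G =>
      (q.1.map σ.toEmbedding, conj g σ q.2))
      (Finset.univ.filter fun q : Finset (Fin (m + l)) × PartialMonomial (m + l) G =>
        IsCopy N q.1 q.2)
      (Finset.univ.filter fun q : Finset (Fin (m + l)) × PartialMonomial (m + l) G =>
        IsCopy N q.1 q.2) := by
    intro q hq
    simp only [Finset.coe_filter, Finset.mem_univ, true_and, Set.mem_ofPred_eq] at hq ⊢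
    exact hq.conj hg
  -- Conjugation is an injective self-map of the finite set of copies, hence a permutation of it.
  exact Finset.sum_nbij _ hmaps hinj (Finset.surjOn_of_injOn_of_card_le _ hmaps hinj le_rfl)
    fun q _ => of_wreath_mul_sandwich g σ q.1 q.2

theorem copySum_mem_centralizer (l : ℕ) : copySum F N l ∈ centralizer F G m (m + l) := by
  classical
  refine mem_centralizer_of_commute (fun p hp => ?_) fun g σ hg => of_wreath_mul_copySum F N hg
  refine Commute.sum_right _ _ _ fun q hq => ?_
  rw [Finset.mem_filter] at hq
  exact of_eps_commute_sandwich fun hpR => hq.2.diag hp hpR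

/-- Copies whose index set contains the last index map to zero under `θ`. The remaining ones fix the
last index, so they are exactly the extensions by `1` of the copies one level below. -/
theorem theta_copySum (l : ℕ) : theta (n := m + l) (copySum F N (l + 1)) = copySum F N l := by
  classical
  rw [copySum, map_sum, copySum]
  symm
  refine Finset.sum_of_injOn (fun q => (q.1.map Fin.castSuccEmb, q.2.extend)) ?_ ?_ ?_ ?_
  · intro q _ q' _ h
    rw [Prod.mk.injEq] at h
    refine Prod.ext (Finset.map_injective _ h.1) ?_
    rw [← trunc_extend q.2, h.2, trunc_extend]
  · rintro ⟨R, x⟩ hq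
    simp only [Finset.coe_filter, Finset.mem_univ, true_and, Set.mem_ofPred_eq] at hq ⊢
    obtain ⟨u, h, hx⟩ := hq
    refine ⟨fun v => (u v).castSucc, h, (Fin.castSucc_injective _).comp hx.inj, fun i => ?_,
      hx.label_top, fun p => ?_, fun v w => ?_, fun p hp hpR => ?_⟩
    · rw [hx.top]
      rfl
    · induction p using Fin.lastCases with
      | last => 
        simp [Fin.castSucc_ne_last]
      | cast p => 
        simp [hx.mem_iff]
    · rw [← hx.entry, extend_entry_castSucc]
    · induction p using Fin.lastCases with
      | last => exact extend_entry_last x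
      | cast p =>
        rw [extend_entry_castSucc]
        exact hx.diag p hp fun h => hpR (Finset.mem_map_of_mem _ h)
  · rintro ⟨R, x⟩ hq hq'
    simp only [Finset.mem_filter, Finset.mem_univ, true_and] at hq
    by_cases hR : Fin.last (m + l) ∈ R
    · exact theta_sandwich_of_last_mem hR x
    · exfalso
      obtain ⟨u, h, hx⟩ := hq
      -- The placement avoids the last index, so it descends to the smaller index set.
      have hu : ∀ v, ∃ p, Fin.castSucc p = u v := by
        intro v
        rw [Fin.exists_castSucc_eq]
        intro hv
        cases v with
        | inl i =>
          rw [hx.top] at hv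
          exact (Fin.castSucc_ne_last (Fin.castAdd l i)) hv
        | inr v => exact hR ((hx.mem_iff _).2 ⟨v, hv⟩)
      choose u' hu' using hu
      have hlast : x.entry (Fin.last (m + l)) (Fin.last (m + l)) = 1 :=
        hx.diag _ (Nat.le_add_right m l) hR
      refine hq' ⟨(Finset.univ.filter fun p : Fin (m + l) => p.castSucc ∈ R, x.trunc), ?_,
        Prod.ext ?_ (eq_of_trunc_eq (trunc_extend _) (extend_entry_last _) hlast)⟩
      · simp only [Finset.coe_filter, Finset.mem_univ, true_and, Set.mem_ofPred_eq]
        refine ⟨u', h, fun v w hvw => hx.inj (by rw [← hu', ← hu', hvw]), fun i => ?_,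
          hx.label_top, fun p => ?_, fun v w => ?_, fun p hp hpR => ?_⟩
        · apply Fin.castSucc_injective
          rw [hu', hx.top]
          rfl
        · rw [Finset.mem_filter, hx.mem_iff]
          simp only [Finset.mem_univ, true_and, ← hu', Fin.castSucc_inj]
        · rw [trunc_entry, hu', hu', hx.entry]
        · exact hx.diag _ hp (by simpa using hpR)
      · ext p
        induction p using Fin.lastCases with
        | last => simpa [Fin.castSucc_ne_last] using hR
        | cast p => simp
  · rintro ⟨R, x⟩ hq
    rw [theta_sandwich (extend_entry_last x), trunc_extend]

/-- Lower indices outside `R` keep diagonal entry `1` throughout the expansion of `ε̄_R x ε̄_R`, and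
`|R| = |K|`. -/
theorem mdeg_le_of_mem_support_copySum [Fintype K] {l : ℕ} {γ : PartialMonomial (m + l) G}
    (hγ : γ ∈ (copySum F N l).coeff.support) : γ.mdeg m ≤ Fintype.card K := by
  classical
  rw [copySum, MonoidAlgebra.coeff_sum] at hγ
  obtain ⟨q, hq, hγ⟩ := Finset.mem_biUnion.1 (Finsupp.support_finsetSum hγ)
  rw [Finset.mem_filter] at hq
  rw [← hq.2.card, mdeg]
  apply Finset.card_le_card
  intro p hp
  rw [Finset.mem_filter] at hp
  by_contra hpR
  exact hp.2.2 (FixesDiag.sandwich hpR (hq.2.diag hp.2.1 hpR) γ hγ)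

theorem deg_le_add_mdeg {l : ℕ} (γ : PartialMonomial (m + l) G) : γ.deg ≤ m + γ.mdeg m := by
  classical
  have h : (Finset.univ.filter fun k : Fin (m + l) => k.val < m).card ≤ m := by
    refine (Finset.card_le_card_of_injOn (t := Finset.range m) Fin.val ?_
      Fin.val_injective.injOn).trans (Finset.card_range m).le
    intro k hk
    simpa using hk
  refine le_trans (Finset.card_le_card ?_)
    ((Finset.card_union_le _ _).trans (Nat.add_le_add_right h _))
  intro k hk
  simp only [Finset.mem_union, Finset.mem_filter, Finset.mem_univ, true_and] at hk ⊢
  by_cases hm : k.val < m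
  · exact Or.inl hm
  · exact Or.inr ⟨not_lt.1 hm, hk⟩

theorem mdeg_le_deg {l : ℕ} (γ : PartialMonomial (m + l) G) : γ.mdeg m ≤ γ.deg := by
  classical
  apply Finset.card_le_card
  intro k hk
  simp only [Finset.mem_filter, Finset.mem_univ, true_and] at hk ⊢
  exact hk.2

theorem copySum_mem_limitCentralizer [Fintype K] : copySum F N ∈ limitCentralizer F G m :=
  ⟨copySum_mem_centralizer F N, theta_copySum F N, m + Fintype.card K, fun _ γ hγ =>
    (deg_le_add_mdeg γ).trans (Nat.add_le_add_left (mdeg_le_of_mem_support_copySum F N hγ) m)⟩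

end CopySum

end WreathCentralizer

namespace WreathCentralizer

open PartialMonomial

/-! ### The dual functionals and separation of points. -/

section Functional

variable {F : Type*} [Field F] {G : Type*} [Group G] [Fintype G]

open scoped Classical in
/-- The sum of the coefficients of the matrices that become `z` on killing the rows and columns
in `S`. -/
noncomputable def killCoeff {n : ℕ} (S : Finset (Fin n)) (z : PartialMonomial n G) :
    MonoidAlgebra F (PartialMonomial n G) →ₗ[F] F where
  toFun α := ∑ y, if kill S y = z then α.coeff y else 0
  map_add' α β := by
    rw [← Finset.sum_add_distrib]
    refine Finset.sum_congr rfl fun y _ => ?_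
    split_ifs <;> simp
  map_smul' c α := by
    rw [smul_eq_mul, Finset.mul_sum]
    refine Finset.sum_congr rfl fun y _ => ?_
    split_ifs <;> simp

open scoped Classical in
theorem killCoeff_single {n : ℕ} (S : Finset (Fin n)) (z a : PartialMonomial n G) (b : F) :
    killCoeff S z (MonoidAlgebra.single a b) = if kill S a = z then b else 0 := by
  rw [killCoeff, LinearMap.coe_mk, AddHom.coe_mk, Finset.sum_eq_single a]
  · simp
  · intro y _ hy
    rw [MonoidAlgebra.coeff_single, Finsupp.single_apply, if_neg (Ne.symm hy), ite_self]
  · simp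

/-- Sandwiching with `ε_p` deletes row and column `p`, which deletion along `S` does anyway. -/
theorem killCoeff_eps_mul_mul_eps {n : ℕ} {S : Finset (Fin n)} {p : Fin n} (hp : p ∈ S)
    (z : PartialMonomial n G) (α : MonoidAlgebra F (PartialMonomial n G)) :
    killCoeff S z (MonoidAlgebra.of F _ (eps p) * α * MonoidAlgebra.of F _ (eps p)) =
      killCoeff S z α := by
  classical
  induction α using MonoidAlgebra.induction_linear with
  | zero => rw [mul_zero, zero_mul]
  | add f g hf hg => rw [mul_add, add_mul, map_add, hf, hg, map_add]
  | single a b =>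
    rw [MonoidAlgebra.of_apply, MonoidAlgebra.single_mul_single, MonoidAlgebra.single_mul_single,
      one_mul, mul_one, ← kill_singleton, killCoeff_single, killCoeff_single, kill_kill,
      Finset.union_eq_left.2 (Finset.singleton_subset_iff.2 hp)]

variable {m l : ℕ}

open scoped Classical in
/-- The last indices at which the diagonal entry is `1`. -/
noncomputable def fixSet (x : PartialMonomial (m + l) G) : Finset (Fin (m + l)) :=
  Finset.univ.filter fun p => m ≤ p.val ∧ x.entry p p = 1

theorem mem_fixSet {x : PartialMonomial (m + l) G} {p : Fin (m + l)} :
    p ∈ fixSet x ↔ m ≤ p.val ∧ x.entry p p = 1 := by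
  simp [fixSet]

/-- The functional reading off the coefficient of `ε̄ x ε̄`, where `ε̄` is the product of all
`1 - ε_i` with `i` among the last `l` indices. -/
noncomputable def dual (x : PartialMonomial (m + l) G) :
    MonoidAlgebra F (PartialMonomial (m + l) G) →ₗ[F] F :=
  ∑ S ∈ (fixSet x).powerset, (-1 : F) ^ S.card • killCoeff S (kill S x)

theorem dual_apply (x : PartialMonomial (m + l) G)
    (α : MonoidAlgebra F (PartialMonomial (m + l) G)) :
    dual x α = ∑ S ∈ (fixSet x).powerset, (-1 : F) ^ S.card * killCoeff S (kill S x) α := by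
  simp [dual]

/-- For nonempty `S` the term at `S` does not distinguish `α` from `ε_p α ε_p = 0` with `p ∈ S`.
Only `S = ∅` survives, and it is the plain coefficient. -/
theorem dual_eq_coeff {α : MonoidAlgebra F (PartialMonomial (m + l) G)}
    (hα : ∀ p : Fin (m + l), m ≤ p.val →
      MonoidAlgebra.of F _ (eps p) * α * MonoidAlgebra.of F _ (eps p) = 0)
    (x : PartialMonomial (m + l) G) : dual x α = α.coeff x := by
  classical
  rw [dual_apply, Finset.sum_eq_single ∅]
  · rw [Finset.card_empty, pow_zero, one_mul, kill_empty, killCoeff, LinearMap.coe_mk,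
      AddHom.coe_mk]
    simp [kill_empty]
  · intro S hS hne
    obtain ⟨p, hp⟩ := Finset.nonempty_iff_ne_empty.2 hne
    rw [← killCoeff_eps_mul_mul_eps hp, hα p (mem_fixSet.1 (Finset.mem_powerset.1 hS hp)).1,
      map_zero, mul_zero]
  · simp

/-- Inclusion-exclusion: if `x` fixes `p`, the terms at `S` and `S ∪ {p}` cancel. Otherwise no
admissible `S` contains `p`, and the entry at `(p, p)` always separates `x` from `y`. -/
theorem dual_single_eq_zero {y : PartialMonomial (m + l) G} {p : Fin (m + l)} (hp : m ≤ p.val)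
    (hy : y.entry p p = 1) (x : PartialMonomial (m + l) G) (c : F) :
    dual x (MonoidAlgebra.single y c) = 0 := by
  classical
  simp only [dual_apply, killCoeff_single]
  by_cases hx : x.entry p p = 1
  · have hpx : p ∈ fixSet x := mem_fixSet.2 ⟨hp, hx⟩
    rw [← Finset.insert_erase hpx, Finset.sum_powerset_insert (Finset.notMem_erase p _),
      ← Finset.sum_add_distrib]
    refine Finset.sum_eq_zero fun S hS => ?_
    have hpS : p ∉ S := fun h => Finset.notMem_erase p _ (Finset.mem_powerset.1 hS h)
    -- Row and column `p` of both matrices consist of the single diagonal entry `1`, so deleting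
    -- them loses no information.
    have hiff : kill (insert p S) y = kill (insert p S) x ↔ kill S y = kill S x := by
      constructor
      · intro h
        have key : ∀ {a b : PartialMonomial (m + l) G}, a.entry p p = 1 → b.entry p p = 1 →
            kill (insert p S) a = kill (insert p S) b → ∀ i j, (kill S a).entry i j ≠ 0 →
            (kill S b).entry i j = (kill S a).entry i j := by
          intro a b ha hb hab i j hij
          have hap : (kill S a).entry p p ≠ 0 := by
            rw [kill_entry, if_neg (by simp [hpS]), ha]
            exact one_ne_zero
          by_cases hi : i = p
          · subst hi
            obtain rfl := (kill S a).row_unique _ _ _ hij hap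
            rw [kill_entry, kill_entry, ha, hb]
          · by_cases hj : j = p
            · subst hj
              exact absurd ((kill S a).col_unique _ _ _ hij hap) hi
            · have := congrArg (fun z => z.entry i j) hab
              simp only [kill_entry, Finset.mem_insert, hi, hj, false_or] at this ⊢
              exact this.symm
        exact ext_of_ne (key hy hx h) (key hx hy h.symm)
      · intro h
        rw [Finset.insert_eq, ← kill_kill, h, kill_kill]
    simp only [hiff, Finset.card_insert_of_notMem hpS, pow_succ]
    ring
  · refine Finset.sum_eq_zero fun S hS => ?_
    rw [if_neg, mul_zero]
    intro h
    have hpS : p ∉ S := fun h => hx (mem_fixSet.1 (Finset.mem_powerset.1 hS h)).2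
    have := congrArg (fun z => z.entry p p) h
    simp only [kill_entry, hpS, or_self, if_false, hy] at this
    exact hx this.symm

theorem eq_sum_single {n : ℕ} (α : MonoidAlgebra F (PartialMonomial n G)) :
    α = ∑ y ∈ α.coeff.support, MonoidAlgebra.single y (α.coeff y) :=
  (MonoidAlgebra.sum_coeff_single α).symm

theorem dual_eq_zero_of_support {α : MonoidAlgebra F (PartialMonomial (m + l) G)}
    (hα : ∀ y ∈ α.coeff.support, ∃ p : Fin (m + l), m ≤ p.val ∧ y.entry p p = 1)
    (x : PartialMonomial (m + l) G) : dual x α = 0 := by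
  rw [eq_sum_single α, map_sum]
  refine Finset.sum_eq_zero fun y hy => ?_
  obtain ⟨p, hp, hyp⟩ := hα y hy
  exact dual_single_eq_zero hp hyp x _

theorem card_lower : (Finset.univ.filter fun p : Fin (m + l) => m ≤ p.val).card = l := by
  have : (Finset.univ.filter fun p : Fin (m + l) => m ≤ p.val) =
      Finset.univ.map (Fin.natAddEmb m) := by
    ext p
    simp only [Finset.mem_filter, Finset.mem_univ, true_and, Finset.mem_map, Fin.natAddEmb_apply]
    constructor
    · intro hp
      refine ⟨⟨p.val - m, by omega⟩, Fin.ext ?_⟩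
      simp only [Fin.val_natAdd]
      omega
    · rintro ⟨i, rfl⟩
      simp
  rw [this, Finset.card_map, Finset.card_univ, Fintype.card_fin]

/-- There are `l` lower indices, so a matrix of `m`-degree below `l` fixes at least one of them. -/
theorem dual_eq_zero_of_mdeg_lt {α : MonoidAlgebra F (PartialMonomial (m + l) G)}
    (hα : ∀ y ∈ α.coeff.support, y.mdeg m < l) (x : PartialMonomial (m + l) G) :
    dual x α = 0 := by
  classical
  refine dual_eq_zero_of_support (fun y hy => ?_) x
  by_contra! h
  have h1 := (hα y hy).trans_eq (card_lower (m := m) (l := l)).symm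
  rw [mdeg] at h1
  refine absurd h1 (not_lt.2 (Finset.card_le_card fun p hp => ?_))
  simp only [Finset.mem_filter, Finset.mem_univ, true_and] at hp ⊢
  exact ⟨hp, h p hp⟩

-- A copy on a proper subset of the lower indices fixes some lower index throughout and contributes
-- zero. A copy on all of them is annihilated by every lower `ε_p`, so the functional is its
-- coefficient at `x`, given by `coeff_sandwich`.
open scoped Classical in
theorem dual_copySum {K : Type*} (N : Fin m ⊕ K → Fin m ⊕ K → WithZero G)
    {x : PartialMonomial (m + l) G} (hx : IsFull x) :
    dual x (copySum F N l) =
      if IsCopy N (Finset.univ.filter fun p : Fin (m + l) => m ≤ p.val) x then 1 else 0 := by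
  set U := Finset.univ.filter fun p : Fin (m + l) => m ≤ p.val with hU
  have key : ∀ q : Finset (Fin (m + l)) × PartialMonomial (m + l) G, IsCopy N q.1 q.2 →
      dual x (sandwich F q.1 q.2) = if q = (U, x) then 1 else 0 := by
    rintro ⟨R, y⟩ hy
    by_cases hR : R = U
    · subst hR
      have hmem : ∀ p : Fin (m + l), p ∈ U ↔ m ≤ p.val := by simp [hU]
      rw [dual_eq_coeff, coeff_sandwich fun p hp => hx p ((hmem p).1 hp)]
      · simp
      · intro p hp
        rw [sandwich, ← mul_assoc, ← mul_assoc, of_eps_mul_epsBar ((hmem p).2 hp), zero_mul,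
          zero_mul, zero_mul]
    · rw [if_neg (by simp [hR])]
      have : ∃ p, m ≤ p.val ∧ p ∉ R := by
        by_contra! h
        refine hR (Finset.Subset.antisymm (fun p hp => ?_) fun p hp => ?_)
        · simpa [hU] using hy.le_of_mem hp
        · exact h p (by simpa [hU] using hp)
      obtain ⟨p, hp, hpR⟩ := this
      exact dual_eq_zero_of_support
        (fun z hz => ⟨p, hp, FixesDiag.sandwich hpR (hy.diag hp hpR) z hz⟩) x
  rw [copySum, map_sum, Finset.sum_congr rfl fun q hq => key q (Finset.mem_filter.1 hq).2,
    Finset.sum_ite_eq' _ (U, x)]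
  simp

theorem coeff_conj {g : Fin (m + l) → G} {σ : Equiv.Perm (Fin (m + l))}
    {α : MonoidAlgebra F (PartialMonomial (m + l) G)}
    (hα : Commute (MonoidAlgebra.of F _ (wreath g σ)) α) (y : PartialMonomial (m + l) G) :
    α.coeff (conj g σ y) = α.coeff y := by
  have h := congrArg (fun z => z.coeff (wreath g σ * y)) hα.eq
  simp only [MonoidAlgebra.of_apply] at h
  rw [MonoidAlgebra.coeff_single_mul_eq_mul_coeff y, one_mul,
    MonoidAlgebra.coeff_mul_single_eq_coeff_mul (conj g σ y), mul_one] at h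
  · exact h.symm
  · intro z _
    rw [← conj_mul_wreath]
    exact (wreathUnit g σ).mul_left_inj
  · intro z _
    exact (wreathUnit g σ).mul_right_inj

theorem killCoeff_conj {g : Fin (m + l) → G} {σ : Equiv.Perm (Fin (m + l))}
    {α : MonoidAlgebra F (PartialMonomial (m + l) G)}
    (hα : Commute (MonoidAlgebra.of F _ (wreath g σ)) α) (S : Finset (Fin (m + l)))
    (z : PartialMonomial (m + l) G) :
    killCoeff (S.map σ.toEmbedding) (conj g σ z) α = killCoeff S z α := by
  classical
  simp only [killCoeff, LinearMap.coe_mk, AddHom.coe_mk]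
  symm
  refine Fintype.sum_bijective (conj g σ) ⟨conj_injective g σ, conj_surjective g σ⟩ _ _
    fun y => ?_
  rw [kill_conj, coeff_conj hα, (conj_injective g σ).eq_iff]

/-- On the centralizer, one functional per conjugacy class of full matrices therefore suffices. -/
theorem dual_conj {g : Fin (m + l) → G} {σ : Equiv.Perm (Fin (m + l))} (hg : IsLower m g σ)
    {α : MonoidAlgebra F (PartialMonomial (m + l) G)}
    (hα : Commute (MonoidAlgebra.of F _ (wreath g σ)) α) (x : PartialMonomial (m + l) G) :
    dual (conj g σ x) α = dual x α := by
  classical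
  have hfix : fixSet (conj g σ x) = (fixSet x).map σ.toEmbedding := by
    ext p
    obtain ⟨p, rfl⟩ := σ.surjective p
    rw [mem_fixSet, Finset.mem_map_equiv, Equiv.symm_apply_apply, mem_fixSet, conj_entry_self,
      hg.le_apply]
  rw [dual_apply, dual_apply, hfix]
  symm
  refine Finset.sum_nbij (fun S => S.map σ.toEmbedding) (fun S hS => ?_)
    (Finset.map_injective _).injOn (fun S hS => ?_) fun S _ => ?_
  · rw [Finset.mem_powerset] at hS ⊢
    exact Finset.map_subset_map.2 hS
  · rw [Finset.mem_coe, Finset.mem_powerset] at hS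
    obtain ⟨T, hT, rfl⟩ := Finset.subset_map_iff.1 hS
    exact ⟨T, Finset.mem_powerset.2 hT, rfl⟩
  · rw [Finset.card_map, kill_conj, killCoeff_conj hα]

/-- Since `α` commutes with the idempotents `ε_p`, the hypothesis gives `ε_p α = 0`, hence `α = ε̄ α
ε̄` over all lower indices. In the expansion the matrices that are not full are killed by `ε̄`, and
the full ones have coefficient zero. -/
theorem eq_zero_of_theta_of_dual {l : ℕ} {α : MonoidAlgebra F (PartialMonomial (m + l) G)}
    (hα : α ∈ centralizer F G m (m + l))
    (heps : ∀ p : Fin (m + l), m ≤ p.val →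
      MonoidAlgebra.of F _ (eps p) * α * MonoidAlgebra.of F _ (eps p) = 0)
    (hdual : ∀ x, IsFull x → dual x α = 0) : α = 0 := by
  have hcomm : ∀ p : Fin (m + l), m ≤ p.val → Commute (MonoidAlgebra.of F _ (eps p)) α :=
    fun p hp => commute_of_mem_centralizer hα (eps_mem_lowerSemigroup hp)
  have h0 : ∀ p : Fin (m + l), m ≤ p.val → MonoidAlgebra.of F _ (eps p) * α = 0 := by
    intro p hp
    have := heps p hp
    rwa [mul_assoc, ← (hcomm p hp).eq, ← mul_assoc, ← map_mul, eps_mul_eps] at this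
  set U := Finset.univ.filter fun p : Fin (m + l) => m ≤ p.val with hU
  have hmem : ∀ p : Fin (m + l), p ∈ U ↔ m ≤ p.val := by simp [hU]
  have h1 : epsBar F U * α * epsBar F U = α := by
    rw [epsBar_mul_eq_self fun p hp => h0 p ((hmem p).1 hp), mul_epsBar_eq_self]
    intro p hp
    rw [← (hcomm p ((hmem p).1 hp)).eq, h0 p ((hmem p).1 hp)]
  rw [← h1, eq_sum_single α, Finset.mul_sum, Finset.sum_mul]
  refine Finset.sum_eq_zero fun y _ => ?_
  by_cases hy : IsFull y
  · rw [← dual_eq_coeff heps, hdual y hy, MonoidAlgebra.single_zero, mul_zero, zero_mul]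
  · simp only [IsFull, not_forall, not_and_or, not_exists, not_not] at hy
    obtain ⟨p, hp, hy⟩ := hy
    rcases hy with hy | hy
    · have : epsBar F U * MonoidAlgebra.single y (α.coeff y) = 0 := by
        have h2 : MonoidAlgebra.single y (α.coeff y) =
            MonoidAlgebra.of F _ (eps p) * MonoidAlgebra.single y (α.coeff y) := by
          rw [MonoidAlgebra.of_apply, MonoidAlgebra.single_mul_single, one_mul]
          congr 1
          apply PartialMonomial.ext
          funext i j
          rw [eps_mul_entry]
          split_ifs with h
          · rw [h, hy j]
          · rfl
        rw [h2, ← mul_assoc, epsBar_mul_of_eps ((hmem p).2 hp), zero_mul]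
      rw [this, zero_mul]
    · have : MonoidAlgebra.single y (α.coeff y) * epsBar F U = 0 := by
        have h2 : MonoidAlgebra.single y (α.coeff y) =
            MonoidAlgebra.single y (α.coeff y) * MonoidAlgebra.of F _ (eps p) := by
          rw [MonoidAlgebra.of_apply, MonoidAlgebra.single_mul_single, mul_one]
          congr 1
          apply PartialMonomial.ext
          funext i j
          rw [mul_eps_entry]
          split_ifs with h
          · rw [h, hy i]
          · rfl
        rw [h2, mul_assoc, of_eps_mul_epsBar ((hmem p).2 hp), mul_zero]
      rw [mul_assoc, this, mul_zero]

/-- For the last index this follows from `θ(α) = 0`. A transposition of lower indices commutes with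
`α` and carries the conclusion to any other `p`. -/
theorem eps_mul_mul_eps_of_theta_eq_zero_of_mem {l : ℕ}
    {α : MonoidAlgebra F (PartialMonomial (m + (l + 1)) G)}
    (hα : α ∈ centralizer F G m (m + (l + 1))) (h : theta (n := m + l) α = 0)
    {p : Fin (m + (l + 1))} (hp : m ≤ p.val) :
    MonoidAlgebra.of F _ (eps p) * α * MonoidAlgebra.of F _ (eps p) = 0 := by
  set q : Fin (m + (l + 1)) := Fin.last (m + l) with hq
  have hg : IsLower m (fun _ => (1 : G)) (Equiv.swap q p) := by
    intro i hi
    refine ⟨Equiv.swap_apply_of_ne_of_ne ?_ ?_, rfl⟩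
    · rintro rfl
      rw [hq, Fin.val_last] at hi
      omega
    · rintro rfl
      omega
  have hc := commute_of_mem_centralizer hα hg.wreath_mem
  set w := MonoidAlgebra.of F _ (wreath (fun _ => (1 : G)) (Equiv.swap q p)) with hw
  have h1 : MonoidAlgebra.of F _ (eps p) * w = w * MonoidAlgebra.of F _ (eps q) := by
    rw [hw, ← map_mul, ← map_mul, ← conj_mul_wreath, conj_eps, Equiv.swap_apply_left]
  have h2 : MonoidAlgebra.of F _ (eps p) * α * MonoidAlgebra.of F _ (eps p) * w = 0 := by
    rw [mul_assoc, h1, mul_assoc, ← mul_assoc α, ← hc.eq, mul_assoc w, ← mul_assoc _ w, h1,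
      mul_assoc, ← mul_assoc _ α]
    exact (congrArg (w * ·) (eps_mul_mul_eps_of_theta_eq_zero h)).trans (mul_zero w)
  have h3 := congrArg (fun z => z * MonoidAlgebra.of F _
    (↑(wreathUnit (fun _ => (1 : G)) (Equiv.swap q p))⁻¹ : PartialMonomial (m + (l + 1)) G)) h2
  simp only [hw, mul_assoc, zero_mul] at h3
  rw [← map_mul _ (wreath _ _)] at h3
  erw [(wreathUnit (fun _ => (1 : G)) (Equiv.swap q p)).mul_inv] at h3
  rw [map_one, mul_one, ← mul_assoc] at h3
  exact h3

/-- Induction on the level: vanishing at level `l` says that `θ` kills the component at level `l +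
1`. At level `0` there are no lower indices. -/
theorem eq_zero_of_forall_dual_eq_zero {α : limitCentralizer F G m}
    (h : ∀ (l : ℕ) (x : PartialMonomial (m + l) G), IsFull x → dual x (α.1 l) = 0) : α = 0 := by
  apply Subtype.ext
  funext l
  change α.1 l = 0
  induction l with
  | zero =>
    refine eq_zero_of_theta_of_dual (α.2.1 0) (fun p hp => ?_) (h 0)
    exact absurd p.2 (not_lt.2 hp)
  | succ l ih =>
    refine eq_zero_of_theta_of_dual (α.2.1 (l + 1)) (fun p hp => ?_) (h (l + 1))
    refine eps_mul_mul_eps_of_theta_eq_zero_of_mem (α.2.1 (l + 1)) ?_ hp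
    rw [α.2.2.1 l, ih]

end Functional

end WreathCentralizer

namespace WreathCentralizer

open PartialMonomial

/-! ### Bases from biorthogonal systems, and the abstract basis theorem. -/

section DualBasis

-- The vector `∑ δ_i(a) v_i`, a finite sum, has the same coordinates as `a`, and the functionals
-- separate points.
open scoped Classical in
theorem exists_basis_of_dual {ι F M : Type*} [Field F] [AddCommGroup M] [Module F M] (v : ι → M)
    (δ : ι → M →ₗ[F] F) (hδ : ∀ i j, δ i (v j) = if i = j then 1 else 0)
    (hfin : ∀ a, {i | δ i a ≠ 0}.Finite) (hinj : ∀ a, (∀ i, δ i a = 0) → a = 0) :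
    ∃ b : Module.Basis ι F M, ∀ i, b i = v i := by
  have hli : LinearIndependent F v := by
    rw [linearIndependent_iff']
    intro s c hc i hi
    have := congrArg (δ i) hc
    simpa [map_sum, hδ, hi] using this
  have hspan : ⊤ ≤ Submodule.span F (Set.range v) := by
    intro a _
    have : a = ∑ i ∈ (hfin a).toFinset, δ i a • v i := by
      rw [← sub_eq_zero]
      apply hinj
      intro j
      rw [map_sub, map_sum]
      simp only [map_smul, hδ, smul_eq_mul, mul_ite, mul_one, mul_zero, Finset.sum_ite_eq,
        Set.Finite.mem_toFinset, Set.mem_ofPred_eq]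
      split_ifs with h
      · exact sub_self _
      · rw [not_not.1 h, sub_zero]
    rw [this]
    exact Submodule.sum_mem _ fun i _ => Submodule.smul_mem _ _ (Submodule.subset_span ⟨i, rfl⟩)
  exact ⟨Module.Basis.mk hli hspan, fun i => Module.Basis.mk_apply hli hspan i⟩

end DualBasis

section Family

variable (F : Type*) [Field F] {G : Type*} [Group G] [Fintype G] {m : ℕ} {ι : Type*}
  {K : ι → Type*} [∀ i, Fintype (K i)] {N : ∀ i, Fin m ⊕ K i → Fin m ⊕ K i → WithZero G}

/-- The patterns `N i` represent the full matrices up to conjugacy, each exactly once. -/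
structure IsRepresenting (N : ∀ i, Fin m ⊕ K i → Fin m ⊕ K i → WithZero G) : Prop where
  isPattern : ∀ i, IsPattern (N i)
  exists_isCopy : ∀ (l : ℕ) (x : PartialMonomial (m + l) G), IsFull x →
    ∃ i, IsCopy (N i) (Finset.univ.filter fun p => m ≤ p.val) x
  eq_of_isCopy : ∀ (l : ℕ) (x : PartialMonomial (m + l) G) (i j : ι),
    IsCopy (N i) (Finset.univ.filter fun p => m ≤ p.val) x →
    IsCopy (N j) (Finset.univ.filter fun p => m ≤ p.val) x → i = j

/-- A full matrix representing the pattern `N i`. -/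
noncomputable def IsRepresenting.rep (hN : IsRepresenting N) (i : ι) : PartialMonomial (m + Fintype.card (K i)) G :=
  ((hN.isPattern i).exists_isCopy rfl).choose

theorem IsRepresenting.isCopy_rep (hN : IsRepresenting N) (i : ι) :
    IsCopy (N i) (Finset.univ.filter fun p => m ≤ p.val) (hN.rep i) :=
  ((hN.isPattern i).exists_isCopy rfl).choose_spec

/-- The functional dual to the sum over the copies of `N i`. -/
noncomputable def IsRepresenting.functional (hN : IsRepresenting N) (i : ι) : limitCentralizer F G m →ₗ[F] F :=
  (dual (hN.rep i)).comp ((LinearMap.proj (Fintype.card (K i))).comp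
    (limitCentralizer F G m).val.toLinearMap)

theorem IsRepresenting.functional_apply (hN : IsRepresenting N) (i : ι) (α : limitCentralizer F G m) :
    hN.functional F i α = dual (hN.rep i) (α.1 (Fintype.card (K i))) := rfl

open scoped Classical in
theorem IsRepresenting.functional_copySum (hN : IsRepresenting N) (i j : ι) :
    hN.functional F i ⟨copySum F (N j), copySum_mem_limitCentralizer F (N j)⟩ =
      if i = j then 1 else 0 := by
  rw [hN.functional_apply F, dual_copySum _ ((hN.isCopy_rep i).isFull (hN.isPattern i))]
  refine if_congr ⟨fun h => hN.eq_of_isCopy _ _ i j (hN.isCopy_rep i) h, ?_⟩ rfl rfl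
  rintro rfl
  exact hN.isCopy_rep i

/-- Every full matrix is conjugate to one of the representatives, and `dual` is constant on
conjugacy classes for elements of the centralizer. -/
theorem IsRepresenting.eq_zero (hN : IsRepresenting N) {α : limitCentralizer F G m}
    (h : ∀ i, hN.functional F i α = 0) : α = 0 := by
  apply eq_zero_of_forall_dual_eq_zero
  intro l x hx
  obtain ⟨i, hi⟩ := hN.exists_isCopy l x hx
  have hl : Fintype.card (K i) = l := by rw [← hi.card, card_lower]
  subst hl
  obtain ⟨g, σ, hg, rfl⟩ := (hN.isCopy_rep i).exists_conj hi (by simp) (by simp)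
  rw [dual_conj hg (commute_of_mem_centralizer (α.2.1 _) hg.wreath_mem)]
  exact h i

theorem IsRepresenting.functional_eq_zero (hN : IsRepresenting N) {k : ℕ} {α : limitCentralizer F G m}
    (hα : α ∈ mdegFiltration F G m k) {i : ι} (hi : k < Fintype.card (K i)) :
    hN.functional F i α = 0 :=
  dual_eq_zero_of_mdeg_lt (fun y hy => (hα _ y hy).trans_lt hi) _

theorem exists_mem_mdegFiltration (α : limitCentralizer F G m) :
    ∃ k, α ∈ mdegFiltration F G m k := by
  obtain ⟨d, hd⟩ := α.2.2.2
  exact ⟨d, fun l γ hγ => (mdeg_le_deg γ).trans (hd l γ hγ)⟩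

/-- A pattern with `l` lower places has a copy in the finite semigroup at level `l`, and that copy
determines it. -/
theorem IsRepresenting.finite_card_le (hN : IsRepresenting N) (k : ℕ) : {i | Fintype.card (K i) ≤ k}.Finite := by
  have : {i | Fintype.card (K i) ≤ k} = ⋃ l ∈ Finset.range (k + 1), {i | Fintype.card (K i) = l} := by
    ext i
    simp
  rw [this]
  refine Set.Finite.biUnion (Finset.finite_toSet _) fun l _ => ?_
  have h := fun i : {i | Fintype.card (K i) = l} => (hN.isPattern i.1).exists_isCopy i.2
  choose x hx using h
  refine Set.finite_coe_iff.1 (Finite.of_injective x fun i j hij => Subtype.ext ?_)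
  exact hN.eq_of_isCopy l (x i) i j (hx i) (hij ▸ hx j)

theorem IsRepresenting.finite_functional_ne_zero (hN : IsRepresenting N) (α : limitCentralizer F G m) :
    {i | hN.functional F i α ≠ 0}.Finite := by
  obtain ⟨k, hk⟩ := exists_mem_mdegFiltration F α
  refine (hN.finite_card_le k).subset fun i hi => ?_
  by_contra hlt
  exact hi (hN.functional_eq_zero F hk (not_le.1 hlt))

theorem IsRepresenting.exists_basis (hN : IsRepresenting N) :
    ∃ b : Module.Basis ι F (limitCentralizer F G m),
      ∀ i, b i = ⟨copySum F (N i), copySum_mem_limitCentralizer F (N i)⟩ :=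
  exists_basis_of_dual _ (hN.functional F) (hN.functional_copySum F)
    (hN.finite_functional_ne_zero F) fun _ => hN.eq_zero F

/-- On the `k`th filtration term the functionals of patterns with more than `k` lower places vanish
automatically, so the remaining ones still separate points. -/
theorem IsRepresenting.exists_basis_mdegFiltration (hN : IsRepresenting N) (k : ℕ) :
    ∃ b : Module.Basis {i // Fintype.card (K i) ≤ k} F (mdegFiltration F G m k),
      ∀ i, (b i : limitCentralizer F G m) =
        ⟨copySum F (N i), copySum_mem_limitCentralizer F (N i)⟩ := by
  classical
  refine Exists.imp (fun b hb i => congrArg Subtype.val (hb i)) (exists_basis_of_dual (F := F) (M := mdegFiltration F G m k)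
    (ι := {i // Fintype.card (K i) ≤ k})
    (fun i => ⟨⟨copySum F (N i), copySum_mem_limitCentralizer F (N i)⟩, fun l γ hγ =>
      (mdeg_le_of_mem_support_copySum F (N i) hγ).trans i.2⟩)
    (fun i => (hN.functional F i).comp (mdegFiltration F G m k).subtype) (fun i j => ?_)
    (fun α => ?_) fun α hα => ?_)
  · refine (hN.functional_copySum F i j).trans ?_
    by_cases h : i = j
    · rw [if_pos h, if_pos (congrArg Subtype.val h)]
    · rw [if_neg h, if_neg fun h' => h (Subtype.ext h')]
  · exact (hN.finite_functional_ne_zero F α.1).preimage Subtype.val_injective.injOn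
  · apply Subtype.ext
    refine hN.eq_zero F fun i => ?_
    by_cases hi : Fintype.card (K i) ≤ k
    · exact hα ⟨i, hi⟩
    · exact hN.functional_eq_zero F α.2 (not_le.1 hi)

end Family

end WreathCentralizer

namespace WreathCentralizer

/-! ### Products of labels along orbits. -/

section OrbitProducts

variable {G X Y : Type*} [Group G]

/-- The product `f (σ^{s-1} z) ⋯ f (σ z) f(z)` along the orbit of `z`. -/
def orbitProd (σ : X → X) (f : X → G) (z : X) : ℕ → G
  | 0 => 1
  | s + 1 => f (σ^[s] z) * orbitProd σ f z s

theorem orbitProd_succ (σ : X → X) (f : X → G) (z : X) (s : ℕ) :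
    orbitProd σ f z (s + 1) = f (σ^[s] z) * orbitProd σ f z s := rfl

theorem reverse_prod_ofFn (σ : X → X) (f : X → G) (z : X) (s : ℕ) :
    (List.ofFn fun a : Fin s => f (σ^[a.val] z)).reverse.prod = orbitProd σ f z s := by
  induction s with
  | zero => simp [orbitProd]
  | succ s ih =>
    rw [List.ofFn_succ', List.concat_eq_append, List.reverse_append, List.prod_append]
    simp only [Fin.val_castSucc, Fin.val_last, List.reverse_cons, List.reverse_nil, List.nil_append,
      List.prod_singleton]
    rw [ih, orbitProd_succ]

theorem orbitProd_succ' (σ : X → X) (f : X → G) (z : X) (s : ℕ) :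
    orbitProd σ f z (s + 1) = orbitProd σ f (σ z) s * f z := by
  induction s with
  | zero => simp [orbitProd]
  | succ s ih => rw [orbitProd_succ, ih, orbitProd_succ, mul_assoc, Function.iterate_succ_apply]

theorem orbitProd_semiconj {σ : X → X} {τ : Y → Y} {k : X → Y} (h : ∀ z, k (σ z) = τ (k z))
    (f : Y → G) (z : X) (s : ℕ) : orbitProd τ f (k z) s = orbitProd σ (f ∘ k) z s := by
  induction s with
  | zero => rfl
  | succ s ih =>
    have hs : k (σ^[s] z) = τ^[s] (k z) := (Function.Semiconj.iterate_right h s) z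
    rw [orbitProd_succ, orbitProd_succ, ih, Function.comp_apply, hs]

/-- Telescoping. The label `f z` sits on the edge from `σ⁻¹ z` to `z`, which is why both end terms
are shifted by `σ.symm`. -/
theorem orbitProd_cocycle {σ : Equiv.Perm X} {f f' h : X → G}
    (hf : ∀ z, f (σ z) = h (σ z) * f' (σ z) * (h z)⁻¹) (z : X) (s : ℕ) :
    orbitProd σ f z s =
      h (σ.symm (σ^[s] z)) * orbitProd σ f' z s * (h (σ.symm z))⁻¹ := by
  induction s with
  | zero => simp [orbitProd]
  | succ s ih =>
    have h1 := hf (σ.symm (σ^[s] z))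
    rw [Equiv.apply_symm_apply] at h1
    rw [orbitProd_succ, ih, h1, orbitProd_succ, Function.iterate_succ_apply',
      Equiv.symm_apply_apply]
    group

/-- The conjugacy class of the product along the orbit of `z`. -/
noncomputable def orbitClass (σ : X → X) (f : X → G) (z : X) : ConjClasses G :=
  ConjClasses.mk (orbitProd σ f z (Function.minimalPeriod σ z))

theorem minimalPeriod_semiconj {σ : X → X} {τ : Y → Y} {k : X → Y} (hk : Function.Injective k)
    (h : ∀ z, k (σ z) = τ (k z)) (z : X) :
    Function.minimalPeriod τ (k z) = Function.minimalPeriod σ z := by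
  rw [Function.minimalPeriod_eq_minimalPeriod_iff]
  intro s
  have hs : k (σ^[s] z) = τ^[s] (k z) := (Function.Semiconj.iterate_right h s) z
  rw [Function.IsPeriodicPt, Function.IsFixedPt, ← hs, hk.eq_iff]
  rfl

theorem orbitClass_semiconj {σ : X → X} {τ : Y → Y} {k : X → Y} (hk : Function.Injective k)
    (h : ∀ z, k (σ z) = τ (k z)) (f : Y → G) (z : X) :
    orbitClass τ f (k z) = orbitClass σ (f ∘ k) z := by
  rw [orbitClass, orbitClass, minimalPeriod_semiconj hk h, orbitProd_semiconj h]

/-- Moving the starting point by one step conjugates the full cycle product by `f z`. -/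
theorem orbitClass_apply {σ : X → X} (f : X → G) {z : X} (hz : z ∈ Function.periodicPts σ) :
    orbitClass σ f (σ z) = orbitClass σ f z := by
  rw [orbitClass, orbitClass, Function.minimalPeriod_apply hz, ConjClasses.mk_eq_mk_iff_isConj]
  refine IsConj.symm ?_
  rw [isConj_iff]
  have h1 := orbitProd_succ' σ f z (Function.minimalPeriod σ z)
  rw [orbitProd_succ, Function.iterate_minimalPeriod] at h1
  exact ⟨f z, by rw [h1, mul_inv_cancel_right]⟩

theorem orbitClass_iterate {σ : X → X} (f : X → G) {z : X} (hz : z ∈ Function.periodicPts σ)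
    (s : ℕ) : orbitClass σ f (σ^[s] z) = orbitClass σ f z := by
  induction s with
  | zero => rfl
  | succ s ih =>
    rw [Function.iterate_succ_apply', orbitClass_apply f, ih]
    obtain ⟨n, hn, hz⟩ := hz
    exact ⟨n, hn, hz.apply_iterate s⟩

end OrbitProducts

/-! ### The model cycles of a family of partitions. -/

section Slots

variable {G : Type*} [Group G] (ρ : PartitionFamily G)

theorem val_finRotate {n : ℕ} (a : Fin n) : (finRotate n a).val = (a.val + 1) % n := by
  cases n with
  | zero => exact a.elim0
  | succ n => rw [finRotate_apply, Fin.val_add, Fin.val_one', Nat.add_mod_mod]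

/-- The length of the cycle through a slot. -/
def PartitionFamily.len (z : ρ.Slots) : ℕ := (ρ.partList z.1).get z.2.1

variable {ρ}

theorem PartitionFamily.shift_mk (C : ConjClasses G) (s : Fin (ρ.partList C).length)
    (a : Fin ((ρ.partList C).get s)) : ρ.shift ⟨C, s, a⟩ = ⟨C, s, finRotate _ a⟩ := rfl

theorem PartitionFamily.iterate_shift_mk (C : ConjClasses G) (s : Fin (ρ.partList C).length)
    (a : Fin ((ρ.partList C).get s)) (b : ℕ) : ∃ h,
    ρ.shift^[b] ⟨C, s, a⟩ = ⟨C, s, ⟨(a.val + b) % (ρ.partList C).get s, h⟩⟩ := by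
  refine ⟨Nat.mod_lt _ (Nat.zero_lt_of_lt a.2), ?_⟩
  induction b with
  | zero =>
    rw [Function.iterate_zero, id_eq]
    congr 2
    exact Fin.ext (Nat.mod_eq_of_lt a.2).symm
  | succ b ih =>
    rw [Function.iterate_succ_apply', ih, shift_mk]
    congr 2
    apply Fin.ext
    rw [val_finRotate]
    simp [Nat.add_assoc]

theorem PartitionFamily.iterate_shift_zero (C : ConjClasses G) (s : Fin (ρ.partList C).length)
    (a : Fin ((ρ.partList C).get s)) :
    ρ.shift^[a.val] ⟨C, s, ⟨0, Nat.zero_lt_of_lt a.2⟩⟩ = ⟨C, s, a⟩ := by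
  obtain ⟨h, h'⟩ := iterate_shift_mk C s ⟨0, Nat.zero_lt_of_lt a.2⟩ a.val
  rw [h']
  congr 2
  apply Fin.ext
  simp only [zero_add]
  exact Nat.mod_eq_of_lt a.2

theorem PartitionFamily.minimalPeriod_shift (z : ρ.Slots) :
    Function.minimalPeriod ρ.shift z = ρ.len z := by
  obtain ⟨C, s, a⟩ := z
  have key : ∀ b, Function.IsPeriodicPt ρ.shift b ⟨C, s, a⟩ ↔ (ρ.partList C).get s ∣ b := by
    intro b
    obtain ⟨h, h'⟩ := iterate_shift_mk C s a b
    rw [Function.IsPeriodicPt, Function.IsFixedPt, h']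
    simp only [Sigma.mk.injEq, heq_eq_eq, true_and]
    rw [Fin.ext_iff]
    constructor
    · intro hab
      change (a.val + b) % _ = a.val at hab
      have h2 : a.val + b ≡ a.val + 0 [MOD (ρ.partList C).get s] := by
        rw [Nat.ModEq, hab, add_zero, Nat.mod_eq_of_lt a.2]
      exact (Nat.modEq_zero_iff_dvd).1 (Nat.ModEq.add_left_cancel' _ h2)
    · rintro ⟨c, rfl⟩
      simp only [Nat.add_mul_mod_self_left]
      exact Nat.mod_eq_of_lt a.2
  apply Nat.dvd_antisymm
  · exact Function.IsPeriodicPt.minimalPeriod_dvd ((key _).2 dvd_rfl)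
  · exact (key _).1 (Function.isPeriodicPt_minimalPeriod _ _)

theorem PartitionFamily.partList_pos {C : ConjClasses G} (s : Fin (ρ.partList C).length) :
    0 < (ρ.partList C).get s := by
  have h : (ρ.partList C).get s ∈ (ρ C).2.parts.sort (· ≥ ·) := List.get_mem _ _
  exact (ρ C).2.parts_pos ((Multiset.mem_sort _).1 h)

theorem PartitionFamily.len_pos (z : ρ.Slots) : 0 < ρ.len z := partList_pos z.2.1

theorem PartitionFamily.mem_periodicPts (z : ρ.Slots) : z ∈ Function.periodicPts ρ.shift := by
  rw [← Function.minimalPeriod_pos_iff_mem_periodicPts, minimalPeriod_shift]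
  exact len_pos z

theorem PartitionFamily.orbitProd_zero (f : ρ.Slots → G) (C : ConjClasses G)
    (s : Fin (ρ.partList C).length) :
    orbitProd ρ.shift f ⟨C, s, ⟨0, partList_pos s⟩⟩ ((ρ.partList C).get s) =
      (List.ofFn fun a => f ⟨C, s, a⟩).reverse.prod := by
  rw [← reverse_prod_ofFn]
  simp only [iterate_shift_zero]

theorem PartitionFamily.orbitClass_eq (f : ρ.Slots → G) (C : ConjClasses G)
    (s : Fin (ρ.partList C).length) (a : Fin ((ρ.partList C).get s)) :
    orbitClass ρ.shift f ⟨C, s, a⟩ = orbitClass ρ.shift f ⟨C, s, ⟨0, partList_pos s⟩⟩ := by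
  rw [← iterate_shift_zero C s a, orbitClass_iterate f (mem_periodicPts _)]

/-- The condition on cycle products, in terms of orbits. -/
theorem PartitionFamily.forall_prod_iff (f : ρ.Slots → G) :
    (∀ (C : ConjClasses G) (s : Fin (ρ.partList C).length),
      ConjClasses.mk (List.ofFn fun a => f ⟨C, s, a⟩).reverse.prod = C) ↔
    ∀ z, orbitClass ρ.shift f z = z.1 := by
  have key : ∀ (C : ConjClasses G) (s : Fin (ρ.partList C).length),
      orbitClass ρ.shift f ⟨C, s, ⟨0, partList_pos s⟩⟩ =
        ConjClasses.mk (List.ofFn fun a => f ⟨C, s, a⟩).reverse.prod := by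
    intro C s
    rw [orbitClass, minimalPeriod_shift, ← orbitProd_zero]
    rfl
  constructor
  · rintro h ⟨C, s, a⟩
    rw [orbitClass_eq, key, h]
  · intro h C s
    rw [← key, h]

open scoped Classical in
/-- The labels of the model cycles: a representative of the class at the first place. -/
noncomputable def PartitionFamily.label (z : ρ.Slots) : G :=
  if z.2.2.val = 0 then z.1.exists_rep.choose else 1

theorem PartitionFamily.orbitProd_label (C : ConjClasses G) (s : Fin (ρ.partList C).length)
    {b : ℕ} (hb : b < (ρ.partList C).get s) :
    orbitProd ρ.shift (label (ρ := ρ)) ⟨C, s, ⟨0, partList_pos s⟩⟩ (b + 1) =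
      C.exists_rep.choose := by
  induction b with
  | zero => simp [orbitProd, label]
  | succ b ih =>
    rw [orbitProd_succ, ih (by omega), iterate_shift_zero C s ⟨b + 1, hb⟩]
    simp [label]

theorem PartitionFamily.orbitClass_label (z : ρ.Slots) :
    orbitClass ρ.shift label z = z.1 := by
  obtain ⟨C, s, a⟩ := z
  rw [orbitClass_eq, orbitClass, minimalPeriod_shift]
  have h := orbitProd_label C s (Nat.sub_lt (partList_pos s) one_pos)
  erw [Nat.sub_add_cancel (partList_pos s)] at h
  exact (congrArg ConjClasses.mk h).trans C.exists_rep.choose_spec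

/-- After a full period the two end terms in `orbitProd_cocycle` are inverse to each other. -/
theorem PartitionFamily.orbitClass_of_cocycle {f f' h : ρ.Slots → G}
    (hf : ∀ z, f (ρ.shift z) = h (ρ.shift z) * f' (ρ.shift z) * (h z)⁻¹) (z : ρ.Slots) :
    orbitClass ρ.shift f z = orbitClass ρ.shift f' z := by
  rw [orbitClass, orbitClass, orbitProd_cocycle hf, Function.iterate_minimalPeriod,
    ConjClasses.mk_eq_mk_iff_isConj]
  exact (isConj_iff.2 ⟨_, rfl⟩).symm

/-- On each cycle, choose an element `c` conjugating one total product into the other and propagate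
it along the cycle; the relation between the totals is exactly the condition for closing up. -/
theorem PartitionFamily.exists_cocycle {f f' : ρ.Slots → G}
    (hf : ∀ z, orbitClass ρ.shift f z = orbitClass ρ.shift f' z) :
    ∃ h : ρ.Slots → G, ∀ z, f (ρ.shift z) = h (ρ.shift z) * f' (ρ.shift z) * (h z)⁻¹ := by
  have hconj : ∀ (C : ConjClasses G) (s : Fin (ρ.partList C).length), ∃ c : G,
      orbitProd ρ.shift f ⟨C, s, ⟨0, partList_pos s⟩⟩ ((ρ.partList C).get s) =
      c * orbitProd ρ.shift f' ⟨C, s, ⟨0, partList_pos s⟩⟩ ((ρ.partList C).get s) * c⁻¹ := by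
    intro C s
    have h := hf ⟨C, s, ⟨0, partList_pos s⟩⟩
    rw [orbitClass, orbitClass, minimalPeriod_shift, ConjClasses.mk_eq_mk_iff_isConj] at h
    obtain ⟨c, hc⟩ := isConj_iff.1 h.symm
    exact ⟨c, hc.symm⟩
  choose c hc using hconj
  refine ⟨fun z => orbitProd ρ.shift f ⟨z.1, z.2.1, ⟨0, partList_pos z.2.1⟩⟩ (z.2.2.val + 1) *
    c z.1 z.2.1 *
    (orbitProd ρ.shift f' ⟨z.1, z.2.1, ⟨0, partList_pos z.2.1⟩⟩ (z.2.2.val + 1))⁻¹, ?_⟩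
  rintro ⟨C, s, a⟩
  rw [shift_mk]
  -- At the last place the proposed `h` reduces to `c`, and this makes the wrap-around edge
  -- consistent.
  by_cases ha : a.val + 1 = (ρ.partList C).get s
  · have h0 : finRotate _ a = ⟨0, partList_pos s⟩ := by
      apply Fin.ext
      rw [val_finRotate, ha, Nat.mod_self]
    simp only [h0, ha, zero_add, hc C s]
    simp only [orbitProd, Function.iterate_zero, id_eq, mul_one]
    group
  · have hlt : a.val + 1 < (ρ.partList C).get s := lt_of_le_of_ne a.2 ha
    have h1 : finRotate _ a = ⟨a.val + 1, hlt⟩ := by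
      apply Fin.ext
      rw [val_finRotate]
      exact Nat.mod_eq_of_lt hlt
    simp only [h1]
    rw [orbitProd_succ _ _ _ (a.val + 1), orbitProd_succ _ _ _ (a.val + 1),
      iterate_shift_zero C s ⟨a.val + 1, hlt⟩]
    group

end Slots

end WreathCentralizer

namespace WreathCentralizer

open PartialMonomial

theorem withZero_ext {M : Type*} {a b : WithZero M} (h : ∀ x : M, a = x ↔ b = x) : a = b := by
  cases a with
  | zero =>
    cases b with
    | zero => rfl
    | coe b => exact absurd ((h b).2 rfl) WithZero.zero_ne_coe
  | coe a => exact ((h a).1 rfl).symm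

/-! ### Path products and the matrix `Ω(x)`. -/

section Paths

variable {G : Type*} [Group G] {n : ℕ}

/-- A path product is `g` precisely if the entries along the path are the quotients of the
successive values of a function on the path. -/
theorem pathProd_eq_coe_iff (x : PartialMonomial n G) (d : Fin n) (ps : List (Fin n))
    (j i : Fin n) (g : G) : pathProd x ps j i = g ↔
      ∃ val : ℕ → G, val 0 = 1 ∧
        (∀ a < ps.length, x.entry ((j :: ps).getD (a + 1) d) ((j :: ps).getD a d) =
          ((val (a + 1) * (val a)⁻¹ : G) : WithZero G)) ∧
        x.entry i ((j :: ps).getD ps.length d) = ((g * (val ps.length)⁻¹ : G) : WithZero G) := by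
  -- The default `d` is never attained: all places read are at most `ps.length`, hence inside `j ::
  -- ps`.
  induction ps generalizing j g with
  | nil =>
    simp only [pathProd, List.length_nil, Nat.not_lt_zero, List.getD_cons_zero, false_imp_iff,
      implies_true, true_and]
    constructor
    · intro h
      exact ⟨fun _ => 1, rfl, by rw [h, inv_one, mul_one]⟩
    · rintro ⟨val, h0, h⟩
      rw [h, h0, inv_one, mul_one]
  | cons p ps ih =>
    rw [pathProd]
    simp only [List.length_cons, List.getD_cons_succ]
    constructor
    · intro h
      have hne : pathProd x ps p i * x.entry p j ≠ 0 := by rw [h]; exact WithZero.coe_ne_zero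
      obtain ⟨c, hc⟩ := WithZero.ne_zero_iff_exists.1 (right_ne_zero_of_mul hne)
      obtain ⟨g', hg'⟩ := WithZero.ne_zero_iff_exists.1 (left_ne_zero_of_mul hne)
      rw [← hc, ← hg', ← WithZero.coe_mul, WithZero.coe_inj] at h
      obtain ⟨val, h0, h1, h2⟩ := (ih p g').1 hg'.symm
      refine ⟨fun a => Nat.casesOn a 1 fun a => val a * c, rfl, ?_, ?_⟩
      · intro a ha
        cases a with
        | zero => simp [h0, hc]
        | succ a =>
          refine (h1 a (by omega)).trans ?_
          simp [mul_assoc]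
      · rw [h2, ← h]
        simp [mul_assoc]
    · rintro ⟨val, h0, h1, h2⟩
      have hp : x.entry p j = (val 1 : WithZero G) := by
        have := h1 0 (Nat.succ_pos _)
        simpa [h0] using this
      have := (ih p (g * (val 1)⁻¹)).2 ⟨fun a => val (a + 1) * (val 1)⁻¹, by simp, ?_, ?_⟩
      · rw [this, hp, ← WithZero.coe_mul, inv_mul_cancel_right]
      · intro a ha
        refine (h1 (a + 1) (by omega)).trans ?_
        simp [mul_assoc]
      · rw [h2]
        simp [mul_assoc]

/-- No nonzero entry leads from outside `T` into `T`, so a path starting outside only reads columns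
on which `x` and `y` agree. Used with `T` the support of the cycles. -/
theorem pathProd_congr {x y : PartialMonomial n G} {T : Set (Fin n)}
    (hxy : ∀ i, ∀ j ∉ T, x.entry i j = y.entry i j)
    (hT : ∀ i, ∀ j ∉ T, x.entry i j ≠ 0 → i ∉ T) (ps : List (Fin n)) (i : Fin n) {j : Fin n}
    (hj : j ∉ T) : pathProd x ps j i = pathProd y ps j i := by
  induction ps generalizing j with
  | nil => exact hxy i j hj
  | cons p ps ih =>
    rw [pathProd, pathProd, ← hxy p j hj]
    by_cases h : x.entry p j = 0
    · rw [h, mul_zero, mul_zero]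
    · rw [ih (hT p j hj h)]

variable {m l : ℕ}

/-- Each column has at most one nonzero entry, so the next index is determined; the path stops
exactly on reaching one of the first `m` indices. -/
theorem path_unique {x : PartialMonomial (m + l) G} {ps ps' : List (Fin (m + l))}
    {j i i' : Fin (m + l)} (hps : ∀ p ∈ ps, m ≤ p.val) (hps' : ∀ p ∈ ps', m ≤ p.val)
    (hi : i.val < m) (hi' : i'.val < m) (h : pathProd x ps j i ≠ 0)
    (h' : pathProd x ps' j i' ≠ 0) : ps = ps' ∧ i = i' := by
  induction ps generalizing ps' j with
  | nil =>
    cases ps' with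
    | nil => exact ⟨rfl, x.col_unique _ _ _ h h'⟩
    | cons p' ps' =>
      have := x.col_unique _ _ _ h (right_ne_zero_of_mul h')
      have := hps' p' (List.mem_cons_self)
      subst i
      omega
  | cons p ps ih =>
    cases ps' with
    | nil =>
      have := x.col_unique _ _ _ (right_ne_zero_of_mul h) h'
      have := hps p (List.mem_cons_self)
      subst i'
      omega
    | cons p' ps' =>
      obtain rfl := x.col_unique _ _ _ (right_ne_zero_of_mul h) (right_ne_zero_of_mul h')
      obtain ⟨rfl, rfl⟩ := ih (fun q hq => hps q (List.mem_cons_of_mem p hq))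
        (fun q hq => hps' q (List.mem_cons_of_mem p hq)) (left_ne_zero_of_mul h)
        (left_ne_zero_of_mul h')
      exact ⟨rfl, rfl⟩

theorem omega_eq_coe_iff (x : PartialMonomial (m + l) G) (i j : Fin m) (g : G)
    (r : Multiplicative ℕ) :
    omega x i j = ((g, r) : G × Multiplicative ℕ) ↔ ∃ ps : List (Fin (m + l)),
      (∀ p ∈ ps, m ≤ p.val) ∧ ps.length = r.toAdd ∧
        pathProd x ps (Fin.castAdd l j) (Fin.castAdd l i) = g := by
  rw [omega]
  split_ifs with h
  · rw [WithZero.coe_inj, Prod.mk.injEq]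
    have hc := h.choose_spec
    constructor
    · rintro ⟨h1, h2⟩
      exact ⟨_, hc.1, by rw [← h2, toAdd_ofAdd], by rw [← h1]; exact hc.2⟩
    · rintro ⟨ps, hps, hlen, hprod⟩
      have hu := (path_unique hc.1 hps (Fin.castAdd_lt l i) (Fin.castAdd_lt l i)
        (by rw [hc.2]; exact WithZero.coe_ne_zero) (by rw [hprod]; exact WithZero.coe_ne_zero)).1
      refine ⟨?_, ?_⟩
      · have := hc.2
        rw [hu, hprod, WithZero.coe_inj] at this
        exact this.symm
      · rw [hu, hlen, ofAdd_toAdd]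
  · constructor
    · intro h'
      exact absurd h'.symm WithZero.coe_ne_zero
    · rintro ⟨ps, hps, -, hprod⟩
      exact absurd ⟨(g, ps), hps, hprod⟩ h

theorem omega_congr {x y : PartialMonomial (m + l) G} {T : Set (Fin (m + l))}
    (hlow : ∀ p ∈ T, m ≤ p.val) (hxy : ∀ i, ∀ j ∉ T, x.entry i j = y.entry i j)
    (hT : ∀ i, ∀ j ∉ T, x.entry i j ≠ 0 → i ∉ T) : omega x = omega y := by
  funext i j
  apply withZero_ext
  rintro ⟨g, r⟩
  have hj : Fin.castAdd l j ∉ T := fun h => absurd (hlow _ h) (not_le.2 (Fin.castAdd_lt l j))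
  simp only [omega_eq_coe_iff, pathProd_congr hxy hT _ _ hj]

theorem pathSet_congr {x y : PartialMonomial (m + l) G} {T : Set (Fin (m + l))}
    (hlow : ∀ p ∈ T, m ≤ p.val) (hxy : ∀ i, ∀ j ∉ T, x.entry i j = y.entry i j)
    (hT : ∀ i, ∀ j ∉ T, x.entry i j ≠ 0 → i ∉ T) : pathSet x = pathSet y := by
  have hj : ∀ j : Fin m, Fin.castAdd l j ∉ T :=
    fun j h => absurd (hlow _ h) (not_le.2 (Fin.castAdd_lt l j))
  simp only [pathSet, pathProd_congr hxy hT _ _ (hj _)]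

theorem le_of_mem_pathSet {x : PartialMonomial (m + l) G} {p : Fin (m + l)}
    (hp : p ∈ pathSet x) : m ≤ p.val := by
  obtain ⟨i, j, ps, hps, -, hp⟩ := hp
  exact hps p hp

end Paths

/-! ### The normal form attached to `(Ω, ρ)`. -/

section Pattern

variable {G : Type*} [Group G] {m : ℕ} (Ω : PartialMonomial m (G × Multiplicative ℕ))
  (ρ : PartitionFamily G)

/-- The order of the nonzero entry of a column of `Ω`. -/
def colOrd (j : Fin m) : ℕ := ∑ i, ordEntry (Ω.entry i j)

/-- The places on the paths described by `Ω`. -/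
abbrev PathSlots : Type := Σ j : Fin m, Fin (colOrd Ω j)

/-- The value of an entry of `Ω` if its order is `s`, and zero otherwise. -/
def valueAt (s : ℕ) : WithZero (G × Multiplicative ℕ) → WithZero G :=
  WithZero.recZeroCoe 0 fun x => if x.2.toAdd = s then (x.1 : WithZero G) else 0

variable {Ω ρ}

theorem valueAt_ne_zero_iff {s : ℕ} {w : WithZero (G × Multiplicative ℕ)} :
    valueAt s w ≠ 0 ↔ ∃ g : G, w = ((g, Multiplicative.ofAdd s) : G × Multiplicative ℕ) := by
  cases w with
  | zero => simp [valueAt]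
  | coe w =>
    obtain ⟨g, r⟩ := w
    simp only [valueAt, WithZero.recZeroCoe_coe, ne_eq, ite_eq_right_iff, WithZero.coe_ne_zero,
      imp_false, not_not, WithZero.coe_inj, Prod.mk.injEq, exists_eq_left']
    exact ⟨fun h => by rw [← h]; rfl, fun h => by rw [h]; rfl⟩

theorem valueAt_coe (s : ℕ) (g : G) :
    valueAt s (((g, Multiplicative.ofAdd s) : G × Multiplicative ℕ) : WithZero (G × Multiplicative ℕ)) = (g : WithZero G) := by
  simp [valueAt]

theorem ordEntry_coe (g : G) (r : Multiplicative ℕ) :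
    ordEntry (((g, r) : G × Multiplicative ℕ) : WithZero (G × Multiplicative ℕ)) = r.toAdd := rfl

theorem colOrd_eq {i j : Fin m} {g : G} {r : Multiplicative ℕ}
    (h : Ω.entry i j = ((g, r) : G × Multiplicative ℕ)) : colOrd Ω j = r.toAdd := by
  rw [colOrd, Finset.sum_eq_single i, h, ordEntry_coe]
  · intro i' _ hi'
    have : Ω.entry i' j = 0 := by
      by_contra hne
      exact hi' (Ω.col_unique _ _ _ hne (by rw [h]; exact WithZero.coe_ne_zero))
    rw [this]
    rfl
  · simp

theorem exists_entry_of_colOrd_pos {j : Fin m} (h : 0 < colOrd Ω j) :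
    ∃ i g, Ω.entry i j = ((g, Multiplicative.ofAdd (colOrd Ω j)) : G × Multiplicative ℕ) := by
  obtain ⟨i, -, hi⟩ := Finset.exists_ne_zero_of_sum_ne_zero h.ne'
  have hne : Ω.entry i j ≠ 0 := by
    intro h0
    rw [h0] at hi
    exact hi rfl
  obtain ⟨⟨g, r⟩, hgr⟩ := WithZero.ne_zero_iff_exists.1 hne
  exact ⟨i, g, by rw [colOrd_eq hgr.symm, ofAdd_toAdd, hgr]⟩

/-- The path and the place on it of an index. -/
def pathPos : Fin m ⊕ (PathSlots Ω ⊕ ρ.Slots) → Option (Fin m × ℕ)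
  | Sum.inl j => some (j, 0)
  | Sum.inr (Sum.inl q) => some (q.1, q.2.val + 1)
  | Sum.inr (Sum.inr _) => none

theorem pathPos_injective {v w : Fin m ⊕ (PathSlots Ω ⊕ ρ.Slots)} {q : Fin m × ℕ}
    (hv : pathPos v = some q) (hw : pathPos w = some q) : v = w := by
  rcases v with v | ⟨j, a⟩ | v <;> rcases w with w | ⟨j', a'⟩ | w <;>
    simp only [pathPos, Option.some.injEq, reduceCtorEq] at hv hw <;> subst hv <;>
    simp only [Prod.mk.injEq, Nat.add_right_cancel_iff, Nat.add_eq_zero_iff, one_ne_zero, and_false,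
      and_true] at hw
  · rw [hw]
  · exact absurd hw.2.symm (Nat.succ_ne_zero _)
  · obtain ⟨rfl, h⟩ := hw
    rw [Fin.ext h]

variable (Ω ρ)

open scoped Classical in
/-- The pattern of the matrices attached to `(Ω, ρ)`: for every nonzero entry of `Ω` a path, and
for every part of `ρ` a cycle. -/
noncomputable def pattern :
    Fin m ⊕ (PathSlots Ω ⊕ ρ.Slots) → Fin m ⊕ (PathSlots Ω ⊕ ρ.Slots) → WithZero G
  -- The group element of `Ω i j` is put on the last edge of path `j`, leaving from place `colOrd Ω
  -- j`; inner edges carry `1`.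
  | Sum.inl i, w => (pathPos w).elim 0 fun q => valueAt q.2 (Ω.entry i q.1)
  | Sum.inr (Sum.inl q), w => if pathPos w = some (q.1, q.2.val) then 1 else 0
  | Sum.inr (Sum.inr z), w =>
    if w = Sum.inr (Sum.inr (ρ.shift.symm z)) then ((PartitionFamily.label z : G) : WithZero G)
    else 0

variable {Ω ρ}

theorem pattern_inl_ne_zero_iff {i : Fin m} {w : Fin m ⊕ (PathSlots Ω ⊕ ρ.Slots)} :
    pattern Ω ρ (Sum.inl i) w ≠ 0 ↔ ∃ j s, ∃ g : G, pathPos w = some (j, s) ∧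
      Ω.entry i j = ((g, Multiplicative.ofAdd s) : G × Multiplicative ℕ) := by
  rw [pattern]
  cases h : pathPos w with
  | none => simp
  | some q =>
    rw [Option.elim_some, valueAt_ne_zero_iff]
    constructor
    · rintro ⟨g, hg⟩
      exact ⟨q.1, q.2, g, rfl, hg⟩
    · rintro ⟨j, s, g, hq, hg⟩
      rw [Option.some.injEq] at hq
      subst hq
      exact ⟨g, hg⟩

theorem pattern_path_ne_zero_iff {q : PathSlots Ω} {w : Fin m ⊕ (PathSlots Ω ⊕ ρ.Slots)} :
    pattern Ω ρ (Sum.inr (Sum.inl q)) w ≠ 0 ↔ pathPos w = some (q.1, q.2.val) := by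
  rw [pattern]
  simp

theorem pattern_cycle_ne_zero_iff {z : ρ.Slots} {w : Fin m ⊕ (PathSlots Ω ⊕ ρ.Slots)} :
    pattern Ω ρ (Sum.inr (Sum.inr z)) w ≠ 0 ↔ w = Sum.inr (Sum.inr (ρ.shift.symm z)) := by
  rw [pattern]
  simp

theorem isPattern_pattern : IsPattern (pattern Ω ρ) where
  row_unique := by
    rintro (i | q | z) w w' h h'
    · rw [pattern_inl_ne_zero_iff] at h h'
      obtain ⟨j, s, g, hw, hg⟩ := h
      obtain ⟨j', s', g', hw', hg'⟩ := h'
      obtain rfl := Ω.row_unique i j j' (by rw [hg]; exact WithZero.coe_ne_zero)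
        (by rw [hg']; exact WithZero.coe_ne_zero)
      rw [hg, WithZero.coe_inj, Prod.mk.injEq, Multiplicative.ofAdd.injective.eq_iff] at hg'
      rw [← hg'.2] at hw'
      exact pathPos_injective hw hw'
    · rw [pattern_path_ne_zero_iff] at h h'
      exact pathPos_injective h h'
    · rw [pattern_cycle_ne_zero_iff] at h h'
      rw [h, h']
  col_unique := by
    -- Place `s` of path `j` has an inner outgoing edge only if `s < colOrd Ω j`, and an edge into
    -- the first block only if `s = colOrd Ω j`.
    have key : ∀ {i : Fin m} {q : PathSlots Ω} {w : Fin m ⊕ (PathSlots Ω ⊕ ρ.Slots)},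
        pattern Ω ρ (Sum.inl i) w ≠ 0 → pattern Ω ρ (Sum.inr (Sum.inl q)) w ≠ 0 → False := by
      intro i q w h h'
      rw [pattern_inl_ne_zero_iff] at h
      obtain ⟨j, s, g, hw, hg⟩ := h
      rw [pattern_path_ne_zero_iff, hw, Option.some.injEq, Prod.mk.injEq] at h'
      obtain ⟨rfl, hs⟩ := h'
      have h1 := q.2.2
      have h2 := colOrd_eq hg
      rw [toAdd_ofAdd] at h2
      omega
    have key' : ∀ {z : ρ.Slots} {v w : Fin m ⊕ (PathSlots Ω ⊕ ρ.Slots)},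
        pattern Ω ρ (Sum.inr (Sum.inr z)) w ≠ 0 → pattern Ω ρ v w ≠ 0 →
        v = Sum.inr (Sum.inr z) := by
      rintro z (i | q | z') w h h'
      · rw [pattern_cycle_ne_zero_iff] at h
        subst h
        rw [pattern_inl_ne_zero_iff] at h'
        obtain ⟨j, s, g, hw, hg⟩ := h'
        simp [pathPos] at hw
      · rw [pattern_cycle_ne_zero_iff] at h
        subst h
        rw [pattern_path_ne_zero_iff] at h'
        simp [pathPos] at h'
      · rw [pattern_cycle_ne_zero_iff] at h h'
        rw [h] at h'
        simp only [Sum.inr.injEq, ρ.shift.symm.injective.eq_iff] at h'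
        rw [h']
    rintro (i | q | z) (i' | q' | z') w h h'
    · rw [pattern_inl_ne_zero_iff] at h h'
      obtain ⟨j, s, g, hw, hg⟩ := h
      obtain ⟨j', s', g', hw', hg'⟩ := h'
      rw [hw, Option.some.injEq, Prod.mk.injEq] at hw'
      obtain ⟨rfl, rfl⟩ := hw'
      rw [Ω.col_unique i i' j (by rw [hg]; exact WithZero.coe_ne_zero)
        (by rw [hg']; exact WithZero.coe_ne_zero)]
    · exact (key h h').elim
    · exact key' h' h
    · exact (key h' h).elim
    · rw [pattern_path_ne_zero_iff] at h h'
      rw [h, Option.some.injEq, Prod.mk.injEq] at h'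
      obtain ⟨j, a⟩ := q
      obtain ⟨j', a'⟩ := q'
      obtain ⟨hj, ha⟩ := h'
      dsimp only at hj ha
      subst hj
      rw [Fin.ext ha]
    · exact key' h' h
    · exact (key' h h').symm
    · exact (key' h h').symm
    · exact key' h' h
  row_full := by
    rintro (⟨j, a⟩ | z)
    · simp only [pattern_path_ne_zero_iff]
      by_cases ha : a.val = 0
      · exact ⟨Sum.inl j, by rw [pathPos, ha]⟩
      · refine ⟨Sum.inr (Sum.inl ⟨j, ⟨a.val - 1, by omega⟩⟩), ?_⟩
        simp only [pathPos]
        rw [Nat.sub_add_cancel (Nat.one_le_iff_ne_zero.2 ha)]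
    · exact ⟨_, pattern_cycle_ne_zero_iff.2 rfl⟩
  col_full := by
    rintro (⟨j, a⟩ | z)
    · by_cases ha : a.val + 1 < colOrd Ω j
      · exact ⟨Sum.inr (Sum.inl ⟨j, ⟨a.val + 1, ha⟩⟩), pattern_path_ne_zero_iff.2 rfl⟩
      · obtain ⟨i, g, hg⟩ := exists_entry_of_colOrd_pos (Nat.zero_lt_of_lt a.2)
        refine ⟨Sum.inl i, pattern_inl_ne_zero_iff.2 ⟨j, colOrd Ω j, g, ?_, hg⟩⟩
        have : a.val + 1 = colOrd Ω j := le_antisymm a.2 (not_lt.1 ha)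
        simp only [pathPos, this]
    · refine ⟨Sum.inr (Sum.inr (ρ.shift z)), pattern_cycle_ne_zero_iff.2 ?_⟩
      rw [Equiv.symm_apply_apply]

theorem card_pathSlots : Fintype.card (PathSlots Ω) = Ω.ord := by
  rw [Fintype.card_sigma, ord]
  exact (Finset.sum_congr rfl fun j _ => Fintype.card_fin _).trans Finset.sum_comm

theorem card_slots [Fintype G] [Fintype ρ.Slots] : Fintype.card ρ.Slots = ρ.norm := by
  classical
  have h : ∀ C, ∑ s : Fin (ρ.partList C).length, (ρ.partList C).get s = (ρ C).1 := by
    intro C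
    rw [← List.sum_ofFn, List.ofFn_get]
    have h1 : ((ρ.partList C : List ℕ) : Multiset ℕ) = (ρ C).2.parts := Multiset.sort_eq _ _
    rw [← Multiset.sum_coe, h1, (ρ C).2.parts_sum]
  rw [PartitionFamily.norm, ← Finset.sum_congr rfl fun C _ => h C]
  rw [← Nat.card_eq_fintype_card, Nat.card_sigma]
  refine Finset.sum_congr ?_ fun C _ => ?_
  · ext; simp
  · rw [Nat.card_eq_fintype_card, Fintype.card_sigma]
    simp

end Pattern

end WreathCentralizer

namespace WreathCentralizer

open PartialMonomial

/-! ### Copies of the normal form and matrices of type `(Ω, ρ)` are the same. -/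

section Types

variable {G : Type*} [Group G] {m l : ℕ} {Ω : PartialMonomial m (G × Multiplicative ℕ)}
  {ρ : PartitionFamily G} {R : Finset (Fin (m + l))} {x : PartialMonomial (m + l) G}

/-- `x` is composed of the paths described by `Ω` and of cycles of type `ρ` on the set `R`, and is
the identity elsewhere. -/
structure IsTypeVia (Ω : PartialMonomial m (G × Multiplicative ℕ)) (ρ : PartitionFamily G)
    (R : Finset (Fin (m + l))) (x : PartialMonomial (m + l) G) (k : ρ.Slots ↪ Fin (m + l))
    (g : Fin (m + l) → G) : Prop where
  full : IsFull x
  omega_eq : omega x = Ω.entry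
  mem_iff : ∀ p, p ∈ R ↔ p ∈ pathSet x ∨ p ∈ Set.range k
  disj : ∀ z, k z ∉ pathSet x
  lower : ∀ z, m ≤ (k z).val
  entry : ∀ z, x.entry (k (ρ.shift z)) (k z) = (g (k (ρ.shift z)) : WithZero G)
  cls : ∀ z, orbitClass ρ.shift (g ∘ k) z = z.1
  diag : ∀ p : Fin (m + l), m ≤ p.val → p ∉ R → x.entry p p = 1

/-- The lists `L j` are the paths of `x` described by `Ω`. -/
structure IsPathFamily (Ω : PartialMonomial m (G × Multiplicative ℕ))
    (x : PartialMonomial (m + l) G) (L : Fin m → List (Fin (m + l))) : Prop where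
  lower : ∀ j, ∀ p ∈ L j, m ≤ p.val
  length : ∀ j, (L j).length = colOrd Ω j
  prod : ∀ i j g r, Ω.entry i j = ((g, r) : G × Multiplicative ℕ) →
    pathProd x (L j) (Fin.castAdd l j) (Fin.castAdd l i) = g

/-- The `s`th index on the path starting from `j`. -/
def node (L : Fin m → List (Fin (m + l))) (j : Fin m) (s : ℕ) : Fin (m + l) :=
  (Fin.castAdd l j :: L j).getD s (Fin.castAdd l j)

theorem node_zero (L : Fin m → List (Fin (m + l))) (j : Fin m) :
    node L j 0 = Fin.castAdd l j := rfl

theorem node_succ (L : Fin m → List (Fin (m + l))) (j : Fin m) {s : ℕ} (hs : s < (L j).length) :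
    node L j (s + 1) = (L j)[s] := by
  rw [node, List.getD_cons_succ, List.getD_eq_getElem _ _ hs]

theorem exists_isPathFamily (h : omega x = Ω.entry) :
    ∃ L : Fin m → List (Fin (m + l)), IsPathFamily Ω x L := by
  have key : ∀ j, ∃ L : List (Fin (m + l)), (∀ p ∈ L, m ≤ p.val) ∧ L.length = colOrd Ω j ∧
      ∀ i g r, Ω.entry i j = ((g, r) : G × Multiplicative ℕ) →
        pathProd x L (Fin.castAdd l j) (Fin.castAdd l i) = g := by
    intro j
    by_cases hj : ∃ i, Ω.entry i j ≠ 0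
    · obtain ⟨i, hi⟩ := hj
      obtain ⟨⟨g, r⟩, hgr⟩ := WithZero.ne_zero_iff_exists.1 hi
      have h1 : omega x i j = ((g, r) : G × Multiplicative ℕ) := by rw [h, hgr]
      obtain ⟨ps, hps, hlen, hprod⟩ := (omega_eq_coe_iff x i j g r).1 h1
      refine ⟨ps, hps, by rw [hlen, colOrd_eq hgr.symm], fun i' g' r' h' => ?_⟩
      obtain rfl := Ω.col_unique i i' j hi (by rw [h']; exact WithZero.coe_ne_zero)
      rw [← hgr, WithZero.coe_inj, Prod.mk.injEq] at h'
      rw [hprod, h'.1]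
    · push Not at hj
      refine ⟨[], by simp, ?_, fun i g r h' => ?_⟩
      · symm
        rw [List.length_nil, ← Nat.le_zero, ← not_lt]
        intro hlt
        obtain ⟨i, g, hg⟩ := exists_entry_of_colOrd_pos hlt
        exact WithZero.coe_ne_zero (hg.symm.trans (hj i))
      · exact absurd (h'.symm.trans (hj i)) WithZero.coe_ne_zero
  choose L hL using key
  exact ⟨L, fun j => (hL j).1, fun j => (hL j).2.1, fun i j => (hL j).2.2 i⟩

variable {L : Fin m → List (Fin (m + l))}

theorem IsPathFamily.le_node (hL : IsPathFamily Ω x L) {j : Fin m} {s : ℕ}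
    (hs : s < colOrd Ω j) : m ≤ (node L j (s + 1)).val := by
  rw [node_succ L j (by rwa [hL.length])]
  exact hL.lower j _ (List.getElem_mem _)

theorem IsPathFamily.mem_pathSet_iff (hL : IsPathFamily Ω x L) (h : omega x = Ω.entry)
    (p : Fin (m + l)) : p ∈ pathSet x ↔ ∃ q : PathSlots Ω, node L q.1 (q.2.val + 1) = p := by
  constructor
  · rintro ⟨i, j, ps, hps, hprod, hp⟩
    obtain ⟨g, hg⟩ := WithZero.ne_zero_iff_exists.1 hprod
    have h1 := (omega_eq_coe_iff x i j g (Multiplicative.ofAdd ps.length)).2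
      ⟨ps, hps, rfl, hg.symm⟩
    rw [h] at h1
    have h2 := hL.prod i j g _ h1
    obtain ⟨rfl, -⟩ := path_unique hps (hL.lower j) (Fin.castAdd_lt l i) (Fin.castAdd_lt l i) hprod
      (by rw [h2]; exact WithZero.coe_ne_zero)
    obtain ⟨s, hs, rfl⟩ := List.getElem_of_mem hp
    exact ⟨⟨j, ⟨s, by rwa [← hL.length]⟩⟩, node_succ L j hs⟩
  · rintro ⟨⟨j, s, hs⟩, rfl⟩
    obtain ⟨i, g, hg⟩ := exists_entry_of_colOrd_pos (Nat.zero_lt_of_lt hs)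
    refine ⟨i, j, L j, hL.lower j, ?_, ?_⟩
    · rw [hL.prod i j g _ hg]
      exact WithZero.coe_ne_zero
    · rw [node_succ L j (by rwa [hL.length])]
      exact List.getElem_mem _

theorem IsPathFamily.exists_val (hL : IsPathFamily Ω x L) (j : Fin m) :
    ∃ val : ℕ → G, val 0 = 1 ∧
      (∀ s < colOrd Ω j, x.entry (node L j (s + 1)) (node L j s) =
        ((val (s + 1) * (val s)⁻¹ : G) : WithZero G)) ∧
      ∀ i s g, Ω.entry i j = ((g, Multiplicative.ofAdd s) : G × Multiplicative ℕ) →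
        x.entry (Fin.castAdd l i) (node L j s) = ((g * (val s)⁻¹ : G) : WithZero G) := by
  by_cases hj : ∃ i, Ω.entry i j ≠ 0
  · obtain ⟨i, hi⟩ := hj
    obtain ⟨⟨g, r⟩, hgr⟩ := WithZero.ne_zero_iff_exists.1 hi
    obtain ⟨val, h0, h1, h2⟩ := (pathProd_eq_coe_iff x (Fin.castAdd l j) _ _ _ g).1
      (hL.prod i j g r hgr.symm)
    rw [hL.length] at h1 h2
    refine ⟨val, h0, h1, fun i' s g' h' => ?_⟩
    obtain rfl := Ω.col_unique i i' j hi (by rw [h']; exact WithZero.coe_ne_zero)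
    have hs := colOrd_eq h'
    rw [toAdd_ofAdd] at hs
    rw [← hgr, WithZero.coe_inj, Prod.mk.injEq] at h'
    rw [← h'.1, ← hs]
    exact h2
  · push Not at hj
    refine ⟨fun _ => 1, rfl, fun s hs => ?_, fun i s g h' => ?_⟩
    · obtain ⟨i, g, hg⟩ := exists_entry_of_colOrd_pos (Nat.zero_lt_of_lt hs)
      exact absurd (hg.symm.trans (hj i)) WithZero.coe_ne_zero
    · exact absurd (h'.symm.trans (hj i)) WithZero.coe_ne_zero

/-- Row uniqueness makes predecessors of equal nodes equal. Going back ends at a starting node,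
which is the only kind among the first `m` indices. -/
theorem IsPathFamily.node_injective (hL : IsPathFamily Ω x L) {j j' : Fin m} {s s' : ℕ}
    (hs : s ≤ colOrd Ω j) (hs' : s' ≤ colOrd Ω j') (h : node L j s = node L j' s') :
    j = j' ∧ s = s' := by
  induction s generalizing s' with
  | zero =>
    cases s' with
    | zero => exact ⟨Fin.castAdd_injective m l h, rfl⟩
    | succ s' =>
      have h1 := hL.le_node hs'
      rw [← h, node_zero] at h1
      exact absurd j.2 (not_lt.2 h1)
  | succ s ih =>
    cases s' with
    | zero =>
      have h1 := hL.le_node hs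
      rw [h, node_zero] at h1
      exact absurd j'.2 (not_lt.2 h1)
    | succ s' =>
      obtain ⟨val, -, h1, -⟩ := hL.exists_val j
      obtain ⟨val', -, h1', -⟩ := hL.exists_val j'
      have h2 : x.entry (node L j (s + 1)) (node L j s) ≠ 0 := by
        rw [h1 s hs]
        exact WithZero.coe_ne_zero
      have h2' : x.entry (node L j (s + 1)) (node L j' s') ≠ 0 := by
        rw [h, h1' s' hs']
        exact WithZero.coe_ne_zero
      obtain ⟨rfl, rfl⟩ := ih (Nat.le_of_succ_le hs) (Nat.le_of_succ_le hs')
        (x.row_unique _ _ _ h2 h2')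
      exact ⟨rfl, rfl⟩

theorem le_colOrd_of_pathPos {w : Fin m ⊕ (PathSlots Ω ⊕ ρ.Slots)} {j : Fin m} {s : ℕ}
    (hw : pathPos w = some (j, s)) : s ≤ colOrd Ω j := by
  rcases w with w | q | w <;> simp only [pathPos, Option.some.injEq, Prod.mk.injEq,
    reduceCtorEq] at hw
  · omega
  · obtain ⟨rfl, rfl⟩ := hw
    exact q.2.2

/-- Path slots go to the nodes of the paths, labelled by partial path products. Cycle slots are
placed by `k`, labelled by a cocycle comparing the cycle labels of `x` with the model ones, which
have the same classes. -/
theorem IsTypeVia.isCopy {k : ρ.Slots ↪ Fin (m + l)} {g : Fin (m + l) → G}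
    (hx : IsTypeVia Ω ρ R x k g) : IsCopy (pattern Ω ρ) R x := by
  obtain ⟨L, hL⟩ := exists_isPathFamily hx.omega_eq
  choose val hval0 hval1 hval2 using hL.exists_val
  obtain ⟨hc, hhc⟩ := PartitionFamily.exists_cocycle (f := g ∘ k) (f' := PartitionFamily.label)
    fun z => by rw [hx.cls, PartitionFamily.orbitClass_label]
  let u : Fin m ⊕ (PathSlots Ω ⊕ ρ.Slots) → Fin (m + l) :=
    Sum.elim (fun j => Fin.castAdd l j) (Sum.elim (fun q => node L q.1 (q.2.val + 1)) k)
  let h : Fin m ⊕ (PathSlots Ω ⊕ ρ.Slots) → G :=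
    Sum.elim (fun _ => 1) (Sum.elim (fun q => val q.1 (q.2.val + 1)) hc)
  have hpos : ∀ {w j s}, pathPos w = some (j, s) → u w = node L j s ∧ h w = val j s := by
    intro w j s hw
    rcases w with w | q | w <;> simp only [pathPos, Option.some.injEq, Prod.mk.injEq,
      reduceCtorEq] at hw
    · obtain ⟨rfl, rfl⟩ := hw
      exact ⟨rfl, (hval0 w).symm⟩
    · obtain ⟨rfl, rfl⟩ := hw
      exact ⟨rfl, rfl⟩
  have hpath : ∀ q : PathSlots Ω, node L q.1 (q.2.val + 1) ∈ pathSet x := fun q =>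
    (hL.mem_pathSet_iff hx.omega_eq _).2 ⟨q, rfl⟩
  have hinj : Function.Injective u := by
    have key : ∀ w w', u w = u w' → pathPos w = pathPos w' := by
      have h1 : ∀ z w q, pathPos w = some q → u w ≠ k z := by
        intro z w q hw h
        rcases w with i | q' | z'
        · have h2 : Fin.castAdd l i = k z := h
          have h3 := hx.lower z
          rw [← h2] at h3
          exact absurd i.2 (not_lt.2 h3)
        · exact hx.disj z (h ▸ hpath q')
        · simp [pathPos] at hw
      intro w w' hww'
      cases hw : pathPos w with
      | none =>
        cases hw' : pathPos w' with
        | none => rfl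
        | some q' =>
          rcases w with w | w | z
          · simp [pathPos] at hw
          · simp [pathPos] at hw
          · exact absurd hww'.symm (h1 z w' q' hw')
      | some q =>
        cases hw' : pathPos w' with
        | none =>
          rcases w' with w' | w' | z
          · simp [pathPos] at hw'
          · simp [pathPos] at hw'
          · exact absurd hww' (h1 z w q hw)
        | some q' =>
          rw [(hpos hw).1, (hpos hw').1] at hww'
          obtain ⟨h2, h3⟩ := hL.node_injective (le_colOrd_of_pathPos hw)
            (le_colOrd_of_pathPos hw') hww'
          rw [Prod.ext h2 h3]
    intro w w' hww'
    have h1 := key w w' hww'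
    cases hw : pathPos w with
    | some q => exact pathPos_injective hw (h1 ▸ hw)
    | none =>
      have hw' := h1.symm.trans hw
      rcases w with w | w | z
      · simp [pathPos] at hw
      · simp [pathPos] at hw
      · rcases w' with w' | w' | z'
        · simp [pathPos] at hw'
        · simp [pathPos] at hw'
        · rw [k.injective hww']
  have hne : ∀ v w, pattern Ω ρ v w ≠ 0 →
      x.entry (u v) (u w) = h v * pattern Ω ρ v w * ((h w)⁻¹ : G) := by
    rintro (i | q | z) w hvw
    · obtain ⟨j, s, c, hw, hc⟩ := pattern_inl_ne_zero_iff.1 hvw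
      rw [(hpos hw).1, (hpos hw).2, pattern, hw]
      simp only [Option.elim_some, hc, valueAt_coe]
      refine (hval2 j i s c hc).trans ?_
      simp [h]
    · have hw := pattern_path_ne_zero_iff.1 hvw
      rw [(hpos hw).1, (hpos hw).2, pattern, if_pos hw, mul_one]
      exact (hval1 q.1 q.2.val q.2.2).trans (WithZero.coe_mul _ _)
    · obtain rfl := pattern_cycle_ne_zero_iff.1 hvw
      rw [pattern, if_pos rfl, ← WithZero.coe_mul, ← WithZero.coe_mul]
      have h1 := hx.entry (ρ.shift.symm z)
      have h2 := hhc (ρ.shift.symm z)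
      rw [Equiv.apply_symm_apply] at h1 h2
      exact h1.trans (congrArg _ h2)
  refine ⟨u, h, hinj, fun _ => rfl, fun _ => rfl, fun p => ?_, fun v w => ?_, hx.diag⟩
  · rw [hx.mem_iff, hL.mem_pathSet_iff hx.omega_eq]
    simp only [Sum.exists]
    rfl
  · by_cases hvw : pattern Ω ρ v w = 0
    · rw [hvw, mul_zero, zero_mul]
      by_contra h0
      have hP : IsPattern (pattern Ω ρ) := isPattern_pattern
      have hcol : ∀ v', pattern Ω ρ v' w ≠ 0 → False := by
        intro v' hv'
        have h1 : x.entry (u v') (u w) ≠ 0 := by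
          rw [hne v' w hv']
          simpa using hv'
        rw [hinj (x.col_unique _ _ _ h0 h1)] at hvw
        exact hv' hvw
      have hrow : ∀ w', pattern Ω ρ v w' ≠ 0 → False := by
        intro w' hw'
        have h1 : x.entry (u v) (u w') ≠ 0 := by
          rw [hne v w' hw']
          simpa using hw'
        rw [hinj (x.row_unique _ _ _ h0 h1)] at hvw
        exact hw' hvw
      -- A nonzero entry of `x` at a zero of the pattern conflicts with the full lower rows or
      -- columns of the pattern. Only the first block is left, where it would be an order-zero entry
      -- of `Ω`.
      cases w with
      | inr w =>
        obtain ⟨v', hv'⟩ := hP.col_full w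
        exact hcol v' hv'
      | inl j =>
        cases v with
        | inr v =>
          obtain ⟨w', hw'⟩ := hP.row_full v
          exact hrow w' hw'
        | inl i =>
          obtain ⟨c, hc⟩ := WithZero.ne_zero_iff_exists.1 h0
          have h1 := (omega_eq_coe_iff x i j c (Multiplicative.ofAdd 0)).2
            ⟨[], by simp, rfl, hc.symm⟩
          rw [hx.omega_eq] at h1
          exact pattern_inl_ne_zero_iff.2 ⟨j, 0, c, rfl, h1⟩ hvw
    · exact hne v w hvw

/-- The index with a given path and a given place on it. -/
def slotAt (Ω : PartialMonomial m (G × Multiplicative ℕ)) (ρ : PartitionFamily G) (j : Fin m) :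
    ℕ → Fin m ⊕ (PathSlots Ω ⊕ ρ.Slots)
  | 0 => Sum.inl j
  -- The value past the end of the path is a mere default.
  | s + 1 => if hs : s < colOrd Ω j then Sum.inr (Sum.inl ⟨j, ⟨s, hs⟩⟩) else Sum.inl j

theorem slotAt_succ {j : Fin m} {s : ℕ} (hs : s < colOrd Ω j) :
    slotAt Ω ρ j (s + 1) = Sum.inr (Sum.inl ⟨j, ⟨s, hs⟩⟩) := dif_pos hs

theorem pathPos_slotAt {j : Fin m} {s : ℕ} (hs : s ≤ colOrd Ω j) :
    pathPos (slotAt Ω ρ j s) = some (j, s) := by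
  cases s with
  | zero => rfl
  | succ s => rw [slotAt_succ hs, pathPos]

variable {u : Fin m ⊕ (PathSlots Ω ⊕ ρ.Slots) → Fin (m + l)}
  {h : Fin m ⊕ (PathSlots Ω ⊕ ρ.Slots) → G}

theorem IsCopyVia.isPathFamily (hx : IsCopyVia (pattern Ω ρ) R x u h) :
    IsPathFamily Ω x fun j => List.ofFn fun a : Fin (colOrd Ω j) =>
      u (Sum.inr (Sum.inl ⟨j, a⟩)) where
  lower j p hp := by
    obtain ⟨a, rfl⟩ := (List.mem_ofFn' _ _).1 hp
    exact hx.le_of_inr _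
  length j := List.length_ofFn
  prod i j g r hij := by
    set L : Fin m → List (Fin (m + l)) := fun j => List.ofFn fun a : Fin (colOrd Ω j) =>
      u (Sum.inr (Sum.inl ⟨j, a⟩)) with hLdef
    have hnode : ∀ s ≤ colOrd Ω j, node L j s = u (slotAt Ω ρ j s) := by
      intro s hs
      cases s with
      | zero => rw [node_zero, slotAt, hx.top]
      | succ s =>
        rw [slotAt_succ hs, node_succ L j (by rw [hLdef, List.length_ofFn]; exact hs)]
        simp [hLdef]
    have hlen : (L j).length = colOrd Ω j := List.length_ofFn
    change pathProd x (L j) _ _ = _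
    refine (pathProd_eq_coe_iff x (Fin.castAdd l j) _ _ _ g).2
      ⟨fun s => h (slotAt Ω ρ j s), hx.label_top j, fun s hs => ?_, ?_⟩
    · rw [hlen] at hs
      change x.entry (node L j (s + 1)) (node L j s) = _
      rw [hnode _ hs, hnode _ hs.le, hx.entry, slotAt_succ hs, pattern,
        if_pos (pathPos_slotAt hs.le), mul_one, ← WithZero.coe_mul]
      simp only [slotAt_succ hs]
    · rw [hlen]
      change x.entry _ (node L j (colOrd Ω j)) = _
      have hr : r = Multiplicative.ofAdd (colOrd Ω j) := by rw [colOrd_eq hij, ofAdd_toAdd]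
      rw [hnode _ le_rfl, ← hx.top, hx.entry, hx.label_top, pattern, pathPos_slotAt le_rfl,
        Option.elim_some, hij, hr, valueAt_coe, WithZero.coe_one, one_mul, ← WithZero.coe_mul]

theorem IsCopyVia.omega_eq (hx : IsCopyVia (pattern Ω ρ) R x u h) : omega x = Ω.entry := by
  have hL := hx.isPathFamily
  have hle : ∀ i j g r, Ω.entry i j = ((g, r) : G × Multiplicative ℕ) →
      omega x i j = ((g, r) : G × Multiplicative ℕ) := by
    intro i j g r hij
    refine (omega_eq_coe_iff x i j g r).2 ⟨_, hL.lower j, ?_, hL.prod i j g r hij⟩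
    rw [hL.length, colOrd_eq hij]
  funext i j
  apply withZero_ext
  rintro ⟨g, r⟩
  refine ⟨fun hg => ?_, hle i j g r⟩
  obtain ⟨ps, hps, hlen, hprod⟩ := (omega_eq_coe_iff x i j g r).1 hg
  have hprod0 : pathProd x ps (Fin.castAdd l j) (Fin.castAdd l i) ≠ 0 := by
    rw [hprod]
    exact WithZero.coe_ne_zero
  by_cases hj : ∃ i', Ω.entry i' j ≠ 0
  · obtain ⟨i', hi'⟩ := hj
    obtain ⟨⟨g', r'⟩, hgr⟩ := WithZero.ne_zero_iff_exists.1 hi'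
    have h1 := hL.prod i' j g' r' hgr.symm
    obtain ⟨-, hii⟩ := path_unique hps (hL.lower j) (Fin.castAdd_lt l i) (Fin.castAdd_lt l i')
      hprod0 (by rw [h1]; exact WithZero.coe_ne_zero)
    obtain rfl := Fin.castAdd_injective m l hii
    rw [← hg, hle i j g' r' hgr.symm, hgr]
  · push Not at hj
    exfalso
    -- A zero column of `Ω` gives a zero column of `x`: rows outside the placement are lower and
    -- hold only their diagonal entry, and the other rows are governed by the pattern.
    have hcol : ∀ p, x.entry p (Fin.castAdd l j) = 0 := by
      intro p
      by_contra hp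
      have hpu : ∃ v, u v = p := by
        by_contra hno
        push Not at hno
        have hplow : m ≤ p.val := by
          by_contra hlt
          obtain ⟨i, hi⟩ := hx.exists_of_lt (not_le.1 hlt)
          exact hno _ hi
        have hpR : p ∉ R := fun hpR => by
          obtain ⟨v, hv⟩ := (hx.mem_iff p).1 hpR
          exact hno _ hv
        have h1 : x.entry p p ≠ 0 := by rw [hx.diag p hplow hpR]; exact one_ne_zero
        have h2 := x.row_unique _ _ _ hp h1
        rw [← h2] at hplow
        exact absurd j.2 (not_lt.2 hplow)
      obtain ⟨v, rfl⟩ := hpu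
      rw [← hx.top] at hp
      replace hp := (hx.entry_ne_zero_iff _ _).1 hp
      rcases v with i' | q | z
      · obtain ⟨j', s, g', hpos, hg'⟩ := pattern_inl_ne_zero_iff.1 hp
        simp only [pathPos, Option.some.injEq, Prod.mk.injEq] at hpos
        rw [← hpos.1] at hg'
        exact WithZero.coe_ne_zero (hg'.symm.trans (hj i'))
      · have hpos := pattern_path_ne_zero_iff.1 hp
        simp only [pathPos, Option.some.injEq, Prod.mk.injEq] at hpos
        have h1 := Nat.zero_lt_of_lt q.2.2
        rw [← hpos.1] at h1
        obtain ⟨i', g', hg'⟩ := exists_entry_of_colOrd_pos h1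
        exact WithZero.coe_ne_zero (hg'.symm.trans (hj i'))
      · simp [pattern_cycle_ne_zero_iff] at hp
    cases ps with
    | nil => exact hprod0 (hcol _)
    | cons p ps => exact hprod0 (by rw [pathProd, hcol, mul_zero])

/-- The labels on the cycles of a copy differ from the model labels by the cocycle `h`, so the
classes of the cycle products are unchanged. Setting `g = 1` off the cycles matches the
normalization in `IsCycleData`. -/
theorem IsCopy.exists_isTypeVia (hx : IsCopy (pattern Ω ρ) R x) :
    ∃ k g, IsTypeVia Ω ρ R x k g ∧ ∀ p ∉ Set.range k, g p = 1 := by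
  have hfull := hx.isFull isPattern_pattern
  obtain ⟨u, h, hx⟩ := hx
  let k : ρ.Slots ↪ Fin (m + l) := ⟨fun z => u (Sum.inr (Sum.inr z)),
    hx.inj.comp (Sum.inr_injective.comp Sum.inr_injective)⟩
  let gs : ρ.Slots → G := fun z =>
    h (Sum.inr (Sum.inr z)) * PartitionFamily.label z * (h (Sum.inr (Sum.inr (ρ.shift.symm z))))⁻¹
  have hg : ∀ z, Function.extend k gs 1 (k z) = gs z := k.injective.extend_apply gs 1
  have hL := hx.isPathFamily
  have hpath : ∀ p, p ∈ pathSet x ↔ ∃ q, u (Sum.inr (Sum.inl q)) = p := by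
    intro p
    rw [hL.mem_pathSet_iff hx.omega_eq]
    refine exists_congr fun q => ?_
    rw [node_succ _ _ (by rw [hL.length]; exact q.2.2)]
    simp
  refine ⟨k, Function.extend k gs 1, ⟨hfull, hx.omega_eq, fun p => ?_, fun z hz => ?_, fun z =>
    hx.le_of_inr _, fun z => ?_, fun z => ?_, hx.diag⟩, fun p hp => ?_⟩
  · rw [hx.mem_iff, hpath]
    simp only [Sum.exists]
    rfl
  · obtain ⟨q, hq⟩ := (hpath _).1 hz
    have := hx.inj hq
    simp at this
  · rw [hg]
    change x.entry (u _) (u _) = _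
    rw [hx.entry, pattern, if_pos (by rw [Equiv.symm_apply_apply])]
    simp only [gs, Equiv.symm_apply_apply, WithZero.coe_mul]
  · have h1 : Function.extend k gs 1 ∘ k = gs := funext hg
    rw [h1, PartitionFamily.orbitClass_of_cocycle (f' := PartitionFamily.label)
      (h := fun z => h (Sum.inr (Sum.inr z))), PartitionFamily.orbitClass_label]
    intro z
    simp only [gs, Equiv.symm_apply_apply]
  · exact Function.extend_apply' gs (1 : Fin (m + l) → G) p fun ⟨z, hz⟩ => hp ⟨z, hz⟩

end Types

end WreathCentralizer

namespace WreathCentralizer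

open PartialMonomial

/-! ### Cycle types of labelled permutations. -/

section CycleTypes

variable {G : Type*} [Group G]

theorem map_get_univ (L : List ℕ) : (Finset.univ : Finset (Fin L.length)).val.map L.get = ↑L := by
  rw [Fin.univ_val_map, List.ofFn_get]

/-- Equal multisets of values mean fibres of equal size; bijections of the fibres are glued. -/
theorem exists_equiv_of_map_univ_eq {O : Type*} [Fintype O] {φ : O → ℕ} {L : List ℕ}
    (h : (L : Multiset ℕ) = (Finset.univ : Finset O).val.map φ) :
    ∃ e : Fin L.length ≃ O, ∀ s, φ (e s) = L.get s := by
  classical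
  have hcard : ∀ r, Nonempty ({s // L.get s = r} ≃ {o // φ o = r}) := by
    intro r
    rw [← Fintype.card_eq, Fintype.card_subtype, Fintype.card_subtype]
    have h1 := congrArg (Multiset.count r) ((map_get_univ L).trans h)
    rw [Multiset.count_map, Multiset.count_map] at h1
    rw [Finset.card_def, Finset.card_def, Finset.filter_val, Finset.filter_val]
    simpa only [eq_comm] using h1
  let e := ((Equiv.sigmaFiberEquiv L.get).symm.trans
    (Equiv.sigmaCongrRight fun r => (hcard r).some)).trans (Equiv.sigmaFiberEquiv φ)
  refine ⟨e, fun s => ?_⟩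
  exact ((hcard (L.get s)).some ⟨s, rfl⟩).2

/-- Every labelled permutation is composed of cycles of the type of some family of partitions. -/
theorem exists_slots_equiv {X : Type*} [Finite X] (σ : Equiv.Perm X) (f : X → G) :
    ∃ (ρ : PartitionFamily G) (e : ρ.Slots ≃ X), (∀ z, e (ρ.shift z) = σ (e z)) ∧
      ∀ z, orbitClass ρ.shift (f ∘ e) z = z.1 := by
  classical
  have := Fintype.ofFinite X
  let S := Equiv.Perm.SameCycle.setoid σ
  have hper : ∀ x, x ∈ Function.periodicPts σ := fun x =>
    Function.Injective.mem_periodicPts σ.injective x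
  let size : Quotient S → ℕ := fun o => Function.minimalPeriod σ o.out
  have hsize : ∀ o, 0 < size o := fun o =>
    Function.minimalPeriod_pos_iff_mem_periodicPts.2 (hper _)
  let cls : Quotient S → ConjClasses G := fun o => orbitClass σ f o.out
  -- The parts for the class `C` are the sizes of the orbits whose cycle product lies in `C`.
  let M : ConjClasses G → Multiset ℕ := fun C =>
    (Finset.univ : Finset {o // cls o = C}).val.map fun o => size o.1
  let ρ : PartitionFamily G := fun C => ⟨(M C).sum, ⟨M C, by
    intro r hr
    obtain ⟨o, -, rfl⟩ := Multiset.mem_map.1 hr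
    exact hsize o.1, rfl⟩⟩
  have hex : ∀ C, ∃ e : Fin (ρ.partList C).length ≃ {o // cls o = C},
      ∀ s, size (e s).1 = (ρ.partList C).get s := fun C =>
    exists_equiv_of_map_univ_eq (φ := fun o : {o // cls o = C} => size o.1)
      (Multiset.sort_eq _ _)
  choose e he using hex
  -- Place `a` of a cycle is the `a`th iterate of the representative of the corresponding orbit.
  let E : ρ.Slots → X := fun z => σ^[z.2.2.val] (e z.1 z.2.1).1.out
  have hshift : ∀ z, E (ρ.shift z) = σ (E z) := by
    rintro ⟨C, s, a⟩
    simp only [E, PartitionFamily.shift_mk, val_finRotate, ← he]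
    rw [Function.iterate_mod_minimalPeriod_eq, Function.iterate_succ_apply']
  have hmk : ∀ (s : ℕ) (o : Quotient S), (Quotient.mk S (σ^[s] o.out)) = o := by
    intro s o
    conv_rhs => rw [← Quotient.out_eq o]
    apply Quotient.sound
    refine (Equiv.Perm.SameCycle.symm ⟨s, ?_⟩ : σ.SameCycle _ _)
    rw [zpow_natCast, Equiv.Perm.coe_pow]
  have hinj : Function.Injective E := by
    rintro ⟨C, s, a⟩ ⟨C', s', a'⟩ h
    have ho : (e C s).1 = (e C' s').1 := by
      rw [← hmk a.val (e C s).1, ← hmk a'.val (e C' s').1]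
      exact congrArg _ h
    obtain rfl : C = C' := by rw [← (e C s).2, ← (e C' s').2, ho]
    obtain rfl := (e C).injective (Subtype.ext ho)
    congr 2
    apply Fin.ext
    have h1 : Function.minimalPeriod σ (e C s).1.out = (ρ.partList C).get s := he C s
    refine Function.iterate_injOn_Iio_minimalPeriod (f := σ) (x := (e C s).1.out) ?_ ?_ h
    · rw [h1]
      exact a.2
    · rw [h1]
      exact a'.2
  have hsurj : Function.Surjective E := by
    intro x
    let o : Quotient S := Quotient.mk S x
    have hx : σ.SameCycle o.out x := Quotient.exact (Quotient.out_eq o)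
    obtain ⟨i, -, hi⟩ := hx.exists_pow_eq''
    have h2 : size (e (cls o) ((e (cls o)).symm ⟨o, rfl⟩)).1 = size o := by
      rw [Equiv.apply_symm_apply]
    refine ⟨⟨cls o, (e (cls o)).symm ⟨o, rfl⟩, ⟨i % size o, ?_⟩⟩, ?_⟩
    · rw [← he, h2]
      exact Nat.mod_lt _ (hsize o)
    · simp only [E, Equiv.apply_symm_apply]
      rw [Function.iterate_mod_minimalPeriod_eq, ← Equiv.Perm.coe_pow, hi.2]
  refine ⟨ρ, Equiv.ofBijective E ⟨hinj, hsurj⟩, hshift, fun z => ?_⟩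
  rw [← orbitClass_semiconj (Equiv.injective _) hshift]
  exact (orbitClass_iterate f (hper _) _).trans (e z.1 z.2.1).2

theorem card_filter_get_eq (L : List ℕ) (r : ℕ) :
    (Finset.univ.filter fun s => L.get s = r).card = L.count r := by
  have h1 := congrArg (Multiset.count r) (map_get_univ L)
  rw [Multiset.count_map, Multiset.coe_count] at h1
  rw [Finset.card_def, Finset.filter_val, ← h1]
  simp only [eq_comm]

open scoped Classical in
theorem card_slots_filter (ρ : PartitionFamily G) [Fintype ρ.Slots]
    (C : ConjClasses G) (r : ℕ) :
    (Finset.univ.filter fun z : ρ.Slots => z.1 = C ∧ ρ.len z = r).card =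
      r * (ρ C).2.parts.count r := by
  have h0 : ((ρ.partList C : List ℕ) : Multiset ℕ) = (ρ C).2.parts := Multiset.sort_eq _ _
  have h1 : Finset.univ.filter (fun z : ρ.Slots => z.1 = C ∧ ρ.len z = r) =
      ((Finset.univ.filter fun s => (ρ.partList C).get s = r).sigma fun s =>
        (Finset.univ : Finset (Fin ((ρ.partList C).get s)))).map (Function.Embedding.sigmaMk C) := by
    ext ⟨C', s, a⟩
    simp only [Finset.mem_filter, Finset.mem_univ, true_and, Finset.mem_map, Finset.mem_sigma,
      and_true, Function.Embedding.sigmaMk_apply]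
    constructor
    · rintro ⟨rfl, h⟩
      exact ⟨⟨s, a⟩, h, rfl⟩
    · rintro ⟨⟨s', a'⟩, h, h'⟩
      obtain ⟨rfl, h'⟩ := Sigma.mk.inj h'
      have h2 := eq_of_heq h'
      rw [Sigma.mk.injEq] at h2
      obtain ⟨rfl, h2⟩ := h2
      exact ⟨rfl, h⟩
  rw [h1, Finset.card_map, Finset.card_sigma, Finset.sum_congr rfl (g := fun _ => r),
    Finset.sum_const, card_filter_get_eq, ← h0, Multiset.coe_count, smul_eq_mul, mul_comm]
  intro s hs
  rw [Finset.card_univ, Fintype.card_fin, (Finset.mem_filter.1 hs).2]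

/-- The slots of class `C` and length `r` number `r` times the multiplicity of `r` in `ρ(C)`, so
multiplicities can be read off for `r > 0`; zero is never a part. -/
theorem partitionFamily_eq_of_equiv [Fintype G] {ρ ρ' : PartitionFamily G} (τ : ρ.Slots ≃ ρ'.Slots)
    (hcls : ∀ z, (τ z).1 = z.1) (hlen : ∀ z, ρ'.len (τ z) = ρ.len z) : ρ = ρ' := by
  classical
  have hparts : ∀ C, (ρ C).2.parts = (ρ' C).2.parts := by
    intro C
    ext r
    rcases Nat.eq_zero_or_pos r with rfl | hr
    · rw [Multiset.count_eq_zero_of_notMem fun h => lt_irrefl 0 ((ρ C).2.parts_pos h),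
        Multiset.count_eq_zero_of_notMem fun h => lt_irrefl 0 ((ρ' C).2.parts_pos h)]
    · apply Nat.eq_of_mul_eq_mul_left hr
      rw [← card_slots_filter, ← card_slots_filter]
      refine Finset.card_bij (fun z _ => τ z) (fun z hz => ?_) (fun z _ z' _ h => τ.injective h)
        fun z hz => ⟨τ.symm z, ?_, τ.apply_symm_apply z⟩
      · simpa [hcls, hlen] using hz
      · have h1 := hcls (τ.symm z)
        have h2 := hlen (τ.symm z)
        rw [Equiv.apply_symm_apply] at h1 h2
        simpa [← h1, ← h2] using hz
  funext C
  have h := hparts C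
  rcases hρ : ρ C with ⟨a, ⟨pa, ha, rfl⟩⟩
  rcases hρ' : ρ' C with ⟨b, ⟨pb, hb, rfl⟩⟩
  rw [hρ, hρ'] at h
  dsimp only at h
  subst h
  rfl

end CycleTypes

end WreathCentralizer

namespace WreathCentralizer

open PartialMonomial

/-! ### Classification of full matrices up to conjugacy. -/

section Classification

variable {G : Type*} [Group G] {m l : ℕ} {x : PartialMonomial (m + l) G}

theorem pathProd_append {n : ℕ} (x : PartialMonomial n G) (ps qs : List (Fin n)) (j q i : Fin n) :
    pathProd x (ps ++ q :: qs) j i = pathProd x qs q i * pathProd x ps j q := by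
  induction ps generalizing j with
  | nil => rfl
  | cons p ps ih => rw [List.cons_append, pathProd, ih, pathProd, mul_assoc]

/-- The mirror image of `path_unique`, peeling paths from their end and using rows; it yields row
uniqueness of `Ω(x)`. -/
theorem path_unique_left {ps ps' : List (Fin (m + l))} {j j' i : Fin (m + l)}
    (hps : ∀ p ∈ ps, m ≤ p.val) (hps' : ∀ p ∈ ps', m ≤ p.val) (hj : j.val < m) (hj' : j'.val < m)
    (h : pathProd x ps j i ≠ 0) (h' : pathProd x ps' j' i ≠ 0) : j = j' := by
  induction ps using List.reverseRecOn generalizing ps' i with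
  | nil =>
    induction ps' using List.reverseRecOn with
    | nil => exact x.row_unique _ _ _ h h'
    | append_singleton ps' p' _ =>
      rw [pathProd_append] at h'
      have := x.row_unique _ _ _ h (left_ne_zero_of_mul h')
      have := hps' p' (by simp)
      subst j
      omega
  | append_singleton ps p ih =>
    rw [pathProd_append] at h
    induction ps' using List.reverseRecOn with
    | nil =>
      have := x.row_unique _ _ _ (left_ne_zero_of_mul h) h'
      have := hps p (by simp)
      subst j'
      omega
    | append_singleton ps' p' _ =>
      rw [pathProd_append] at h'
      obtain rfl := x.row_unique _ _ _ (left_ne_zero_of_mul h) (left_ne_zero_of_mul h')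
      exact ih (fun q hq => hps q (by simp [hq])) (fun q hq => hps' q (by simp [hq]))
        (right_ne_zero_of_mul h) (right_ne_zero_of_mul h')

theorem exists_path_of_omega_ne_zero {i j : Fin m} (h : omega x i j ≠ 0) :
    ∃ ps : List (Fin (m + l)), (∀ p ∈ ps, m ≤ p.val) ∧
      pathProd x ps (Fin.castAdd l j) (Fin.castAdd l i) ≠ 0 := by
  obtain ⟨⟨g, r⟩, hgr⟩ := WithZero.ne_zero_iff_exists.1 h
  obtain ⟨ps, hps, -, hprod⟩ := (omega_eq_coe_iff x i j g r).1 hgr.symm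
  exact ⟨ps, hps, by rw [hprod]; exact WithZero.coe_ne_zero⟩

/-- The matrix `Ω(x)` as a partial monomial matrix. -/
noncomputable def omegaMonomial (x : PartialMonomial (m + l) G) :
    PartialMonomial m (G × Multiplicative ℕ) where
  entry := omega x
  row_unique i j j' h h' := by
    obtain ⟨ps, hps, hprod⟩ := exists_path_of_omega_ne_zero h
    obtain ⟨ps', hps', hprod'⟩ := exists_path_of_omega_ne_zero h'
    exact Fin.castAdd_injective m l (path_unique_left hps hps' (Fin.castAdd_lt l j)
      (Fin.castAdd_lt l j') hprod hprod')
  col_unique i i' j h h' := by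
    obtain ⟨ps, hps, hprod⟩ := exists_path_of_omega_ne_zero h
    obtain ⟨ps', hps', hprod'⟩ := exists_path_of_omega_ne_zero h'
    exact Fin.castAdd_injective m l (path_unique hps hps' (Fin.castAdd_lt l i)
      (Fin.castAdd_lt l i') hprod hprod').2

/-- The index `t` lies on a path starting from the first `m` indices. -/
def IsReachable (x : PartialMonomial (m + l) G) (t : Fin (m + l)) : Prop :=
  ∃ (j : Fin m) (ps : List (Fin (m + l))), (∀ p ∈ ps, m ≤ p.val) ∧
    pathProd x ps (Fin.castAdd l j) t ≠ 0

/-- There is a path from the index `t` to the first `m` indices. -/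
def IsCoreachable (x : PartialMonomial (m + l) G) (t : Fin (m + l)) : Prop :=
  ∃ (i : Fin m) (ps : List (Fin (m + l))), (∀ p ∈ ps, m ≤ p.val) ∧
    pathProd x ps t (Fin.castAdd l i) ≠ 0

theorem IsReachable.step {s t : Fin (m + l)} (ht : IsReachable x t) (hlow : m ≤ t.val)
    (h : x.entry s t ≠ 0) : IsReachable x s := by
  obtain ⟨j, ps, hps, hprod⟩ := ht
  refine ⟨j, ps ++ [t], ?_, ?_⟩
  · simpa [or_imp, forall_and] using ⟨hps, hlow⟩
  · rw [pathProd_append]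
    exact mul_ne_zero h hprod

theorem IsCoreachable.step {s t : Fin (m + l)} (hs : IsCoreachable x s) (hlow : m ≤ s.val)
    (h : x.entry s t ≠ 0) : IsCoreachable x t := by
  obtain ⟨i, ps, hps, hprod⟩ := hs
  refine ⟨i, s :: ps, ?_, mul_ne_zero hprod h⟩
  simpa using ⟨hlow, hps⟩

theorem mem_pathSet_iff {t : Fin (m + l)} (ht : m ≤ t.val) :
    t ∈ pathSet x ↔ IsReachable x t ∧ IsCoreachable x t := by
  constructor
  · rintro ⟨i, j, ps, hps, hprod, hmem⟩
    obtain ⟨as, bs, rfl⟩ := List.append_of_mem hmem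
    rw [pathProd_append] at hprod
    exact ⟨⟨j, as, fun p hp => hps p (by simp [hp]), right_ne_zero_of_mul hprod⟩,
      ⟨i, bs, fun p hp => hps p (by simp [hp]), left_ne_zero_of_mul hprod⟩⟩
  · rintro ⟨⟨j, as, has, hprod⟩, ⟨i, bs, hbs, hprod'⟩⟩
    refine ⟨i, j, as ++ t :: bs, ?_, ?_, by simp⟩
    · intro p hp
      rw [List.mem_append, List.mem_cons] at hp
      rcases hp with hp | rfl | hp
      · exact has p hp
      · exact ht
      · exact hbs p hp
    · rw [pathProd_append]
      exact mul_ne_zero hprod' hprod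

theorem exists_castAdd_of_lt {p : Fin (m + l)} (hp : ¬ m ≤ p.val) :
    ∃ i : Fin m, Fin.castAdd l i = p := ⟨⟨p, not_le.1 hp⟩, rfl⟩

/-- The lower indices that are reachable but not coreachable are mapped into themselves by the
next-step map, which is defined because columns are nonzero. It is injective on a finite set, hence
surjective, so predecessors stay in that set; tracing a path back puts its starting point there,
although that point is not lower. -/
theorem PartialMonomial.IsFull.isCoreachable (hx : IsFull x) {t : Fin (m + l)} (hlow : m ≤ t.val)
    (ht : IsReachable x t) : IsCoreachable x t := by
  by_contra hnot
  let B := {t : Fin (m + l) // m ≤ t.val ∧ IsReachable x t ∧ ¬ IsCoreachable x t}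
  have hnext : ∀ t : B, ∃ s : B, x.entry s.1 t.1 ≠ 0 := by
    rintro ⟨t, hlow, ht, hnot⟩
    obtain ⟨s, hs⟩ := (hx t hlow).2
    have hslow : m ≤ s.val := by
      by_contra hlt
      obtain ⟨i, rfl⟩ := exists_castAdd_of_lt hlt
      exact hnot ⟨i, [], by simp, hs⟩
    exact ⟨⟨s, hslow, ht.step hlow hs, fun h => hnot (h.step hslow hs)⟩, hs⟩
  choose nxt hnxt using hnext
  have hinj : Function.Injective nxt := by
    intro s t hst
    have h := hnxt s
    rw [hst] at h
    exact Subtype.ext (x.row_unique _ _ _ h (hnxt t))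
  have hsurj := Finite.surjective_of_injective hinj
  have key : ∀ (ps : List (Fin (m + l))) (j : Fin m) (t : B), (∀ p ∈ ps, m ≤ p.val) →
      pathProd x ps (Fin.castAdd l j) t.1 ≠ 0 → False := by
    intro ps j t hps hprod
    induction ps using List.reverseRecOn generalizing t with
    | nil =>
      obtain ⟨s, rfl⟩ := hsurj t
      have h1 := x.row_unique _ _ _ hprod (hnxt s)
      have h2 := s.2.1
      rw [← h1] at h2
      exact absurd j.2 (not_lt.2 h2)
    | append_singleton ps p ih =>
      rw [pathProd_append] at hprod
      obtain ⟨s, rfl⟩ := hsurj t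
      have h1 := x.row_unique _ _ _ (left_ne_zero_of_mul hprod) (hnxt s)
      rw [h1] at hprod
      exact ih s (fun q hq => hps q (by simp [hq])) (right_ne_zero_of_mul hprod)
  obtain ⟨j, ps, hps, hprod⟩ := ht
  exact key ps j ⟨t, hlow, ⟨j, ps, hps, hprod⟩, hnot⟩ hps hprod

/-- Lower indices off the paths are not reachable, so their predecessors are again lower and off the
paths. Thus `x` permutes them, and the permutation has a cycle type. -/
theorem PartialMonomial.IsFull.exists_isTypeVia (hx : IsFull x) :
    ∃ (ρ : PartitionFamily G) (k : _) (g : _),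
      IsTypeVia (omegaMonomial x) ρ (Finset.univ.filter fun p => m ≤ p.val) x k g := by
  let T := {t : Fin (m + l) // m ≤ t.val ∧ t ∉ pathSet x}
  have hreach : ∀ {t : Fin (m + l)}, m ≤ t.val → IsReachable x t → t ∈ pathSet x :=
    fun hlow ht => (mem_pathSet_iff hlow).2 ⟨ht, hx.isCoreachable hlow ht⟩
  have hprev : ∀ t : T, ∃ s : T, x.entry t.1 s.1 ≠ 0 := by
    rintro ⟨t, hlow, ht⟩
    obtain ⟨s, hs⟩ := (hx t hlow).1
    have hslow : m ≤ s.val := by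
      by_contra hlt
      obtain ⟨j, rfl⟩ := exists_castAdd_of_lt hlt
      exact ht (hreach hlow ⟨j, [], by simp, hs⟩)
    refine ⟨⟨s, hslow, fun h => ht (hreach hlow ?_)⟩, hs⟩
    exact ((mem_pathSet_iff hslow).1 h).1.step hslow hs
  choose prev hprev using hprev
  have hinj : Function.Injective prev := by
    intro s t hst
    have h := hprev s
    rw [hst] at h
    exact Subtype.ext (x.col_unique _ _ _ h (hprev t))
  -- An edge runs from column to row, so the permutation is the inverse of `prev`.
  let σ : Equiv.Perm T := (Equiv.ofBijective prev (Finite.injective_iff_bijective.1 hinj)).symm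
  have hσ : ∀ t, prev (σ t) = t := fun t =>
    (Equiv.ofBijective prev (Finite.injective_iff_bijective.1 hinj)).apply_symm_apply t
  let f : T → G := fun t => WithZero.unzero (hprev t)
  obtain ⟨ρ, e, he, hcls⟩ := exists_slots_equiv σ f
  let k : ρ.Slots ↪ Fin (m + l) := e.toEmbedding.trans (Function.Embedding.subtype _)
  have hg : ∀ z, Function.extend k (f ∘ e) 1 (k z) = f (e z) :=
    k.injective.extend_apply (f ∘ e) 1
  refine ⟨ρ, k, Function.extend k (f ∘ e) 1, hx, rfl, fun p => ?_, fun z => (e z).2.2,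
    fun z => (e z).2.1, fun z => ?_, fun z => ?_, fun p hp hpR => ?_⟩
  · rw [Finset.mem_filter]
    constructor
    · rintro ⟨-, hp⟩
      by_cases hpP : p ∈ pathSet x
      · exact Or.inl hpP
      · refine Or.inr ⟨e.symm ⟨p, hp, hpP⟩, ?_⟩
        change (e (e.symm _)).1 = p
        rw [Equiv.apply_symm_apply]
    · rintro (hp | ⟨z, rfl⟩)
      · exact ⟨Finset.mem_univ _, le_of_mem_pathSet hp⟩
      · exact ⟨Finset.mem_univ _, (e z).2.1⟩
  · rw [hg]
    have h1 : (f (e (ρ.shift z)) : WithZero G) =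
        x.entry (e (ρ.shift z)).1 (prev (e (ρ.shift z))).1 := WithZero.coe_unzero _
    rw [h1, he, hσ]
    change x.entry (e (ρ.shift z)).1 (e z).1 = _
    rw [he]
  · have h1 : Function.extend k (f ∘ e) 1 ∘ k = f ∘ e := funext hg
    rw [h1, hcls]
  · simp [hp] at hpR

/-- `Ω` is read off from `x`. Both cycle placements have range `R` minus the path set, and the
entries of `x` there determine the shift and its labels, hence lengths and classes. -/
theorem IsTypeVia.eq [Fintype G] {Ω Ω' : PartialMonomial m (G × Multiplicative ℕ)}
    {ρ ρ' : PartitionFamily G} {R : Finset (Fin (m + l))} {k : ρ.Slots ↪ Fin (m + l)}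
    {k' : ρ'.Slots ↪ Fin (m + l)} {g g' : Fin (m + l) → G} (h : IsTypeVia Ω ρ R x k g)
    (h' : IsTypeVia Ω' ρ' R x k' g') : Ω = Ω' ∧ ρ = ρ' := by
  refine ⟨PartialMonomial.ext (h.omega_eq.symm.trans h'.omega_eq), ?_⟩
  have hrange : Set.range k = Set.range k' := by
    have key : ∀ {Ω Ω' : PartialMonomial m (G × Multiplicative ℕ)}
        {ρ ρ' : PartitionFamily G} {k : ρ.Slots ↪ Fin (m + l)}
        {k' : ρ'.Slots ↪ Fin (m + l)} {g g' : Fin (m + l) → G} (_ : IsTypeVia Ω ρ R x k g)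
        (_ : IsTypeVia Ω' ρ' R x k' g'), Set.range k ⊆ Set.range k' := by
      rintro Ω Ω' ρ ρ' k k' g g' h h' _ ⟨z, rfl⟩
      have h1 := (h.mem_iff (k z)).2 (Or.inr ⟨z, rfl⟩)
      exact ((h'.mem_iff (k z)).1 h1).resolve_left (h.disj z)
    exact Set.Subset.antisymm (key h h') (key h' h)
  let τ : ρ.Slots ≃ ρ'.Slots := (Equiv.ofInjective k k.injective).trans
    ((Equiv.setCongr hrange).trans (Equiv.ofInjective k' k'.injective).symm)
  have hτ : ∀ z, k' (τ z) = k z := fun z =>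
    Equiv.apply_ofInjective_symm k'.injective ((Equiv.setCongr hrange) ⟨k z, z, rfl⟩)
  have hne : ∀ z, x.entry (k (ρ.shift z)) (k z) ≠ 0 := fun z => by
    rw [h.entry]
    exact WithZero.coe_ne_zero
  have hne' : ∀ z, x.entry (k' (ρ'.shift z)) (k' z) ≠ 0 := fun z => by
    rw [h'.entry]
    exact WithZero.coe_ne_zero
  have hstep : ∀ z, k' (ρ'.shift (τ z)) = k (ρ.shift z) := fun z => by
    have h1 := hne' (τ z)
    rw [hτ] at h1
    exact x.col_unique _ _ _ h1 (hne z)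
  have hshift : ∀ z, τ (ρ.shift z) = ρ'.shift (τ z) := fun z =>
    k'.injective (by rw [hτ, hstep])
  have hg : (g' ∘ k') ∘ τ = g ∘ k := by
    funext z
    obtain ⟨z, rfl⟩ := ρ.shift.surjective z
    have h1 := h'.entry (τ z)
    rw [hτ, hstep, h.entry, WithZero.coe_inj] at h1
    simp only [Function.comp_apply, hτ]
    exact h1.symm
  refine partitionFamily_eq_of_equiv τ (fun z => ?_) fun z => ?_
  · rw [← h'.cls, ← h.cls, orbitClass_semiconj τ.injective hshift, hg]
  · rw [← PartitionFamily.minimalPeriod_shift, ← PartitionFamily.minimalPeriod_shift,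
      minimalPeriod_semiconj τ.injective hshift]

open scoped Classical in
theorem isRepresenting_pattern (G : Type*) [Group G] [Fintype G] (m : ℕ) :
    IsRepresenting fun i : PartialMonomial m (G × Multiplicative ℕ) × PartitionFamily G =>
      pattern i.1 i.2 where
  isPattern i := isPattern_pattern
  exists_isCopy l x hx := by
    obtain ⟨ρ, k, g, h⟩ := hx.exists_isTypeVia
    exact ⟨(omegaMonomial x, ρ), h.isCopy⟩
  eq_of_isCopy l x i j hi hj := by
    obtain ⟨k, g, h, -⟩ := hi.exists_isTypeVia
    obtain ⟨k', g', h', -⟩ := hj.exists_isTypeVia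
    exact Prod.ext (h.eq h').1 (h.eq h').2

end Classification

end WreathCentralizer

namespace WreathCentralizer

open PartialMonomial

/-! ### The multiplicity-free elements as copy sums. -/

section Gluing

variable {G : Type*} [Group G] {m l n : ℕ} {Ω : PartialMonomial m (G × Multiplicative ℕ)}
  {ρ : PartitionFamily G}

theorem cyclePerm_apply (k : ρ.Slots ↪ Fin n) (z : ρ.Slots) :
    cyclePerm ρ k (k z) = k (ρ.shift z) :=
  Equiv.Perm.viaEmbedding_apply _ _ _

theorem cyclePerm_apply_of_notMem (k : ρ.Slots ↪ Fin n) {j : Fin n} (hj : j ∉ Set.range k) :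
    cyclePerm ρ k j = j :=
  Equiv.Perm.viaEmbedding_apply_of_notMem _ _ _ hj

theorem IsCycleData.mem_iff {T : Finset (Fin n)} {k : ρ.Slots ↪ Fin n} {g : Fin n → G}
    (h : IsCycleData ρ T k g) {j : Fin n} : j ∈ T ↔ ∃ z, k z = j := by
  rw [← Finset.mem_coe, ← h.1]
  rfl

theorem IsCycleData.cyclePerm_mem_iff {T : Finset (Fin n)} {k : ρ.Slots ↪ Fin n} {g : Fin n → G}
    (h : IsCycleData ρ T k g) {j : Fin n} : cyclePerm ρ k j ∈ T ↔ j ∈ T := by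
  by_cases hj : j ∈ T
  · obtain ⟨z, rfl⟩ := h.mem_iff.1 hj
    rw [cyclePerm_apply]
    simp [h.mem_iff]
  · have hj' : j ∉ Set.range k := by rwa [h.1]
    rw [cyclePerm_apply_of_notMem k hj']

theorem IsCycleData.map_cyclePerm {T : Finset (Fin n)} {k : ρ.Slots ↪ Fin n} {g : Fin n → G}
    (h : IsCycleData ρ T k g) : T.map (cyclePerm ρ k).toEmbedding = T := by
  ext j
  rw [Finset.mem_map_equiv, ← h.cyclePerm_mem_iff, Equiv.apply_symm_apply]

theorem IsCycleData.mul_entry_of_notMem {T : Finset (Fin n)} {k : ρ.Slots ↪ Fin n}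
    {g : Fin n → G} (h : IsCycleData ρ T k g) (γ : PartialMonomial n G) (i : Fin n) {j : Fin n}
    (hj : j ∉ T) : (γ * wreath g (cyclePerm ρ k)).entry i j = γ.entry i j := by
  have hj' : j ∉ Set.range k := by rwa [h.1]
  rw [mul_wreath_entry, cyclePerm_apply_of_notMem k hj', h.2.2 j hj, WithZero.coe_one, mul_one]

theorem IsCycleData.mul_entry_of_mem {T : Finset (Fin n)} {k : ρ.Slots ↪ Fin n}
    {g : Fin n → G} (h : IsCycleData ρ T k g) {γ : PartialMonomial n G}
    (hγ : ∀ t ∈ T, γ.entry t t = 1) (i : Fin n) {j : Fin n} (hj : j ∈ T) :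
    (γ * wreath g (cyclePerm ρ k)).entry i j = (wreath g (cyclePerm ρ k)).entry i j := by
  have h1 := hγ _ (h.cyclePerm_mem_iff.2 hj)
  rw [mul_wreath_entry, wreath_entry]
  split_ifs with hi
  · subst hi
    rw [h1, one_mul]
  · have : γ.entry i (cyclePerm ρ k j) = 0 := by
      by_contra hne
      exact hi (γ.col_unique _ _ _ (by rw [h1]; exact one_ne_zero) hne)
    rw [this, zero_mul]

theorem IsCycleData.wreath_entry_of_notMem {T : Finset (Fin n)} {k : ρ.Slots ↪ Fin n}
    {g : Fin n → G} (h : IsCycleData ρ T k g) (i : Fin n) {j : Fin n}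
    (hj : j ∉ T) : (wreath g (cyclePerm ρ k)).entry i j = (1 : PartialMonomial n G).entry i j := by
  rw [← h.mul_entry_of_notMem 1 i hj, one_mul]

/-- The idempotent `ε̄_T` may be doubled and one factor moved to the left: it passes the cycles,
which permute `T`, and then `γ`, which fixes `T`. -/
theorem sandwich_union {F : Type*} [Field F] {P T : Finset (Fin n)} (hPT : Disjoint P T)
    {γ : PartialMonomial n G} (hγ : ∀ t ∈ T, γ.entry t t = 1) {k : ρ.Slots ↪ Fin n}
    {g : Fin n → G} (h : IsCycleData ρ T k g) :
    epsBar F P * MonoidAlgebra.of F _ γ * MonoidAlgebra.of F _ (wreath g (cyclePerm ρ k)) *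
      epsBar F T * epsBar F P = sandwich F (P ∪ T) (γ * wreath g (cyclePerm ρ k)) := by
  have h1 : MonoidAlgebra.of F _ γ * epsBar F T = epsBar F T * MonoidAlgebra.of F _ γ := by
    have h0 : Commute (MonoidAlgebra.of F _ γ) (epsBar F T) := by
      refine commute_epsBar fun p hp => ?_
      rw [Commute, SemiconjBy, ← map_mul, ← map_mul, eps_mul_eq_mul_eps (hγ p hp)]
    exact h0.eq
  have h2 := of_wreath_mul_epsBar (F := F) g (cyclePerm ρ k) T
  rw [h.map_cyclePerm] at h2
  have e2 : epsBar F (G := G) (P ∪ T) = epsBar F T * epsBar F P := by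
    rw [Finset.union_comm, epsBar_union hPT.symm]
  calc _ = epsBar F P * (MonoidAlgebra.of F _ γ * (MonoidAlgebra.of F _ (wreath g (cyclePerm ρ k)) *
        epsBar F T)) * (epsBar F T * epsBar F P) := by
          conv_lhs => rw [← epsBar_mul_self T]
          simp only [mul_assoc]
    _ = epsBar F P * epsBar F T * (MonoidAlgebra.of F _ γ *
        MonoidAlgebra.of F _ (wreath g (cyclePerm ρ k))) * (epsBar F T * epsBar F P) := by
          rw [h2, ← mul_assoc (MonoidAlgebra.of F _ γ), h1]
          simp only [mul_assoc]
    _ = _ := by rw [sandwich, ← epsBar_union hPT, ← e2, map_mul]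

variable {P T : Finset (Fin (m + l))} {γ : PartialMonomial (m + l) G}
  {k : ρ.Slots ↪ Fin (m + l)} {g : Fin (m + l) → G}

theorem diag_of_mem_gammaSet (hlow : ∀ t ∈ T, m ≤ t.val) (hPT : Disjoint P T)
    (hγ : γ ∈ gammaSet Ω P) : ∀ t ∈ T, γ.entry t t = 1 := fun t ht =>
  hγ.2.2.2 t (hlow t ht) (Finset.disjoint_right.1 hPT ht)

/-- Columns outside `T` are those of `γ`, columns in `T` those of the cycles, and no edge joins the
two parts. So paths come from `γ` alone. -/
theorem isTypeVia_mul (hlow : ∀ t ∈ T, m ≤ t.val) (hPT : Disjoint P T) (hγ : γ ∈ gammaSet Ω P)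
    (h : IsCycleData ρ T k g) :
    IsTypeVia Ω ρ (P ∪ T) (γ * wreath g (cyclePerm ρ k)) k g ∧
      pathSet (γ * wreath g (cyclePerm ρ k)) = P := by
  set x := γ * wreath g (cyclePerm ρ k) with hx
  have hdiag := diag_of_mem_gammaSet hlow hPT hγ
  have hoff : ∀ i, ∀ j ∉ (T : Set (Fin (m + l))), x.entry i j = γ.entry i j := fun i j hj =>
    h.mul_entry_of_notMem γ i hj
  have hon : ∀ z, x.entry (k (ρ.shift z)) (k z) = (g (k (ρ.shift z)) : WithZero G) := by
    intro z
    rw [hx, h.mul_entry_of_mem hdiag _ (h.mem_iff.2 ⟨z, rfl⟩), wreath_entry,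
      if_pos (cyclePerm_apply k z)]
  have hT : ∀ i, ∀ j ∉ (T : Set (Fin (m + l))), x.entry i j ≠ 0 → i ∉ (T : Set (Fin (m + l))) := by
    intro i j hj hij hi
    rw [hoff i j hj] at hij
    have h1 : j = i := γ.row_unique i j i hij (by rw [hdiag i hi]; exact one_ne_zero)
    exact hj (h1.symm ▸ hi)
  have hpath : pathSet x = P := (pathSet_congr hlow hoff hT).trans hγ.2.2.1
  refine ⟨⟨fun p hp => ?_, (omega_congr hlow hoff hT).trans hγ.2.1, fun p => ?_, fun z hz => ?_,
    fun z => hlow _ (h.mem_iff.2 ⟨z, rfl⟩), hon, ?_, fun p hp hpR => ?_⟩, hpath⟩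
  · by_cases hpT : p ∈ T
    · obtain ⟨z, rfl⟩ := h.mem_iff.1 hpT
      refine ⟨⟨k (ρ.shift.symm z), ?_⟩, ⟨k (ρ.shift z), ?_⟩⟩
      · have h1 := hon (ρ.shift.symm z)
        rw [Equiv.apply_symm_apply] at h1
        rw [h1]
        exact WithZero.coe_ne_zero
      · rw [hon]
        exact WithZero.coe_ne_zero
    · obtain ⟨⟨j, hj⟩, ⟨i, hi⟩⟩ := hγ.1 p hp
      refine ⟨⟨j, ?_⟩, ⟨i, ?_⟩⟩
      · rw [hoff p j fun hjT => hpT ?_]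
        · exact hj
        · have h1 : p = j := γ.col_unique p j j hj (by rw [hdiag j hjT]; exact one_ne_zero)
          rwa [h1]
      · rwa [hoff i p hpT]
  · rw [Finset.mem_union, hpath, h.1]
    rfl
  · rw [hpath] at hz
    exact Finset.disjoint_left.1 hPT hz (h.mem_iff.2 ⟨z, rfl⟩)
  · exact (PartitionFamily.forall_prod_iff (g ∘ k)).1 h.2.1
  · rw [Finset.mem_union, not_or] at hpR
    rw [hoff p p hpR.2, hγ.2.2.2 p hp hpR.1]

/-- Multiplying `x` by the inverse of its cycle part turns every cycle into fixed points with label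
`1` and leaves the paths alone. -/
theorem IsTypeVia.exists_eq_mul {R : Finset (Fin (m + l))} {x : PartialMonomial (m + l) G}
    (hx : IsTypeVia Ω ρ R x k g) (hg : ∀ p ∉ Set.range k, g p = 1)
    (hP : (P : Set (Fin (m + l))) = pathSet x) (hT : (T : Set (Fin (m + l))) = Set.range k) :
    IsCycleData ρ T k g ∧ ∃ γ ∈ gammaSet Ω P, γ * wreath g (cyclePerm ρ k) = x := by
  have hd : IsCycleData ρ T k g :=
    ⟨hT.symm, (PartitionFamily.forall_prod_iff (g ∘ k)).2 hx.cls, fun j hj => hg j (by rwa [← hT])⟩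
  refine ⟨hd, ?_⟩
  let γ : PartialMonomial (m + l) G :=
    x * ↑(wreathUnit g (cyclePerm ρ k))⁻¹
  have hγx : γ * wreath g (cyclePerm ρ k) = x := (wreathUnit g (cyclePerm ρ k)).inv_mul_cancel_right x
  have hlow : ∀ p ∈ (T : Set (Fin (m + l))), m ≤ p.val := by
    rw [hT]
    rintro _ ⟨z, rfl⟩
    exact hx.lower z
  have hoff : ∀ i, ∀ j ∉ (T : Set (Fin (m + l))), x.entry i j = γ.entry i j := fun i j hj => by
    rw [← hd.mul_entry_of_notMem γ i hj, hγx]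
  have hne : ∀ z, x.entry (k (ρ.shift z)) (k z) ≠ 0 := fun z => by
    rw [hx.entry]
    exact WithZero.coe_ne_zero
  have hTx : ∀ i, ∀ j ∉ (T : Set (Fin (m + l))), x.entry i j ≠ 0 →
      i ∉ (T : Set (Fin (m + l))) := by
    rw [hT]
    rintro _ j hj hij ⟨z, rfl⟩
    have h1 := hne (ρ.shift.symm z)
    rw [Equiv.apply_symm_apply] at h1
    exact hj ⟨_, (x.row_unique _ _ _ hij h1).symm⟩
  have hdiag : ∀ t ∈ T, γ.entry t t = 1 := by
    intro t ht
    obtain ⟨z, rfl⟩ := hd.mem_iff.1 ht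
    obtain ⟨z, rfl⟩ := ρ.shift.surjective z
    have h1 := hx.entry z
    rw [← hγx, mul_wreath_entry, cyclePerm_apply] at h1
    have h2 := congrArg (fun w => w * ((g (k (ρ.shift z)))⁻¹ : WithZero G)) h1
    simpa [mul_assoc] using h2
  refine ⟨γ, ⟨fun p hp => ?_, ?_, ?_, fun p hp hpP => ?_⟩, hγx⟩
  · by_cases hpT : p ∈ T
    · have : γ.entry p p ≠ 0 := by rw [hdiag p hpT]; exact one_ne_zero
      exact ⟨⟨p, this⟩, ⟨p, this⟩⟩
    · obtain ⟨⟨j, hj⟩, ⟨i, hi⟩⟩ := hx.full p hp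
      refine ⟨⟨j, ?_⟩, ⟨i, ?_⟩⟩
      · rw [← hoff p j]
        · exact hj
        · rw [hT]
          rintro ⟨z, rfl⟩
          exact hpT (hd.mem_iff.2 ⟨ρ.shift z, x.col_unique _ _ _ (hne z) hj⟩)
      · rwa [← hoff i p hpT]
  · rw [← omega_congr hlow hoff hTx, hx.omega_eq]
  · rw [← pathSet_congr hlow hoff hTx, hP]
  · by_cases hpT : p ∈ T
    · exact hdiag p hpT
    · rw [← hoff p p hpT]
      refine hx.diag p hp fun hpR => ?_
      rcases (hx.mem_iff p).1 hpR with h1 | h1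
      · rw [← hP] at h1
        exact hpP h1
      · rw [← hT] at h1
        exact hpT h1

variable [Fintype G] (F : Type*) [Field F]

/-- The summands `(P, T, γ, c)` correspond bijectively to copies by `R = P ∪ T`, `x = γ c`.
Conversely `P` is the path set of `x`, `T` is the rest of `R`, and `c` consists of the columns of
`x` in `T`. Bijectivity needs each `c` to be counted once. -/
theorem reducedDelta_eq_copySum (Ω : PartialMonomial m (G × Multiplicative ℕ))
    (ρ : PartitionFamily G) (l : ℕ) : reducedDelta F Ω ρ l = copySum F (pattern Ω ρ) l := by
  classical
  rw [reducedDelta, deltaSum, copySum]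
  simp only [reducedCycleSum, Finset.mul_sum, Finset.sum_mul]
  rw [Finset.sum_sigma', Finset.sum_sigma']
  refine Finset.sum_bij (fun q _ => (q.1.1.1 ∪ q.1.1.2, q.1.2 * q.2)) ?_ ?_ ?_ ?_
  · rintro ⟨⟨⟨P, T⟩, γ⟩, c⟩ hq
    simp only [Finset.mem_sigma, Finset.mem_filter, Finset.mem_univ, true_and,
      Finset.mem_union] at hq ⊢
    obtain ⟨⟨⟨hlow, hPT, -, -⟩, hγ⟩, k, g, hd, rfl⟩ := hq
    exact (isTypeVia_mul (fun t ht => hlow t (Or.inr ht)) hPT hγ hd).1.isCopy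
  · rintro ⟨⟨⟨P, T⟩, γ⟩, c⟩ hq ⟨⟨⟨P', T'⟩, γ'⟩, c'⟩ hq' heq
    simp only [Finset.mem_sigma, Finset.mem_filter, Finset.mem_univ, true_and,
      Finset.mem_union] at hq hq' heq
    obtain ⟨⟨⟨hlow, hPT, -, -⟩, hγ⟩, k, g, hd, rfl⟩ := hq
    obtain ⟨⟨⟨hlow', hPT', -, -⟩, hγ'⟩, k', g', hd', rfl⟩ := hq'
    rw [Prod.mk.injEq] at heq
    obtain ⟨hR, hx⟩ := heq
    have hlowT : ∀ t ∈ T, m ≤ t.val := fun t ht => hlow t (Or.inr ht)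
    have hlowT' : ∀ t ∈ T', m ≤ t.val := fun t ht => hlow' t (Or.inr ht)
    obtain rfl : P = P' := by
      have h1 := (isTypeVia_mul hlowT hPT hγ hd).2
      have h2 := (isTypeVia_mul hlowT' hPT' hγ' hd').2
      rw [hx, h2] at h1
      exact (Finset.coe_injective h1).symm
    obtain rfl : T = T' := by
      rw [← Finset.union_sdiff_cancel_left hPT, hR, Finset.union_sdiff_cancel_left hPT']
    have hc : wreath g (cyclePerm ρ k) = wreath g' (cyclePerm ρ k') := by
      apply PartialMonomial.ext
      funext i j
      by_cases hj : j ∈ T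
      · rw [← hd.mul_entry_of_mem (diag_of_mem_gammaSet hlowT hPT hγ) i hj, hx,
          hd'.mul_entry_of_mem (diag_of_mem_gammaSet hlowT' hPT' hγ') i hj]
      · rw [hd.wreath_entry_of_notMem i hj, hd'.wreath_entry_of_notMem i hj]
    rw [hc] at hx
    obtain rfl := (wreathUnit g' (cyclePerm ρ k')).mul_left_inj.1 hx
    rw [hc]
  · rintro ⟨R, x⟩ hq
    rw [Finset.mem_filter] at hq
    obtain ⟨k, g, hx, hg⟩ := hq.2.exists_isTypeVia
    let P : Finset (Fin (m + l)) := Finset.univ.filter fun p => p ∈ pathSet x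
    let T : Finset (Fin (m + l)) := Finset.univ.map k
    have hP : (P : Set (Fin (m + l))) = pathSet x := by ext; simp [P]
    have hT : (T : Set (Fin (m + l))) = Set.range k := by ext; simp [T]
    have hR : P ∪ T = R := by
      ext p
      rw [hx.mem_iff, Finset.mem_union, ← hP, ← hT]
      rfl
    have hPT : Disjoint P T := by
      rw [Finset.disjoint_right]
      intro p hpT hpP
      obtain ⟨z, -, rfl⟩ := Finset.mem_map.1 hpT
      exact hx.disj z (Finset.mem_filter.1 hpP).2
    have hTcard : T.card = ρ.norm := by
      rw [Finset.card_map, Finset.card_univ, card_slots]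
    have hPcard : P.card = Ω.ord := by
      have h1 := hq.2.card
      rw [← hR, Finset.card_union_of_disjoint hPT, hTcard, Fintype.card_sum, card_pathSlots,
        card_slots] at h1
      exact Nat.add_right_cancel h1
    obtain ⟨hd, γ, hγ, hγx⟩ := hx.exists_eq_mul hg hP hT
    refine ⟨⟨⟨(P, T), γ⟩, wreath g (cyclePerm ρ k)⟩, ?_, Prod.ext hR hγx⟩
    simp only [Finset.mem_sigma, Finset.mem_filter, Finset.mem_univ, true_and]
    refine ⟨⟨⟨fun p hp => ?_, hPT, hPcard, hTcard⟩, hγ⟩, k, g, hd, rfl⟩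
    rw [hR] at hp
    exact hq.2.le_of_mem hp
  · rintro ⟨⟨⟨P, T⟩, γ⟩, c⟩ hq
    simp only [Finset.mem_sigma, Finset.mem_filter, Finset.mem_univ, true_and,
      Finset.mem_union] at hq
    obtain ⟨⟨⟨hlow, hPT, -, -⟩, hγ⟩, k, g, hd, rfl⟩ := hq
    exact sandwich_union hPT (diag_of_mem_gammaSet (fun t ht => hlow t (Or.inr ht)) hPT hγ) hd

end Gluing

end WreathCentralizer

namespace WreathCentralizer

open PartialMonomial

/-! ### Multiplicities in `C^ρ`. -/

section Multiplicity

variable {G : Type*} [Group G] {n : ℕ} {ρ : PartitionFamily G}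

theorem wreath_injective {g g' : Fin n → G} {σ σ' : Equiv.Perm (Fin n)}
    (h : wreath g σ = wreath g' σ') : g = g' ∧ σ = σ' := by
  have key : ∀ j, σ' j = σ j ∧ g (σ j) = g' (σ j) := by
    intro j
    have h1 := congrArg (fun x => PartialMonomial.entry x (σ j) j) h
    simp only [wreath_entry, if_true] at h1
    split_ifs at h1 with h2
    · exact ⟨h2, WithZero.coe_inj.1 h1⟩
    · exact absurd h1 WithZero.coe_ne_zero
  refine ⟨funext fun i => ?_, Equiv.ext fun j => (key j).1.symm⟩
  have := (key (σ.symm i)).2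
  rwa [Equiv.apply_symm_apply] at this

/-- The permutations of the slots that commute with the cyclic shift and preserve the classes. -/
abbrev PartitionFamily.Symmetry (ρ : PartitionFamily G) : Type _ :=
  {τ : Equiv.Perm ρ.Slots // ∀ z, τ (ρ.shift z) = ρ.shift (τ z) ∧ (τ z).1 = z.1}

instance (ρ : PartitionFamily G) : Nonempty ρ.Symmetry := ⟨⟨1, fun _ => ⟨rfl, rfl⟩⟩⟩

theorem cyclePerm_symmetry (k : ρ.Slots ↪ Fin n) (τ : ρ.Symmetry) :
    cyclePerm ρ (τ.1.toEmbedding.trans k) = cyclePerm ρ k := by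
  ext1 j
  by_cases hj : j ∈ Set.range k
  · obtain ⟨z, rfl⟩ := hj
    have h1 := cyclePerm_apply (τ.1.toEmbedding.trans k) (τ.1.symm z)
    have h2 := (τ.2 (τ.1.symm z)).1
    simp only [Function.Embedding.trans_apply, Equiv.coe_toEmbedding, Equiv.apply_symm_apply,
      h2] at h1
    rw [h1, cyclePerm_apply]
  · rw [cyclePerm_apply_of_notMem k hj, cyclePerm_apply_of_notMem]
    rintro ⟨z, rfl⟩
    exact hj ⟨τ.1 z, rfl⟩

theorem orbitClass_symmetry (f : ρ.Slots → G) (τ : ρ.Slots ≃ ρ.Slots)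
    (hτ : ∀ z, τ (ρ.shift z) = ρ.shift (τ z)) (z : ρ.Slots) :
    orbitClass ρ.shift (f ∘ τ) z = orbitClass ρ.shift f (τ z) :=
  (orbitClass_semiconj τ.injective hτ f z).symm

theorem IsCycleData.symmetry {T : Finset (Fin n)} {k : ρ.Slots ↪ Fin n} {g : Fin n → G}
    (h : IsCycleData ρ T k g) (τ : ρ.Symmetry) :
    IsCycleData ρ T (τ.1.toEmbedding.trans k) g := by
  refine ⟨?_, (PartitionFamily.forall_prod_iff (g ∘ (τ.1.toEmbedding.trans k))).2 fun z => ?_,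
    h.2.2⟩
  · rw [← h.1]
    exact τ.1.surjective.range_comp k
  · have h1 := (PartitionFamily.forall_prod_iff (g ∘ k)).1 h.2.1 (τ.1 z)
    rw [← (τ.2 z).2, ← h1]
    exact orbitClass_symmetry (g ∘ k) τ.1 (fun z => (τ.2 z).1) z

/-- Two fillings with the same range differ by a permutation of the slots. It commutes with the
shift because the cycle permutations agree, and it preserves classes because the cycle products
agree. -/
theorem IsCycleData.exists_symmetry {T : Finset (Fin n)} {k k' : ρ.Slots ↪ Fin n} {g : Fin n → G}
    (h : IsCycleData ρ T k g) (h' : IsCycleData ρ T k' g) (hk : cyclePerm ρ k' = cyclePerm ρ k) :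
    ∃ τ : ρ.Symmetry, τ.1.toEmbedding.trans k = k' := by
  let τ : Equiv.Perm ρ.Slots := (Equiv.ofInjective k' k'.injective).trans
    ((Equiv.setCongr (h'.1.trans h.1.symm)).trans (Equiv.ofInjective k k.injective).symm)
  have hτ : ∀ z, k (τ z) = k' z := fun z => Equiv.apply_ofInjective_symm k.injective _
  have hcomm : ∀ z, τ (ρ.shift z) = ρ.shift (τ z) := fun z => k.injective <| by
    rw [hτ, ← cyclePerm_apply, ← cyclePerm_apply, hτ, hk]
  refine ⟨⟨τ, fun z => ⟨hcomm z, ?_⟩⟩, Function.Embedding.ext hτ⟩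
  have h1 := (PartitionFamily.forall_prod_iff (g ∘ k)).1 h.2.1 (τ z)
  have h2 := (PartitionFamily.forall_prod_iff (g ∘ k')).1 h'.2.1 z
  rw [← h1, ← h2, ← orbitClass_symmetry (g ∘ k) τ hcomm]
  congr 1
  funext z
  exact congrArg g (hτ z)

variable (F : Type*) [Field F] [Fintype G]

/-- Every element of `G_n` occurs in `C^ρ_{n,T}` with the same multiplicity. -/
theorem cycleSum_eq_smul (ρ : PartitionFamily G) (T : Finset (Fin n)) :
    cycleSum F ρ T = (Nat.card ρ.Symmetry : F) • reducedCycleSum F ρ T := by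
  classical
  rw [cycleSum, reducedCycleSum, Finset.sum_sigma', Finset.smul_sum]
  rw [← Finset.sum_fiberwise_of_maps_to (g := fun q : Σ _ : ρ.Slots ↪ Fin n, Fin n → G =>
    wreath q.2 (cyclePerm ρ q.1)) (t := Finset.univ.filter (fun γ : PartialMonomial n G =>
      ∃ k g, IsCycleData ρ T k g ∧ γ = wreath g (cyclePerm ρ k)))]
  · refine Finset.sum_congr rfl fun γ hγ => ?_
    obtain ⟨k, g, h, rfl⟩ := (Finset.mem_filter.1 hγ).2
    rw [Finset.sum_congr rfl (g := fun _ => MonoidAlgebra.of F _ (wreath g (cyclePerm ρ k)))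
      fun q hq => by rw [(Finset.mem_filter.1 hq).2], Finset.sum_const, ← Nat.cast_smul_eq_nsmul F]
    congr 2
    rw [Nat.card_eq_fintype_card, ← Finset.card_univ]
    -- The symmetries act simply transitively on the fillings giving a fixed element of `G_n`, since
    -- `g` is determined by that element.
    refine (Finset.card_bij (fun τ _ => ⟨τ.1.toEmbedding.trans k, g⟩) (fun τ _ => ?_)
      (fun τ _ τ' _ hττ => ?_) ?_).symm
    · simp only [Finset.mem_filter, Finset.mem_sigma, Finset.mem_univ, true_and]
      exact ⟨h.symmetry τ, by rw [cyclePerm_symmetry]⟩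
    · rw [Sigma.mk.injEq] at hττ
      exact Subtype.ext (Equiv.ext fun z => k.injective (DFunLike.congr_fun hττ.1 z))
    · rintro ⟨k', g'⟩ hq
      simp only [Finset.mem_filter, Finset.mem_sigma, Finset.mem_univ, true_and] at hq
      obtain ⟨rfl, hσ⟩ := wreath_injective hq.2
      obtain ⟨τ, rfl⟩ := h.exists_symmetry hq.1 hσ
      exact ⟨τ, Finset.mem_univ _, rfl⟩
  · rintro ⟨k, g⟩ hq
    simp only [Finset.mem_filter, Finset.mem_sigma, Finset.mem_univ, true_and] at hq ⊢
    exact ⟨k, g, hq, rfl⟩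

theorem delta_eq_smul {m : ℕ} (Ω : PartialMonomial m (G × Multiplicative ℕ))
    (ρ : PartitionFamily G) :
    delta F Ω ρ = (Nat.card ρ.Symmetry : F) • reducedDelta F Ω ρ := by
  funext l
  rw [Pi.smul_apply, delta, reducedDelta, deltaSum, deltaSum, Finset.smul_sum]
  refine Finset.sum_congr rfl fun PT _ => ?_
  rw [Finset.smul_sum]
  refine Finset.sum_congr rfl fun γ _ => ?_
  rw [cycleSum_eq_smul, mul_smul_comm, smul_mul_assoc, smul_mul_assoc]

end Multiplicity

/-! ### Conclusion. -/

section Bases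

variable {F : Type*} [Field F] {G : Type*} [Group G] [Fintype G] {m : ℕ}

theorem IsFilteredBasis.smul {D D' : PartialMonomial m (G × Multiplicative ℕ) → PartitionFamily G →
      ∀ l : ℕ, MonoidAlgebra F (PartialMonomial (m + l) G)} (hD : IsFilteredBasis F G m D)
    (c : PartitionFamily G → F) (hc : ∀ ρ, c ρ ≠ 0) (h : ∀ Ω ρ, D' Ω ρ = c ρ • D Ω ρ) :
    IsFilteredBasis F G m D' := by
  refine ⟨?_, fun k => ?_⟩
  · obtain ⟨b, hb⟩ := hD.1
    refine ⟨b.isUnitSMul (w := fun i => c i.2) fun i => (hc i.2).isUnit, fun i => ?_⟩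
    rw [Module.Basis.isUnitSMul_apply, h, ← hb]
    rfl
  · obtain ⟨b, hb⟩ := hD.2 k
    refine ⟨b.isUnitSMul (w := fun i => c i.1.2) fun i => (hc i.1.2).isUnit, fun i => ?_⟩
    rw [Module.Basis.isUnitSMul_apply, h, ← hb]
    rfl

variable (F G m)

theorem isFilteredBasis_reducedDelta : IsFilteredBasis F G m (reducedDelta F) := by
  classical
  have hN := isRepresenting_pattern G m
  have hcard : ∀ i : PartialMonomial m (G × Multiplicative ℕ) × PartitionFamily G,
      Fintype.card (PathSlots i.1 ⊕ i.2.Slots) = i.1.ord + i.2.norm := by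
    intro i
    rw [Fintype.card_sum, card_pathSlots, card_slots]
  refine ⟨?_, fun k => ?_⟩
  · obtain ⟨b, hb⟩ := hN.exists_basis F
    refine ⟨b, fun i => ?_⟩
    rw [hb]
    exact funext fun l => (reducedDelta_eq_copySum F i.1 i.2 l).symm
  · obtain ⟨b, hb⟩ := hN.exists_basis_mdegFiltration F k
    refine ⟨b.reindex (Equiv.subtypeEquivRight fun i => by rw [hcard]), fun i => ?_⟩
    rw [Module.Basis.reindex_apply, hb]
    exact funext fun l => (reducedDelta_eq_copySum F i.1.1 i.1.2 l).symm

theorem isFilteredBasis_delta [CharZero F] : IsFilteredBasis F G m (delta F) :=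
  (isFilteredBasis_reducedDelta F G m).smul (fun ρ => (Nat.card ρ.Symmetry : F))
    (fun ρ => by
      classical
      -- The symmetries form a finite nonempty set, so their number is nonzero in characteristic
      -- zero.
      exact Nat.cast_ne_zero.2 Nat.card_pos.ne') (delta_eq_smul F)

end Bases

end WreathCentralizer

theorem mainTheorem2 (F : Type*) [Field F] (G : Type*) [Group G] [Fintype G] (m : ℕ)
    (hm : 0 < m) :
    (CharZero F → WreathCentralizer.IsFilteredBasis F G m (WreathCentralizer.delta F)) ∧
    WreathCentralizer.IsFilteredBasis F G m (WreathCentralizer.reducedDelta F) :=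
  ⟨fun _ => WreathCentralizer.isFilteredBasis_delta F G m,
    WreathCentralizer.isFilteredBasis_reducedDelta F G m⟩
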